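/- Let $\delta=1/N$ with $N\ge 36$ an integer, let $\hat y>1/\delta^{12}$ be an integer, and put $\alpha=\hat y/\delta^{34}$. **Instance.** There are $n$ jobs and $m$ machines. Job $j$ has size $p_j$, weight $w_j$ and release date $r_j$, machine $\ell$ has speed $s_\ell$, and all these numbers are integer powers of $1+\delta$; the density of $j$ is $w_j/p_j$. A job $j$ that is run on machine $\ell$ with completion time $C_j$ occupies $[C_j-p_j/s_\ell,\,C_j)$. A schedule is feasible if no job starts before its release date and no two jobs overlap on a machine; it is timely if moreover every job $j$ on a machine $\ell$ starts no earlier than $\delta p_j/s_\ell$. All times are rational. Costs are pseudo-costs: a job with $C_j\in[(1+\delta)^q,(1+\delta)^{q+1})$, $q\in\mathbb Z$, costs $w_j(1+\delta)^{q+1}$. **Bands.** Let $(1+\delta)^\theta$ be the smallest release date. For $i\ge 0$ and $0\le k\le \alpha/\delta$ let $\Psi_{i,k}=(1+\delta)^{\theta+\lceil\log_{1+\delta}\alpha^{k+i\alpha/\delta}\rceil}$, and let $\Psi_{-1,k}=(1+\delta)^\theta$. Fix an integer $k$ with $0\le k<\alpha/\delta$. The instance $A_k$ arises by raising every release date in $[\Psi_{i,k},\Psi_{i,k+1})$,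 for any $i\ge 0$, to $\Psi_{i,k+1}$. For $i\ge 0$ the sub-instance $A_{ik}$ consists of all the machines and of the jobs whose release date in $A_k$ lies in $[\Psi_{i-1,k+1},\Psi_{i,k})$. **Hypotheses.** For every $i\ge0$ let $sol_{ik}$ be a timely schedule of $A_{ik}$ that satisfies the following with $\Psi=\Psi_{i,k}$. 1. (Density decay.) On every machine, the jobs that start after $\Psi$ are run in non-increasing order of density; and for some integer power $\Psi'$ of $1+\delta$ in $\left(\frac{\Psi\alpha}{1+\delta},\Psi\alpha(1+\delta)\right)$, whenever two jobs $j,j'$ run on the same machine, $j$ starts at time $\Psi'/2$ or later, and $C_{j'}\ge C_j+\Psi\hat y/\delta^{28}$, the density of $j'$ is at most $(1+\delta)^{-\hat y}$ times the density of $j$. 2. (No large jobs.) Every job assigned to a machine of speed $\sigma$ has size at most $\Psi\,\sigma\,\hat y/\delta^{25}$. **Conclusion.** There is one deterministic algorithm, independent of all the data, which, given $N,\hat y,k$, the instance, the schedules $sol_{ik}$ for all $i$, and a machine $\ell$, computes a feasible schedule on machine $\ell$, with respect to the release dates of $A_k$, of exactly the jobs in $\bigcup_i S_i$, where $S_i$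 is the set of jobs that $sol_{ik}$ assigns to $\ell$. The cost of this schedule is at most $(1+\delta)^2\sum_i c_i$, where $c_i$ is the cost of the jobs of $S_i$ in $sol_{ik}$. The algorithm runs in polynomial time: all numbers being given exactly in binary (rational numbers as numerator and denominator), it takes at most $f(N,\hat y)\cdot L^{c}$ steps on an input of length $L$, for a function $f$ and an exponent $c$ that do not depend on the input, steps being counted at bit cost. -/

import Mathlib

noncomputable section

namespace Sched

/-! ### A machine model with a bit-cost step count -/

/-- Data: binary trees whose leaves carry integers, written in binary. -/
inductive Val where
  | num (z : ℤ) : Val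
  | pair (a b : Val) : Val

/-- The length of a datum: the number of bits of its integers plus the number of its nodes. -/
def Val.size : Val → ℕ
  | .num z => Nat.size z.natAbs + 1
  | .pair a b => a.size + b.size + 1

/-- Primitive operations. -/
inductive Prim where
  | id | const (z : ℤ) | fst | snd | isPair | add | sub | mul | div | le

/-- The value of a primitive operation; `num 0` stands for `false`, and for the result on data
of the wrong shape. Division is integer division with nonnegative remainder. -/
def Prim.eval : Prim → Val → Val
  | .id, x => x
  | .const z, _ => .num z
  | .fst, .pair a _ => a
  | .snd, .pair _ b => b
  | .isPair, .pair _ _ => .num 1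
  | .add, .pair (.num a) (.num b) => .num (a + b)
  | .sub, .pair (.num a) (.num b) => .num (a - b)
  | .mul, .pair (.num a) (.num b) => .num (a * b)
  | .div, .pair (.num a) (.num b) => .num (a / b)
  | .le, .pair (.num a) (.num b) => .num (if a ≤ b then 1 else 0)
  | _, _ => .num 0

/-- Programs: a primitive operation; form the pair of two results; run `f`, then `g`;
branch on a test; repeat `f` while a test is true. -/
inductive Prog where
  | prim (o : Prim) : Prog
  | pair (f g : Prog) : Prog
  | comp (g f : Prog) : Prog
  | cond (c f g : Prog) : Prog
  | loop (c f : Prog) : Prog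

/-- `p.Runs x y t`: started on `x`, the program `p` halts with result `y` after `t` steps.
A primitive operation on a datum of length `s` is charged `s ^ 2` steps (enough for schoolbook
multiplication and division), and copying a datum of length `s` is charged `s` steps. -/
inductive Prog.Runs : Prog → Val → Val → ℕ → Prop where
  | prim (o : Prim) (x : Val) : Runs (.prim o) x (o.eval x) (x.size ^ 2)
  | pair {f g : Prog} {x a b : Val} {s t : ℕ} (hf : Runs f x a s) (hg : Runs g x b t) :
      Runs (.pair f g) x (.pair a b) (s + t + x.size)
  | comp {f g : Prog} {x y z : Val} {s t : ℕ} (hf : Runs f x y s) (hg : Runs g y z t) :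
      Runs (.comp g f) x z (s + t + 1)
  | cond_true {c f g : Prog} {x v y : Val} {s t : ℕ} (hc : Runs c x v s) (hv : v ≠ .num 0)
      (hf : Runs f x y t) : Runs (.cond c f g) x y (s + t + x.size)
  | cond_false {c f g : Prog} {x y : Val} {s t : ℕ} (hc : Runs c x (.num 0) s)
      (hg : Runs g x y t) : Runs (.cond c f g) x y (s + t + x.size)
  | loop_stop {c f : Prog} {x : Val} {s : ℕ} (hc : Runs c x (.num 0) s) :
      Runs (.loop c f) x x (s + x.size)
  | loop_step {c f : Prog} {x v y z : Val} {s t u : ℕ} (hc : Runs c x v s) (hv : v ≠ .num 0)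
      (hf : Runs f x y t) (hl : Runs (.loop c f) y z u) :
      Runs (.loop c f) x z (s + t + u + x.size)

/-! ### Instances and schedules. Throughout `δ = 1 / N`. -/

/-- The base `1 + δ` with `δ = 1 / N`. -/
def base (N : ℕ) : ℚ := 1 + 1 / (N : ℚ)

/-- An instance with `n` jobs and `m` machines in which all sizes, weights, release dates and
speeds are integer powers of `1 + δ`, given by the exponents. -/
structure Instance (n m : ℕ) where
  sizeExp : Fin n → ℤ
  weightExp : Fin n → ℤ
  releaseExp : Fin n → ℤ
  speedExp : Fin m → ℤ

/-- A machine and a completion time for every job. -/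
structure Schedule (n m : ℕ) where
  machine : Fin n → Fin m
  completion : Fin n → ℚ

variable {n m : ℕ}

namespace Instance

def size (I : Instance n m) (N : ℕ) (j : Fin n) : ℚ := base N ^ I.sizeExp j
def weight (I : Instance n m) (N : ℕ) (j : Fin n) : ℚ := base N ^ I.weightExp j
def release (I : Instance n m) (N : ℕ) (j : Fin n) : ℚ := base N ^ I.releaseExp j
def speed (I : Instance n m) (N : ℕ) (l : Fin m) : ℚ := base N ^ I.speedExp l

/-- The density of a job: its weight divided by its size. -/
def density (I : Instance n m) (N : ℕ) (j : Fin n) : ℚ := I.weight N j / I.size N j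

/-- The exponent `θ` of the smallest release date. -/
def theta (I : Instance n m) : ℤ := ⨅ j, I.releaseExp j

end Instance

/-! ### The release-date bands -/

/-- `α = y / δ ^ 34`. -/
def alpha (N y : ℕ) : ℕ := y * N ^ 34

/-- `α / δ`, the number of possible shifts `k`. -/
def shifts (N y : ℕ) : ℕ := alpha N y * N

/-- `Q_{i,k} = θ + ⌈log_{1+δ} α ^ (k + i α / δ)⌉` for `i ≥ 0`, and `Q_{-1,k} = θ`. For
`k = α / δ` the formula gives `Q_{i+1,0}`. -/
def Q (I : Instance n m) (N y : ℕ) (i : ℤ) (k : ℕ) : ℤ :=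
  if i < 0 then I.theta
  else I.theta +
    ⌈Real.logb ((base N : ℚ) : ℝ) ((alpha N y : ℝ) ^ (k + i.toNat * shifts N y))⌉

/-- `Ψ_{i,k} = (1 + δ) ^ Q_{i,k}`. -/
def Psi (I : Instance n m) (N y : ℕ) (i : ℤ) (k : ℕ) : ℚ := base N ^ Q I N y i k

open Classical in
/-- Release dates of the instance `A_k`: a release date in `[Ψ_{i,k}, Ψ_{i,k+1})` for some
`i ≥ 0` is raised to `Ψ_{i,k+1}` (these intervals are disjoint); all others are kept. -/
def releaseK (I : Instance n m) (N y k : ℕ) (j : Fin n) : ℚ :=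
  if h : ∃ i : ℕ, Psi I N y i k ≤ I.release N j ∧ I.release N j < Psi I N y i (k + 1)
  then Psi I N y (h.choose : ℕ) (k + 1)
  else I.release N j

open Classical in
/-- The job set of the sub-instance `A_{ik}`: the jobs of `A_k` that are released in the band
`[Ψ_{i-1,k+1}, Ψ_{i,k})`. -/
def band (I : Instance n m) (N y k i : ℕ) : Finset (Fin n) :=
  Finset.univ.filter fun j =>
    Psi I N y ((i : ℤ) - 1) (k + 1) ≤ releaseK I N y k j ∧ releaseK I N y k j < Psi I N y i k

/-! ### Feasibility and cost -/

/-- The starting time on machine `l` of a job with completion time `C j`. -/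
def startOn (I : Instance n m) (N : ℕ) (l : Fin m) (C : Fin n → ℚ) (j : Fin n) : ℚ :=
  C j - I.size N j / I.speed N l

/-- The completion times `C` of the jobs in `J` form a feasible schedule on machine `l` for the
release dates `r`: no job starts before its release date, and no two jobs overlap. -/
def FeasibleOn (I : Instance n m) (N : ℕ) (r : Fin n → ℚ) (l : Fin m) (J : Finset (Fin n))
    (C : Fin n → ℚ) : Prop :=
  (∀ j ∈ J, r j ≤ startOn I N l C j) ∧
  ∀ j ∈ J, ∀ j' ∈ J, j ≠ j' → C j ≤ startOn I N l C j' ∨ C j' ≤ startOn I N l C j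

/-- The upper end `(1 + δ) ^ (q + 1)` of the interval `[(1 + δ) ^ q, (1 + δ) ^ (q + 1))`
that contains `t > 0`. -/
def roundUp (N : ℕ) (t : ℚ) : ℚ :=
  base N ^ (⌊Real.logb ((base N : ℚ) : ℝ) (t : ℝ)⌋ + 1)

/-- The total (pseudo-)cost of the jobs in `J` with completion times `C`. -/
def cost (I : Instance n m) (N : ℕ) (J : Finset (Fin n)) (C : Fin n → ℚ) : ℚ :=
  ∑ j ∈ J, I.weight N j * roundUp N (C j)

namespace Schedule

/-- The jobs of `J` that `S` assigns to machine `l`. -/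
def jobsOn (S : Schedule n m) (J : Finset (Fin n)) (l : Fin m) : Finset (Fin n) :=
  J.filter fun j => S.machine j = l

/-- The starting time of a job. -/
def start (S : Schedule n m) (I : Instance n m) (N : ℕ) (j : Fin n) : ℚ :=
  startOn I N (S.machine j) S.completion j

/-- The restriction of `S` to the jobs in `J` is a timely schedule of these jobs: it is feasible
on every machine, and each job starts no earlier than `δ` times its processing time. -/
def IsTimely (S : Schedule n m) (I : Instance n m) (N : ℕ) (r : Fin n → ℚ)
    (J : Finset (Fin n)) : Prop :=
  (∀ l, FeasibleOn I N r l (S.jobsOn J l) S.completion) ∧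
  ∀ j ∈ J, 1 / (N : ℚ) * (I.size N j / I.speed N (S.machine j)) ≤ S.start I N j

/-- The density-decay property for the sub-instance with job set `J`, with parameters `Ψ` and
`Ψ'`. -/
def DensityDecay (S : Schedule n m) (I : Instance n m) (N y : ℕ) (J : Finset (Fin n))
    (Ψ Ψ' : ℚ) : Prop :=
  (∀ j ∈ J, ∀ j' ∈ J, S.machine j = S.machine j' →
    Ψ < S.start I N j → S.start I N j < S.start I N j' →
    I.density N j' ≤ I.density N j) ∧
  ∀ j ∈ J, ∀ j' ∈ J, S.machine j = S.machine j' →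
    Ψ' / 2 ≤ S.start I N j → S.completion j + Ψ * (y * (N : ℚ) ^ 28) ≤ S.completion j' →
    I.density N j' ≤ I.density N j * (1 / base N ^ y)

/-- The no-large-job property for the sub-instance with job set `J`, with parameter `Ψ`. -/
def NoLargeJob (S : Schedule n m) (I : Instance n m) (N y : ℕ) (J : Finset (Fin n))
    (Ψ : ℚ) : Prop :=
  ∀ j ∈ J, I.size N j ≤ Ψ * (y * (N : ℚ) ^ 25) * I.speed N (S.machine j)

end Schedule

/-- `Ψ'` is an integer power of `1 + δ` in the open interval `(Ψ α / (1 + δ), Ψ α (1 + δ))`. -/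
def Admissible (N y : ℕ) (Ψ Ψ' : ℚ) : Prop :=
  (∃ e : ℤ, Ψ' = base N ^ e) ∧
  Ψ * (alpha N y / base N) < Ψ' ∧ Ψ' < Ψ * (alpha N y * base N)

/-- For every `i`, the restriction of `S` to the jobs of `A_{ik}`, which is the schedule
`sol_{ik}`, is timely and has the density-decay and the no-large-job property with
`Ψ = Ψ_{i,k}`. The sets `A_{ik}` are pairwise disjoint, so that a family of schedules, one for
each `A_{ik}`, is the same as one assignment `S`. -/
def GoodFamily (I : Instance n m) (N y k : ℕ) (S : Schedule n m) : Prop :=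
  ∀ i : ℕ,
    S.IsTimely I N (releaseK I N y k) (band I N y k i) ∧
    (∃ Ψ' : ℚ, Admissible N y (Psi I N y i k) Ψ' ∧
      S.DensityDecay I N y (band I N y k i) (Psi I N y i k) Ψ') ∧
    S.NoLargeJob I N y (band I N y k i) (Psi I N y i k)

open Classical in
/-- The union over all `i` of the sets of jobs that `sol_{ik}` assigns to machine `l`. -/
def allJobsOn (I : Instance n m) (N y k : ℕ) (S : Schedule n m) (l : Fin m) : Finset (Fin n) :=
  Finset.univ.filter fun j => ∃ i : ℕ, j ∈ S.jobsOn (band I N y k i) l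

/-! ### Input and output of the algorithm -/

def encRat (q : ℚ) : Val := .pair (.num q.num) (.num q.den)

def encList (L : List Val) : Val := L.foldr Val.pair (.num 0)

/-- The input: `N`, `y`, `k`, the index of the machine, the speeds, and for each job its size,
weight, original release date, machine and completion time. All numbers are in binary,
rational numbers being given by numerator and denominator. -/
def encInput (I : Instance n m) (N y k : ℕ) (S : Schedule n m) (l : Fin m) : Val :=
  encList [.num N, .num y, .num k, .num (l : ℕ),
    encList ((List.finRange m).map fun a => encRat (I.speed N a)),
    encList ((List.finRange n).map fun j =>
      encList [encRat (I.size N j), encRat (I.weight N j), encRat (I.release N j),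
        .num (S.machine j : ℕ), encRat (S.completion j)])]

open Classical in
/-- The output: the completion times `C j` of the jobs `j` in `J`, together with the indices of
these jobs, in increasing order of the indices. -/
def encOutput (J : Finset (Fin n)) (C : Fin n → ℚ) : Val :=
  encList (((List.finRange n).filter fun j => j ∈ J).map fun j : Fin n =>
    .pair (.num (j : ℕ)) (encRat (C j)))

end Sched

end

/-! Jobs of later bands are released no earlier than about αΨ, where Ψ is the threshold of the band.
So whatever `sol_{ik}` completes by then conflicts with no later band. Conflicts come only from the
jobs called `Late`, which start at 2αB/3 or later; here B is the threshold of the band without the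
ceiling, so B ≤ Ψ ≤ (1+δ)B. The jobs of the machine that are not late are disjoint across all bands
(`disj_of_not_late`).

Every job gets a target time `kap`, the maximum of C and ⌊N⁴ vol²/(αB)⌋, where vol is the length of
the late jobs of its band that complete no later than it. The jobs run in the order of `kap`, each
as early as possible after the relaxed release date min(start, 2B), which is at least its release
date in A_k. Two estimates carry the proof.

Sparsity: since `kap` grows with the square of the volume, the late jobs with `kap` ≤ t have total
length at most 4t/N² (`late_sum_le`). They therefore delay a job by at most that much, and it
completes by (1+4/N²)`kap` (`chain_le`). A job with `kap` = C thus loses a factor 1+δ in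
pseudo-cost.

Cheapness: a job with `kap` > C is preceded by so much late volume of its band that density decay
has set in. Density falls by a factor 54 per block of volume, whereas length times squared volume
grows only cubically in the block number. Hence the jobs with `kap` > C, costed at `kap`, weigh at
most δ² times all jobs costed at C (`sum_all_postponed_le`). In total (1+δ) + δ²(1+δ)² ≤ (1+δ)²
(`IsFinish.cost_le`).

For the algorithm all times are multiplied by a common denominator. The completion time of a job in
list scheduling is a maximum over possible first jobs of an uninterrupted chain, so no sorting is
needed: everything is made of maps, sums and maxima over lists, to which the closure properties of
`PT` apply. Only the powers α^k and α^(α/δ) are not computed in polynomial time; they depend on N, y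
and k < α/δ alone, and their cost goes into f(N, y). The ceilings in Ψ need not be computed, because
release dates are integer powers of 1+δ (`exists_bandIdx`). -/

namespace Sched

/-! ### Typed polynomial-time functions -/

/-- Types whose elements are represented by data. -/
class Enc (α : Type) where
  enc : α → Val

open Enc

instance : Enc ℤ := ⟨.num⟩
-- The value agrees with the end marker of `encList`, so a nested product that ends in `Unit` is
-- encoded like a list with entries of different types.
instance : Enc Unit := ⟨fun _ => .num 0⟩
instance {α β : Type} [Enc α] [Enc β] : Enc (α × β) := ⟨fun p => .pair (enc p.1) (enc p.2)⟩
instance {α : Type} [Enc α] : Enc (List α) := ⟨fun l => encList (l.map enc)⟩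

/-- The length of the representation. -/
def sz {α : Type} [Enc α] (x : α) : ℕ := (enc x).size

/-! ### Lengths of encodings. -/

section Sizes

variable {α β : Type} [Enc α] [Enc β]

theorem Val.size_pos (v : Val) : 0 < v.size := by cases v <;> simp [Val.size]

theorem sz_pos (x : α) : 0 < sz x := Val.size_pos _

theorem sz_pair (a : α) (b : β) : sz (a, b) = sz a + sz b + 1 := rfl

theorem enc_nil : enc ([] : List α) = .num 0 := rfl

theorem enc_cons (a : α) (l : List α) : enc (a :: l) = .pair (enc a) (enc l) := rfl

theorem sz_nil : sz ([] : List α) = 1 := by simp [sz, enc_nil, Val.size]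

theorem sz_cons (a : α) (l : List α) : sz (a :: l) = sz a + sz l + 1 := rfl

theorem sz_int (z : ℤ) : sz z = Nat.size z.natAbs + 1 := rfl

theorem sz_list (l : List α) : sz l = (l.map fun a => sz a + 1).sum + 1 := by
  induction l with
  | nil => simp [sz_nil]
  | cons a l ih => simp [sz_cons, ih]; omega

theorem sz_append (l₁ l₂ : List α) : sz (l₁ ++ l₂) + 1 = sz l₁ + sz l₂ := by
  simp only [sz_list, List.map_append, List.sum_append]; omega

theorem length_lt_sz (l : List α) : l.length < sz l := by
  induction l with
  | nil => simp [sz_nil]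
  | cons a l ih => simp [sz_cons]; omega

theorem sz_reverse (l : List α) : sz l.reverse = sz l := by
  simp [sz_list]

theorem sz_lt_of_mem {a : α} {l : List α} (h : a ∈ l) : sz a < sz l := by
  induction l with
  | nil => simp at h
  | cons b l ih =>
    rw [sz_cons]
    rcases List.mem_cons.1 h with rfl | h
    · omega
    · have := ih h; omega

theorem sz_drop_le (l : List α) (i : ℕ) : sz (l.drop i) ≤ sz l := by
  have h := sz_append (l.take i) (l.drop i)
  rw [List.take_append_drop] at h
  have := sz_pos (l.take i)
  omega

theorem sz_take_le (l : List α) (i : ℕ) : sz (l.take i) ≤ sz l := by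
  have h := sz_append (l.take i) (l.drop i)
  rw [List.take_append_drop] at h
  have := sz_pos (l.drop i)
  omega

theorem natSize_mono {a b : ℕ} (h : a ≤ b) : a.size ≤ b.size := Nat.size_le_size h

theorem natSize_add_le (a b : ℕ) : (a + b).size ≤ a.size + b.size + 1 := by
  refine Nat.size_le.2 ?_
  have ha := Nat.lt_size_self a
  have hb := Nat.lt_size_self b
  have h1 : 2 ^ a.size ≤ 2 ^ (a.size + b.size) := Nat.pow_le_pow_right (by norm_num) (by omega)
  have h2 : 2 ^ b.size ≤ 2 ^ (a.size + b.size) := Nat.pow_le_pow_right (by norm_num) (by omega)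
  rw [pow_succ]; omega

theorem natSize_mul_le (a b : ℕ) : (a * b).size ≤ a.size + b.size := by
  refine Nat.size_le.2 ?_
  rw [pow_add]
  exact Nat.mul_lt_mul'' (Nat.lt_size_self a) (Nat.lt_size_self b)

theorem sz_add_le (a b : ℤ) : sz (a + b) ≤ sz a + sz b := by
  simp only [sz_int]
  have h := natSize_mono (Int.natAbs_add_le a b)
  have := natSize_add_le a.natAbs b.natAbs
  omega

theorem sz_neg (a : ℤ) : sz (-a) = sz a := by simp [sz_int]

theorem sz_sub_le (a b : ℤ) : sz (a - b) ≤ sz a + sz b := by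
  rw [sub_eq_add_neg, ← sz_neg b]; exact sz_add_le _ _

theorem sz_mul_le (a b : ℤ) : sz (a * b) ≤ sz a + sz b := by
  simp only [sz_int, Int.natAbs_mul]
  have := natSize_mul_le a.natAbs b.natAbs
  omega

theorem sz_div_le (a b : ℤ) : sz (a / b) ≤ sz a + sz b := by
  simp only [sz_int]
  have h : (a / b).natAbs ≤ a.natAbs := Int.natAbs_ediv_le_natAbs a b
  have := natSize_mono h
  omega

theorem sz_max_le (a b : ℤ) : sz (max a b) ≤ sz a + sz b := by
  rcases max_choice a b with h | h <;> rw [h] <;> omega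

theorem sz_min_le (a b : ℤ) : sz (min a b) ≤ sz a + sz b := by
  rcases min_choice a b with h | h <;> rw [h] <;> omega

end Sizes

theorem eval_mono_nat (p : Polynomial ℕ) {a b : ℕ} (h : a ≤ b) : p.eval a ≤ p.eval b := by
  rw [Polynomial.eval_eq_sum, Polynomial.eval_eq_sum]
  exact Finset.sum_le_sum fun i _ => Nat.mul_le_mul_left _ (Nat.pow_le_pow_left h i)

/-- A polynomial with natural coefficients is bounded by a monomial at positive arguments. -/
theorem exists_eval_le_mul_pow (p : Polynomial ℕ) :
    ∃ a c : ℕ, ∀ s : ℕ, 0 < s → p.eval s ≤ a * s ^ c := by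
  refine ⟨p.sum fun _ b => b, p.natDegree, fun s hs => ?_⟩
  rw [Polynomial.eval_eq_sum, Polynomial.sum, Polynomial.sum, Finset.sum_mul]
  refine Finset.sum_le_sum fun i hi => Nat.mul_le_mul_left _ ?_
  exact Nat.pow_le_pow_right hs (Polynomial.le_natDegree_of_mem_supp i hi)

/-- A loop that passes through the states `v 0, …, v n`. -/
theorem loop_runs {c f : Prog} {tc tb S : ℕ} (n : ℕ) (v : ℕ → Val)
    (hc : ∀ i < n, ∃ b t, c.Runs (v i) b t ∧ b ≠ .num 0 ∧ t ≤ tc)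
    (hn : ∃ t, c.Runs (v n) (.num 0) t ∧ t ≤ tc)
    (hf : ∀ i < n, ∃ t, f.Runs (v i) (v (i + 1)) t ∧ t ≤ tb)
    (hS : ∀ i ≤ n, (v i).size ≤ S) :
    ∃ t, (Prog.loop c f).Runs (v 0) (v n) t ∧ t ≤ (n + 1) * (tc + tb + S) := by
  induction n generalizing v with
  | zero =>
    obtain ⟨t, ht, htl⟩ := hn
    have := hS 0 le_rfl
    exact ⟨_, Prog.Runs.loop_stop ht, by omega⟩
  | succ n ih =>
    obtain ⟨b, t, h1, h2, h3⟩ := hc 0 (by omega)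
    obtain ⟨t', h4, h5⟩ := hf 0 (by omega)
    obtain ⟨u, h6, h7⟩ := ih (fun i => v (i + 1)) (fun i hi => hc (i + 1) (by omega)) hn
      (fun i hi => hf (i + 1) (by omega)) (fun i hi => hS (i + 1) (by omega))
    have := hS 0 (by omega)
    refine ⟨_, .loop_step h1 h2 h4 h6, ?_⟩
    have e : (n + 1 + 1) * (tc + tb + S) = (n + 1) * (tc + tb + S) + (tc + tb + S) := by ring
    omega

/-- `f` is computed by a program in polynomial time. -/
def PT {α β : Type} [Enc α] [Enc β] (f : α → β) : Prop :=
  ∃ (P : Prog) (p : Polynomial ℕ), ∀ x, ∃ t, P.Runs (enc x) (enc (f x)) t ∧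
    t ≤ p.eval (sz x) ∧ sz (f x) ≤ p.eval (sz x)

/-- The predicate `q` is decided by a program in polynomial time. -/
def PTDec {α : Type} [Enc α] (q : α → Prop) : Prop :=
  ∃ (P : Prog) (p : Polynomial ℕ), ∀ x, ∃ v t, P.Runs (enc x) v t ∧
    (v ≠ .num 0 ↔ q x) ∧ t ≤ p.eval (sz x)

/-! ### Closure properties of polynomial-time functions. -/

section PolyTime

variable {α β γ σ : Type} [Enc α] [Enc β] [Enc γ] [Enc σ]

theorem PT.of_prim (o : Prim) {f : α → β} (h : ∀ x, o.eval (enc x) = enc (f x)) {c : ℕ}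
    (hs : ∀ x, sz (f x) ≤ c * sz x) : PT f := by
  refine ⟨.prim o, Polynomial.X ^ 2 + Polynomial.C c * Polynomial.X, fun x =>
    ⟨_, h x ▸ Prog.Runs.prim o (enc x), ?_, ?_⟩⟩
  · simp [sz]
  · simp only [Polynomial.eval_add, Polynomial.eval_mul, Polynomial.eval_C, Polynomial.eval_X]
    exact (hs x).trans (Nat.le_add_left _ _)

theorem PT.id : PT (fun x : α => x) :=
  PT.of_prim .id (c := 1) (fun _ => rfl) (fun _ => by simp)

theorem PT.comp {g : β → γ} {f : α → β} (hg : PT g) (hf : PT f) : PT (fun x => g (f x)) := by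
  obtain ⟨P, p, hP⟩ := hf
  obtain ⟨Q, q, hQ⟩ := hg
  refine ⟨.comp Q P, p + q.comp p + 1, fun x => ?_⟩
  obtain ⟨t, h1, h2, h3⟩ := hP x
  obtain ⟨u, h4, h5, h6⟩ := hQ (f x)
  have h7 := eval_mono_nat q h3
  refine ⟨_, .comp h1 h4, ?_, ?_⟩ <;>
    simp only [Polynomial.eval_add, Polynomial.eval_comp, Polynomial.eval_one] <;> omega

theorem PT.pair {f : α → β} {g : α → γ} (hf : PT f) (hg : PT g) : PT (fun x => (f x, g x)) := by
  obtain ⟨P, p, hP⟩ := hf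
  obtain ⟨Q, q, hQ⟩ := hg
  refine ⟨.pair P Q, p + q + Polynomial.X + 1, fun x => ?_⟩
  obtain ⟨t, h1, h2, h3⟩ := hP x
  obtain ⟨u, h4, h5, h6⟩ := hQ x
  refine ⟨_, .pair h1 h4, ?_, ?_⟩ <;>
    simp only [Polynomial.eval_add, Polynomial.eval_X, Polynomial.eval_one, sz_pair]
  · change t + u + sz x ≤ _; omega
  · omega

theorem PT.fst' : PT (fun x : α × β => x.1) :=
  PT.of_prim .fst (c := 1) (fun _ => rfl) (fun x => by rcases x with ⟨a, b⟩; simp [sz_pair]; omega)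

theorem PT.snd' : PT (fun x : α × β => x.2) :=
  PT.of_prim .snd (c := 1) (fun _ => rfl) (fun x => by rcases x with ⟨a, b⟩; simp [sz_pair]; omega)

theorem PT.fst {f : α → β × γ} (hf : PT f) : PT (fun x => (f x).1) := PT.fst'.comp hf

theorem PT.snd {f : α → β × γ} (hf : PT f) : PT (fun x => (f x).2) := PT.snd'.comp hf

theorem PT.const (z : ℤ) : PT (fun _ : α => z) :=
  PT.of_prim (.const z) (c := sz z) (fun _ => rfl) (fun x => Nat.le_mul_of_pos_right _ (sz_pos x))

theorem PT.nil : PT (fun _ : α => ([] : List β)) :=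
  PT.of_prim (.const 0) (c := 1) (fun _ => rfl) (fun x => by rw [sz_nil]; have := sz_pos x; omega)

theorem PT.cons {f : α → β} {g : α → List β} (hf : PT f) (hg : PT g) :
    PT (fun x => f x :: g x) := by
  obtain ⟨P, p, h⟩ := hf.pair hg
  exact ⟨P, p, h⟩

theorem PT.add {f g : α → ℤ} (hf : PT f) (hg : PT g) : PT (fun x => f x + g x) :=
  PT.comp (g := fun p : ℤ × ℤ => p.1 + p.2) (PT.of_prim .add (c := 1) (fun _ => rfl)
    (fun x => by rw [one_mul, ← Prod.mk.eta (p := x), sz_pair]; exact (sz_add_le _ _).trans (by simp)))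
    (hf.pair hg)

theorem PT.sub {f g : α → ℤ} (hf : PT f) (hg : PT g) : PT (fun x => f x - g x) :=
  PT.comp (g := fun p : ℤ × ℤ => p.1 - p.2) (PT.of_prim .sub (c := 1) (fun _ => rfl)
    (fun x => by rw [one_mul, ← Prod.mk.eta (p := x), sz_pair]; exact (sz_sub_le _ _).trans (by simp)))
    (hf.pair hg)

theorem PT.mul {f g : α → ℤ} (hf : PT f) (hg : PT g) : PT (fun x => f x * g x) :=
  PT.comp (g := fun p : ℤ × ℤ => p.1 * p.2) (PT.of_prim .mul (c := 1) (fun _ => rfl)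
    (fun x => by rw [one_mul, ← Prod.mk.eta (p := x), sz_pair]; exact (sz_mul_le _ _).trans (by simp)))
    (hf.pair hg)

theorem PT.div {f g : α → ℤ} (hf : PT f) (hg : PT g) : PT (fun x => f x / g x) :=
  PT.comp (g := fun p : ℤ × ℤ => p.1 / p.2) (PT.of_prim .div (c := 1) (fun _ => rfl)
    (fun x => by rw [one_mul, ← Prod.mk.eta (p := x), sz_pair]; exact (sz_div_le _ _).trans (by simp)))
    (hf.pair hg)

theorem PT.pow {f : α → ℤ} (hf : PT f) (n : ℕ) : PT (fun x => f x ^ n) := by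
  induction n with
  | zero => simpa using PT.const 1
  | succ n ih => simpa only [pow_succ] using ih.mul hf

theorem PTDec.le {f g : α → ℤ} (hf : PT f) (hg : PT g) : PTDec (fun x => f x ≤ g x) := by
  obtain ⟨P, p, hP⟩ := PT.comp (g := fun p : ℤ × ℤ => if p.1 ≤ p.2 then (1 : ℤ) else 0)
    (PT.of_prim .le (c := 2) (fun _ => rfl) (fun x => by
      have := sz_pos x
      split_ifs <;> simp [sz_int] <;> omega)) (hf.pair hg)
  refine ⟨P, p, fun x => ?_⟩
  obtain ⟨t, h1, h2, -⟩ := hP x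
  refine ⟨_, t, h1, ?_, h2⟩
  by_cases h : f x ≤ g x <;> simp [h, enc]

theorem PTDec.and {q r : α → Prop} (hq : PTDec q) (hr : PTDec r) :
    PTDec (fun x => q x ∧ r x) := by
  obtain ⟨P, p, hP⟩ := hq
  obtain ⟨P', p', hP'⟩ := hr
  refine ⟨.cond P P' (.prim (.const 0)), p + p' + Polynomial.X + Polynomial.X ^ 2, fun x => ?_⟩
  obtain ⟨v, t, h1, h2, h3⟩ := hP x
  obtain ⟨v', t', h1', h2', h3'⟩ := hP' x
  simp only [Polynomial.eval_add, Polynomial.eval_X, Polynomial.eval_pow]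
  by_cases h : v = .num 0
  · subst h
    refine ⟨_, _, .cond_false h1 (.prim _ _), ?_, ?_⟩
    · simp only [ne_eq, not_true_eq_false, false_iff] at h2
      simp [Prim.eval, h2]
    · change t + sz x ^ 2 + sz x ≤ _
      omega
  · refine ⟨_, _, .cond_true h1 h h1', ?_, ?_⟩
    · rw [h2']; simp [h2.1 h]
    · change t + t' + sz x ≤ _
      omega

theorem PTDec.congr {q r : α → Prop} (hq : PTDec q) (h : ∀ x, q x ↔ r x) : PTDec r := by
  obtain rfl : q = r := funext fun x => propext (h x)
  exact hq

theorem PTDec.eq {f g : α → ℤ} (hf : PT f) (hg : PT g) : PTDec (fun x => f x = g x) :=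
  ((PTDec.le hf hg).and (PTDec.le hg hf)).congr fun _ => le_antisymm_iff.symm

theorem PT.ite {q : α → Prop} [DecidablePred q] {f g : α → β} (hq : PTDec q) (hf : PT f)
    (hg : PT g) : PT (fun x => if q x then f x else g x) := by
  obtain ⟨C, c, hC⟩ := hq
  obtain ⟨P, p, hP⟩ := hf
  obtain ⟨Q, r, hQ⟩ := hg
  refine ⟨.cond C P Q, c + p + r + Polynomial.X, fun x => ?_⟩
  obtain ⟨v, t, h1, h2, h3⟩ := hC x
  obtain ⟨t₁, h4, h5, h6⟩ := hP x
  obtain ⟨t₂, h7, h8, h9⟩ := hQ x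
  simp only [Polynomial.eval_add, Polynomial.eval_X]
  by_cases h : q x
  · simp only [h, if_true]
    refine ⟨_, .cond_true h1 (h2.2 h) h4, ?_, by omega⟩
    change t + t₁ + sz x ≤ _; omega
  · simp only [h, if_false]
    obtain rfl : v = .num 0 := by
      by_contra hv; exact h (h2.1 hv)
    refine ⟨_, .cond_false h1 h7, ?_, by omega⟩
    change t + t₂ + sz x ≤ _; omega

theorem PT.max {f g : α → ℤ} (hf : PT f) (hg : PT g) : PT (fun x => max (f x) (g x)) := by
  simpa only [max_def] using PT.ite (PTDec.le hf hg) hg hf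

theorem PT.min {f g : α → ℤ} (hf : PT f) (hg : PT g) : PT (fun x => min (f x) (g x)) := by
  simpa only [min_def] using PT.ite (PTDec.le hf hg) hf hg

/-- Iteration of a guarded step. -/
theorem PT.while {q : σ → Prop} [DecidablePred q] {f : σ → σ} (hq : PTDec q) (hf : PT f)
    (cnt : σ → ℕ) (b : Polynomial ℕ)
    (hhalt : ∀ s, ¬ q (f^[cnt s] s)) (hgo : ∀ s, ∀ i < cnt s, q (f^[i] s))
    (hcnt : ∀ s, cnt s ≤ b.eval (sz s))
    (hsz : ∀ s, ∀ i ≤ cnt s, sz (f^[i] s) ≤ b.eval (sz s)) :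
    PT (fun s => f^[cnt s] s) := by
  obtain ⟨C, c, hC⟩ := hq
  obtain ⟨P, p, hP⟩ := hf
  refine ⟨.loop C P, (b + 1) * (c.comp b + p.comp b + b), fun x => ?_⟩
  simp only [Polynomial.eval_add, Polynomial.eval_comp, Polynomial.eval_mul, Polynomial.eval_one]
  have key := loop_runs (c := C) (f := P) (tc := c.eval (b.eval (sz x)))
    (tb := p.eval (b.eval (sz x))) (S := b.eval (sz x)) (cnt x) (fun i => enc (f^[i] x))
    ?_ ?_ ?_ (hsz x)
  · obtain ⟨t, h1, h2⟩ := key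
    refine ⟨t, h1, h2.trans (Nat.mul_le_mul_right _ (by have := hcnt x; omega)), ?_⟩
    refine (hsz x _ le_rfl).trans ?_
    calc b.eval (sz x) ≤ 1 * (c.eval (b.eval (sz x)) + p.eval (b.eval (sz x)) + b.eval (sz x)) := by
          omega
      _ ≤ _ := Nat.mul_le_mul_right _ (by omega)
  · intro i hi
    obtain ⟨v, t, h1, h2, h3⟩ := hC (f^[i] x)
    exact ⟨v, t, h1, h2.2 (hgo x i hi), h3.trans (eval_mono_nat c (hsz x i hi.le))⟩
  · obtain ⟨v, t, h1, h2, h3⟩ := hC (f^[cnt x] x)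
    obtain rfl : v = .num 0 := by
      by_contra hv; exact hhalt x (h2.1 hv)
    exact ⟨t, h1, h3.trans (eval_mono_nat c (hsz x _ le_rfl))⟩
  · intro i hi
    obtain ⟨t, h1, h2, -⟩ := hP (f^[i] x)
    refine ⟨t, ?_, h2.trans (eval_mono_nat p (hsz x i hi.le))⟩
    rw [Function.iterate_succ_apply']
    exact h1

/-- The test whether the list in the third component is nonempty. -/
theorem runs_hasNext (x : γ) (w : σ) (l : List α) : ∃ v t,
    (Prog.comp (.prim .isPair) (.comp (.prim .snd) (.prim .snd))).Runs (enc (x, w, l)) v t ∧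
    (v ≠ .num 0 ↔ l ≠ []) ∧ t ≤ 3 * sz (x, w, l) ^ 2 + 3 := by
  refine ⟨_, _, .comp (.comp (.prim .snd _) (.prim .snd _)) (.prim .isPair _), ?_, ?_⟩
  · change Prim.isPair.eval (enc l) ≠ _ ↔ _
    cases l <;> simp [enc_nil, enc_cons, Prim.eval]
  · have q1 : (Prim.snd.eval (enc (x, w, l))).size ≤ sz (x, w, l) := by
      change sz (w, l) ≤ _; simp only [sz_pair]; omega
    have q2 : (Prim.snd.eval (Prim.snd.eval (enc (x, w, l)))).size ≤ sz (x, w, l) := by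
      change sz l ≤ _; simp only [sz_pair]; omega
    have q1' := Nat.pow_le_pow_left q1 2
    have q2' := Nat.pow_le_pow_left q2 2
    have e0 : (enc (x, w, l)).size = sz (x, w, l) := rfl
    rw [e0]
    omega

/-- Folding over a list, if the intermediate results are of polynomial length. -/
theorem PT.foldl {L : γ → List α} {z : γ → σ} {g : γ × σ × α → σ} (hL : PT L) (hz : PT z)
    (hg : PT g) (b : Polynomial ℕ)
    (hb : ∀ x i, sz (((L x).take i).foldl (fun s a => g (x, s, a)) (z x)) ≤ b.eval (sz x)) :
    PT (fun x => (L x).foldl (fun s a => g (x, s, a)) (z x)) := by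
  -- The loop state consists of the input, the accumulated value and the unread rest of the list.
  have hstart : PT (fun x => (x, z x, L x)) := PT.id.pair (hz.pair hL)
  have hend : PT (fun s : γ × σ × List α => s.2.1) := PT.id.snd.fst
  suffices h : ∃ (P : Prog) (p : Polynomial ℕ), ∀ x, ∃ t, P.Runs (enc (x, z x, L x))
      (enc (x, (L x).foldl (fun s a => g (x, s, a)) (z x), ([] : List α))) t ∧
      t ≤ p.eval (sz (x, z x, L x)) by
    obtain ⟨P₁, p₁, h₁⟩ := hstart
    obtain ⟨P₂, p₂, h₂⟩ := hend
    obtain ⟨P, p, h⟩ := h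
    refine ⟨.comp P₂ (.comp P P₁), p₁ + p.comp p₁ + p₂.comp (Polynomial.X + b + 3) + 2 + b,
      fun x => ?_⟩
    obtain ⟨t₁, a1, a2, a3⟩ := h₁ x
    obtain ⟨t, b1, b2⟩ := h x
    obtain ⟨t₂, c1, c2, c3⟩ := h₂ (x, (L x).foldl (fun s a => g (x, s, a)) (z x), ([] : List α))
    have hbx := hb x (L x).length
    rw [List.take_length] at hbx
    have e1 := eval_mono_nat p a3
    beta_reduce at a3 e1 c3
    have e2 : p₂.eval (sz (x, (L x).foldl (fun s a => g (x, s, a)) (z x), ([] : List α))) ≤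
        p₂.eval (sz x + b.eval (sz x) + 3) := by
      apply eval_mono_nat
      rw [sz_pair, sz_pair, sz_nil]; omega
    refine ⟨_, .comp (.comp a1 b1) c1, ?_, ?_⟩
    · simp only [Polynomial.eval_add, Polynomial.eval_comp, Polynomial.eval_X,
        Polynomial.eval_ofNat]
      omega
    · simp only [Polynomial.eval_add]
      omega
  obtain ⟨G, p, hG⟩ := hg
  obtain ⟨H, hhd⟩ : ∃ H : Prog, ∀ (x : γ) (s : σ) (a : α) (l : List α), ∃ t,
      H.Runs (enc (x, s, a :: l)) (enc (x, g (x, s, a), l)) t ∧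
      t ≤ p.eval (sz (x, s, a :: l)) + 16 * (sz (x, s, a :: l) + 1) ^ 2 := by
    refine ⟨Prog.pair (.prim .fst)
      (.pair (.comp G (.pair (.prim .fst) (.pair (.comp (.prim .fst) (.prim .snd))
        (.comp (.prim .fst) (.comp (.prim .snd) (.prim .snd))))))
        (.comp (.prim .snd) (.comp (.prim .snd) (.prim .snd)))), ?_⟩
    intro x s a l
    obtain ⟨t, h1, h2, -⟩ := hG (x, s, a)
    refine ⟨_, .pair (.prim .fst _) (.pair (.comp (.pair (.prim .fst _) (.pair
      (.comp (.prim .snd _) (.prim .fst _)) (.comp (.comp (.prim .snd _) (.prim .snd _))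
      (.prim .fst _)))) h1) (.comp (.comp (.prim .snd _) (.prim .snd _)) (.prim .snd _))), ?_⟩
    have hs : sz (x, s, a) ≤ sz (x, s, a :: l) := by
      simp only [sz_pair, sz_cons]; omega
    have h3 := h2.trans (eval_mono_nat p hs)
    have q1 : (Prim.snd.eval (enc (x, s, a :: l))).size ≤ sz (x, s, a :: l) := by
      change sz (s, a :: l) ≤ _; simp only [sz_pair]; omega
    have q2 : (Prim.snd.eval (Prim.snd.eval (enc (x, s, a :: l)))).size ≤ sz (x, s, a :: l) := by
      change sz (a :: l) ≤ _; simp only [sz_pair]; omega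
    have q1' := Nat.pow_le_pow_left q1 2
    have q2' := Nat.pow_le_pow_left q2 2
    change _ ≤ _ at h3
    have e0 : (enc (x, s, a :: l)).size = sz (x, s, a :: l) := rfl
    rw [e0]
    generalize sz (x, s, a :: l) = S at *
    nlinarith
  refine ⟨.loop (.comp (.prim .isPair) (.comp (.prim .snd) (.prim .snd))) H,
    (Polynomial.X + 1) * ((3 * (Polynomial.X + b + Polynomial.X + 3) ^ 2 + 3) +
      (p.comp (Polynomial.X + b + Polynomial.X + 3) +
        16 * (Polynomial.X + b + Polynomial.X + 3 + 1) ^ 2) +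
      (Polynomial.X + b + Polynomial.X + 3)), fun x => ?_⟩
  set S := sz x + b.eval (sz x) + sz (L x) + 3 with hS
  have hSl : ∀ i, sz (x, ((L x).take i).foldl (fun s a => g (x, s, a)) (z x), (L x).drop i) ≤ S := by
    intro i
    have h1 := hb x i
    have h2 := sz_drop_le (L x) i
    simp only [sz_pair]; omega
  have key := loop_runs (c := .comp (.prim .isPair) (.comp (.prim .snd) (.prim .snd))) (f := H)
    (tc := 3 * S ^ 2 + 3) (tb := p.eval S + 16 * (S + 1) ^ 2) (S := S) (L x).length
    (fun i => enc (x, ((L x).take i).foldl (fun s a => g (x, s, a)) (z x), (L x).drop i))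
    ?_ ?_ ?_ (fun i _ => hSl i)
  · obtain ⟨t, h1, h2⟩ := key
    refine ⟨t, ?_, h2.trans ?_⟩
    · simpa using h1
    · simp only [Polynomial.eval_add, Polynomial.eval_comp, Polynomial.eval_X,
        Polynomial.eval_ofNat, Polynomial.eval_mul, Polynomial.eval_one, Polynomial.eval_pow]
      have hw : sz x ≤ sz (x, z x, L x) := by simp only [sz_pair]; omega
      have hb' := eval_mono_nat b hw
      have hl := length_lt_sz (L x)
      have hl' : sz (L x) ≤ sz (x, z x, L x) := by simp only [sz_pair]; omega
      have hS' : S ≤ sz (x, z x, L x) + b.eval (sz (x, z x, L x)) + sz (x, z x, L x) + 3 := by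
        omega
      have hp := eval_mono_nat p hS'
      gcongr
      omega
  · intro i hi
    obtain ⟨v, t, h1, h2, h3⟩ := runs_hasNext x
      (((L x).take i).foldl (fun s a => g (x, s, a)) (z x)) ((L x).drop i)
    refine ⟨v, t, h1, h2.2 (by simpa using hi), h3.trans ?_⟩
    have := Nat.pow_le_pow_left (hSl i) 2
    omega
  · obtain ⟨v, t, h1, h2, h3⟩ := runs_hasNext x
      (((L x).take (L x).length).foldl (fun s a => g (x, s, a)) (z x)) ((L x).drop (L x).length)
    obtain rfl : v = .num 0 := by
      by_contra hv; exact h2.1 hv (by simp)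
    refine ⟨t, h1, h3.trans ?_⟩
    have := Nat.pow_le_pow_left (hSl (L x).length) 2
    omega
  · intro i hi
    obtain ⟨t, h1, h2⟩ := hhd x (((L x).take i).foldl (fun s a => g (x, s, a)) (z x))
      ((L x)[i]) ((L x).drop (i + 1))
    rw [← List.drop_eq_getElem_cons hi] at h1 h2
    refine ⟨t, ?_, h2.trans ?_⟩
    · rw [List.take_add_one, List.foldl_append, List.getElem?_eq_getElem hi]
      exact h1
    · have := hSl i
      have hp := eval_mono_nat p this
      gcongr

end PolyTime

/-! ### Polynomial-time operations on lists. -/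

section PolyTimeLists

theorem foldl_cons_map {α β : Type} (g : α → β) (l : List α) (acc : List β) :
    l.foldl (fun s a => g a :: s) acc = (l.map g).reverse ++ acc := by
  induction l generalizing acc with
  | nil => rfl
  | cons a l ih => simp [ih]

theorem foldl_cons_filter {α : Type} (q : α → Prop) [DecidablePred q] (l : List α) (acc : List α) :
    l.foldl (fun s a => if q a then a :: s else s) acc =
      (l.filter fun a => decide (q a)).reverse ++ acc := by
  induction l generalizing acc with
  | nil => rfl
  | cons a l ih => by_cases h : q a <;> simp [ih, h]

variable {α β γ σ : Type} [Enc α] [Enc β] [Enc γ] [Enc σ]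

/-- Subadditivity of the length under `op` bounds every intermediate result by the length of the
initial value plus that of the list. -/
theorem PT.foldOp {op : ℤ → ℤ → ℤ} (hop : PT (fun p : ℤ × ℤ => op p.1 p.2))
    (hs : ∀ a b, sz (op a b) ≤ sz a + sz b) {L : γ → List ℤ} {z : γ → ℤ} (hL : PT L)
    (hz : PT z) : PT (fun x => (L x).foldl op (z x)) := by
  have hl : ∀ (l : List ℤ) (c : ℤ), sz (l.foldl op c) ≤ sz c + sz l := by
    intro l
    induction l with
    | nil => intro c; simp
    | cons a l ih =>
      intro c
      have h1 := ih (op c a)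
      have h2 := hs c a
      rw [List.foldl_cons, sz_cons]; omega
  have hz' := hz
  have hL' := hL
  obtain ⟨_, p, hp⟩ := hz'
  obtain ⟨_, q, hq⟩ := hL'
  refine PT.foldl (g := fun s : γ × ℤ × ℤ => op s.2.1 s.2.2) hL hz
    (hop.comp PT.id.snd) (p + q) fun x i => ?_
  obtain ⟨_, -, -, h1⟩ := hp x
  obtain ⟨_, -, -, h2⟩ := hq x
  have h3 := hl ((L x).take i) (z x)
  have h4 := sz_take_le (L x) i
  simp only [Polynomial.eval_add]
  exact h3.trans (by omega)

theorem PT.foldMax {L : γ → List ℤ} {z : γ → ℤ} (hL : PT L) (hz : PT z) :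
    PT (fun x => (L x).foldl Max.max (z x)) :=
  PT.foldOp (PT.max PT.id.fst PT.id.snd) sz_max_le hL hz

theorem PT.foldMin {L : γ → List ℤ} {z : γ → ℤ} (hL : PT L) (hz : PT z) :
    PT (fun x => (L x).foldl Min.min (z x)) :=
  PT.foldOp (PT.min PT.id.fst PT.id.snd) sz_min_le hL hz

theorem PT.listSum {L : γ → List ℤ} (hL : PT L) : PT (fun x => (L x).sum) := by
  simpa only [List.sum_eq_foldl] using
    PT.foldOp (op := (· + ·)) (PT.add PT.id.fst PT.id.snd) sz_add_le hL (PT.const 0)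

theorem PT.listProd {L : γ → List ℤ} (hL : PT L) : PT (fun x => (L x).prod) := by
  simpa only [List.prod_eq_foldl] using
    PT.foldOp (op := (· * ·)) (PT.mul PT.id.fst PT.id.snd) sz_mul_le hL (PT.const 1)

theorem PT.reverse {L : γ → List α} (hL : PT L) : PT (fun x => (L x).reverse) := by
  have hL' := hL
  obtain ⟨_, q, hq⟩ := hL'
  have h := PT.foldl (g := fun s : γ × List α × α => s.2.2 :: s.2.1) hL PT.nil
    (PT.cons PT.id.snd.snd PT.id.snd.fst) q fun x i => ?_
  · simpa using h
  · obtain ⟨_, -, -, h2⟩ := hq x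
    have h4 := sz_take_le (L x) i
    simp only [List.foldl_flip_cons_eq_append, List.append_nil, sz_reverse, List.map_id_fun'] at *
    exact h4.trans h2

theorem sz_map_le (g : α → β) (l : List α) {M : ℕ} (h : ∀ a ∈ l, sz (g a) ≤ M) :
    sz (l.map g) ≤ sz l * (M + 1) + 1 := by
  induction l with
  | nil => simp [sz_nil]
  | cons a l ih =>
    have h1 := ih fun b hb => h b (List.mem_cons_of_mem _ hb)
    have h2 := h a (List.mem_cons_self ..)
    have h3 := sz_pos a
    rw [List.map_cons, sz_cons, sz_cons]
    nlinarith

theorem PT.map {L : γ → List α} {g : γ × α → β} (hL : PT L) (hg : PT g) :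
    PT (fun x => (L x).map fun a => g (x, a)) := by
  have hL' := hL
  have hg' := hg
  obtain ⟨_, q, hq⟩ := hL'
  obtain ⟨_, p, hp⟩ := hg'
  have h := PT.reverse (PT.foldl (g := fun s : γ × List β × α => g (s.1, s.2.2) :: s.2.1) hL
    PT.nil (PT.cons (hg.comp (PT.id.fst.pair PT.id.snd.snd)) PT.id.snd.fst)
    (q * (p.comp (Polynomial.X + q + 1) + 1) + 1) fun x i => ?_)
  · simpa only [foldl_cons_map (fun a => g (_, a)), List.append_nil, List.reverse_reverse] using h
  · obtain ⟨_, -, -, h2⟩ := hq x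
    have h4 := sz_take_le (L x) i
    simp only [foldl_cons_map (fun a => g (x, a)), List.append_nil, sz_reverse]
    refine (sz_map_le _ _ (M := p.eval (sz x + q.eval (sz x) + 1)) fun a ha => ?_).trans ?_
    · obtain ⟨_, -, -, h5⟩ := hp (x, a)
      refine h5.trans (eval_mono_nat p ?_)
      have := sz_lt_of_mem ha
      rw [sz_pair]; omega
    · simp only [Polynomial.eval_add, Polynomial.eval_comp, Polynomial.eval_X,
        Polynomial.eval_mul, Polynomial.eval_one]
      have := h4.trans h2
      gcongr

theorem sz_filter_le (q : α → Bool) (l : List α) : sz (l.filter q) ≤ sz l := by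
  induction l with
  | nil => simp
  | cons a l ih =>
    by_cases h : q a <;> simp only [List.filter_cons, h, sz_cons, if_true] <;> simp <;> omega

theorem PT.filter {L : γ → List α} {q : γ × α → Prop} [DecidablePred q] (hL : PT L)
    (hq : PTDec q) : PT (fun x => (L x).filter fun a => decide (q (x, a))) := by
  have hL' := hL
  obtain ⟨_, p, hp⟩ := hL'
  have h := PT.reverse (PT.foldl (g := fun s : γ × List α × α =>
    if q (s.1, s.2.2) then s.2.2 :: s.2.1 else s.2.1) hL PT.nil
    (PT.ite (q := fun s : γ × List α × α => q (s.1, s.2.2)) ?_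
      (PT.cons PT.id.snd.snd PT.id.snd.fst) PT.id.snd.fst) p fun x i => ?_)
  · simpa only [foldl_cons_filter (fun a => q (_, a)), List.append_nil, List.reverse_reverse]
      using h
  · obtain ⟨P, p', hP⟩ := PT.pair (PT.id (α := γ × List α × α)).fst PT.id.snd.snd
    obtain ⟨Q, r, hQ⟩ := hq
    refine ⟨.comp Q P, p' + r.comp p' + 1, fun x => ?_⟩
    obtain ⟨t, h1, h2, h3⟩ := hP x
    obtain ⟨v, u, h4, h5, h6⟩ := hQ (x.1, x.2.2)
    have h7 := eval_mono_nat r h3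
    refine ⟨v, _, .comp h1 h4, h5, ?_⟩
    simp only [Polynomial.eval_add, Polynomial.eval_comp, Polynomial.eval_one]
    beta_reduce at h7
    omega
  · obtain ⟨_, -, -, h2⟩ := hp x
    have h4 := sz_take_le (L x) i
    simp only [foldl_cons_filter (fun a => q (x, a)), List.append_nil, sz_reverse]
    exact (sz_filter_le _ _).trans (h4.trans h2)

/-- A list with the indices of its entries. -/
def indexed (l : List α) : List (ℤ × α) := l.zipIdx.map fun p => ((p.2 : ℤ), p.1)

theorem foldl_indexed {δ : Type} (l : List δ) (i : ℕ) (acc : List (ℤ × δ)) :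
    l.foldl (fun s a => (s.1 + 1, (s.1, a) :: s.2)) ((i : ℤ), acc) =
      (((i + l.length : ℕ) : ℤ),
        ((l.zipIdx i).map fun p => ((p.2 : ℤ), p.1)).reverse ++ acc) := by
  induction l generalizing i acc with
  | nil => simp
  | cons a l ih =>
    have := ih (i + 1) (((i : ℤ), a) :: acc)
    push_cast at this
    rw [List.foldl_cons, this]
    simp only [List.zipIdx_cons, List.map_cons, List.reverse_cons, List.append_assoc,
      List.length_cons, List.cons_append, List.nil_append]
    push_cast
    rw [add_assoc, add_comm (1 : ℤ)]

theorem natSize_le_self (a : ℕ) : a.size ≤ a := Nat.size_le.2 a.lt_two_pow_self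

theorem sz_indexed_le (l : List α) : ∀ i, sz ((l.zipIdx i).map fun p => ((p.2 : ℤ), p.1)) ≤
    sz l * (i + l.length + 3) := by
  induction l with
  | nil => intro i; simp [sz_nil]
  | cons a l ih =>
    intro i
    have h := ih (i + 1)
    have h1 := natSize_le_self i
    have h2 := sz_pos a
    rw [List.zipIdx_cons, List.map_cons, sz_cons, sz_cons, sz_pair, sz_int, Int.natAbs_natCast]
    rw [List.length_cons]
    nlinarith [Nat.zero_le (sz a * l.length), Nat.zero_le (sz a * i)]

theorem PT.indexed {L : γ → List α} (hL : PT L) : PT (fun x => indexed (L x)) := by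
  have hL' := hL
  obtain ⟨_, q, hq⟩ := hL'
  have h := PT.reverse (PT.snd (PT.foldl
    (g := fun s : γ × (ℤ × List (ℤ × α)) × α => (s.2.1.1 + 1, (s.2.1.1, s.2.2) :: s.2.1.2))
    (z := fun _ => ((0 : ℤ), ([] : List (ℤ × α)))) hL (PT.pair (PT.const 0) PT.nil)
    (PT.pair (PT.add PT.id.snd.fst.fst (PT.const 1))
      (PT.cons (PT.pair PT.id.snd.fst.fst PT.id.snd.snd) PT.id.snd.fst.snd))
    (q + 3 + q * (q + 3)) fun x i => ?_))
  · have e : ∀ x, (((L x).foldl (fun (s : ℤ × List (ℤ × α)) a => (s.1 + 1, (s.1, a) :: s.2))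
        ((0 : ℤ), ([] : List (ℤ × α)))).2).reverse = Sched.indexed (L x) := by
      intro x
      have := foldl_indexed (L x) 0 []
      simp only [Nat.cast_zero] at this
      rw [this]
      simp [Sched.indexed]
    simpa only [e] using h
  · obtain ⟨_, -, -, h2⟩ := hq x
    have h4 := sz_take_le (L x) i
    have h5 := foldl_indexed ((L x).take i) 0 []
    simp only [Nat.cast_zero, List.append_nil] at h5
    simp only [h5, sz_pair, sz_reverse, sz_int, Int.natAbs_natCast]
    have h6 := sz_indexed_le ((L x).take i) 0
    have h7 := length_lt_sz ((L x).take i)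
    have h8 := natSize_le_self (0 + ((L x).take i).length)
    have h9 := h4.trans h2
    simp only [Polynomial.eval_add, Polynomial.eval_mul, Polynomial.eval_ofNat]
    have h10 : sz ((L x).take i) * (0 + ((L x).take i).length + 3) ≤
        q.eval (sz x) * (q.eval (sz x) + 3) := Nat.mul_le_mul h9 (by omega)
    omega

end PolyTimeLists

/-! ### Geometric thresholds -/

/-- One step of the search for a threshold: the state is the ratio, the current value, and the
bound that is to be exceeded. -/
def thrStep (s : ℤ × ℤ × ℤ) : ℤ × ℤ × ℤ := (s.1, s.2.1 * s.1, s.2.2)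

theorem thrStep_iterate (s : ℤ × ℤ × ℤ) (i : ℕ) :
    thrStep^[i] s = (s.1, s.2.1 * s.1 ^ i, s.2.2) := by
  induction i with
  | zero => simp
  | succ i ih => rw [Function.iterate_succ_apply', ih]; simp [thrStep, pow_succ, mul_assoc]

/-- The value at least doubles in each step, so the search takes at most as many steps as the bound
has bits. -/
theorem lt_mul_pow_of_size_le {a x r : ℤ} (ha : 2 ≤ a) (hx : 1 ≤ x) {i : ℕ}
    (hi : Nat.size r.natAbs ≤ i) : r < x * a ^ i := by
  have h1 : r.natAbs < 2 ^ i := Nat.size_le.1 hi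
  have h2 : (2 : ℤ) ^ i ≤ a ^ i := pow_le_pow_left₀ (by norm_num) ha i
  have h3 : (r.natAbs : ℤ) < 2 ^ i := by exact_mod_cast h1
  have h4 : r ≤ r.natAbs := Int.le_natAbs
  have h5 : 0 < a ^ i := by positivity
  nlinarith

theorem exists_lt_mul_pow {s : ℤ × ℤ × ℤ} (h : 2 ≤ s.1 ∧ 1 ≤ s.2.1) :
    ∃ i, s.2.2 < s.2.1 * s.1 ^ i := ⟨_, lt_mul_pow_of_size_le h.1 h.2 le_rfl⟩

/-- The number of steps that the search takes. -/
def thrCount (s : ℤ × ℤ × ℤ) : ℕ :=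
  if h : 2 ≤ s.1 ∧ 1 ≤ s.2.1 then Nat.find (exists_lt_mul_pow h) else 0

/-- The least number of the form `x * a ^ i` that exceeds `r`. -/
def thr (s : ℤ × ℤ × ℤ) : ℤ := (thrStep^[thrCount s] s).2.1

theorem thr_spec {a x r : ℤ} (ha : 2 ≤ a) (hx : 1 ≤ x) :
    ∃ i : ℕ, thr (a, x, r) = x * a ^ i ∧ r < x * a ^ i ∧ ∀ i' < i, x * a ^ i' ≤ r := by
  have h : 2 ≤ (a, x, r).1 ∧ 1 ≤ (a, x, r).2.1 := ⟨ha, hx⟩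
  refine ⟨thrCount (a, x, r), ?_, ?_, ?_⟩
  · rw [thr, thrStep_iterate]
  · rw [thrCount, dif_pos h]
    exact Nat.find_spec (exists_lt_mul_pow h)
  · intro i' hi'
    rw [thrCount, dif_pos h] at hi'
    exact not_lt.1 (Nat.find_min (exists_lt_mul_pow h) hi')

theorem PT.thr : PT thr := by
  refine PT.fst (PT.snd (f := fun s => thrStep^[thrCount s] s) ?_)
  have hle : ∀ s, thrCount s ≤ sz s := by
    intro s
    by_cases h : 2 ≤ s.1 ∧ 1 ≤ s.2.1
    · rw [thrCount, dif_pos h]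
      refine (Nat.find_min' _ (lt_mul_pow_of_size_le h.1 h.2 le_rfl)).trans ?_
      change _ ≤ sz (s.1, s.2.1, s.2.2)
      rw [sz_pair, sz_pair, sz_int s.2.2]; omega
    · rw [thrCount, dif_neg h]; omega
  -- `PT` demands halting on every argument. The guard therefore repeats the condition under which
  -- the search makes sense; otherwise the loop stops at once, in accordance with the default count
  -- 0.
  refine PT.while (f := thrStep) (q := fun s => (2 ≤ s.1 ∧ 1 ≤ s.2.1) ∧ s.2.1 ≤ s.2.2)
    (((PTDec.le (PT.const 2) PT.id.fst).and (PTDec.le (PT.const 1) PT.id.snd.fst)).and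
      (PTDec.le PT.id.snd.fst PT.id.snd.snd))
    (PT.pair PT.id.fst (PT.pair (PT.mul PT.id.snd.fst PT.id.fst) PT.id.snd.snd))
    thrCount (2 * Polynomial.X) ?_ ?_ ?_ ?_
  · intro s
    rw [thrStep_iterate]
    rintro ⟨⟨h1, h2⟩, h3⟩
    by_cases h : 2 ≤ s.1 ∧ 1 ≤ s.2.1
    · rw [thrCount, dif_pos h] at h3
      exact absurd (Nat.find_spec (exists_lt_mul_pow h)) (not_lt.2 h3)
    · rw [thrCount, dif_neg h] at h2
      simp only [pow_zero, mul_one] at h2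
      exact h ⟨h1, h2⟩
  · intro s i hi
    rw [thrStep_iterate]
    by_cases h : 2 ≤ s.1 ∧ 1 ≤ s.2.1
    · rw [thrCount, dif_pos h] at hi
      refine ⟨⟨h.1, ?_⟩, not_lt.1 (Nat.find_min (exists_lt_mul_pow h) hi)⟩
      have := h.1
      have : 0 < s.1 ^ i := pow_pos (by omega) i
      have := h.2
      change 1 ≤ s.2.1 * s.1 ^ i
      nlinarith
    · rw [thrCount, dif_neg h] at hi; omega
  · intro s
    have := hle s
    simp only [Polynomial.eval_mul, Polynomial.eval_X, Polynomial.eval_ofNat]; omega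
  · intro s i hi
    rw [thrStep_iterate]
    have h0 : sz s = sz s.1 + (sz s.2.1 + sz s.2.2 + 1) + 1 := rfl
    simp only [Polynomial.eval_mul, Polynomial.eval_X, Polynomial.eval_ofNat, sz_pair]
    rcases i with _ | i
    · simp; omega
    · by_cases h : 2 ≤ s.1 ∧ 1 ≤ s.2.1
      · rw [thrCount, dif_pos h] at hi
        have h1 := not_lt.1 (Nat.find_min (exists_lt_mul_pow h) hi)
        have h2 := h.1
        have h3 := h.2
        have h4 : 0 < s.1 ^ i := pow_pos (by omega) i
        have h5 : 0 ≤ s.2.1 * s.1 ^ i := by positivity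
        have h6 : sz (s.2.1 * s.1 ^ i) ≤ sz s.2.2 := by
          rw [sz_int, sz_int]
          have := natSize_mono (a := (s.2.1 * s.1 ^ i).natAbs) (b := s.2.2.natAbs) (by omega)
          omega
        have h7 : s.2.1 * s.1 ^ (i + 1) = s.2.1 * s.1 ^ i * s.1 := by ring
        rw [h7]
        have := sz_mul_le (s.2.1 * s.1 ^ i) s.1
        omega
      · rw [thrCount, dif_neg h] at hi; omega

/-! ### The algorithm -/

/-- A rational number as a pair of numerator and denominator. -/
abbrev RatC := ℤ × ℤ

/-- A job: size, weight, release date, machine, completion time. -/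
abbrev JobC := RatC × RatC × RatC × ℤ × RatC × Unit

/-- The input: `N`, `y`, `k`, the machine, the speeds, the jobs. -/
abbrev InpC := ℤ × ℤ × ℤ × ℤ × List RatC × List JobC × Unit

/-- The two powers `α ^ (α / δ)` and `α ^ k`, and the input. -/
abbrev CtxC := (ℤ × ℤ) × InpC

/-- A job of the machine: index, scaled processing time, completion time and threshold. -/
abbrev RowC := ℤ × ℤ × ℤ × ℤ

namespace CtxC

def parN (X : CtxC) : ℤ := X.2.1
def parAlpha (X : CtxC) : ℤ := X.2.2.1 * X.2.1 ^ 34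
def mach (X : CtxC) : ℤ := X.2.2.2.2.1
def speeds (X : CtxC) : List RatC := X.2.2.2.2.2.1
def jobs (X : CtxC) : List JobC := X.2.2.2.2.2.2.1

theorem pt_parN : PT parN := PT.id.snd.fst
theorem pt_parAlpha : PT parAlpha := PT.mul PT.id.snd.snd.fst (PT.pow PT.id.snd.fst 34)
theorem pt_mach : PT mach := PT.id.snd.snd.snd.snd.fst
theorem pt_speeds : PT speeds := PT.id.snd.snd.snd.snd.snd.fst
theorem pt_jobs : PT jobs := PT.id.snd.snd.snd.snd.snd.snd.fst

def speedNum (X : CtxC) : ℤ :=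
  ((indexed X.speeds).map fun a => if a.1 = X.mach then a.2.1 else 0).sum

def speedDen (X : CtxC) : ℤ :=
  ((indexed X.speeds).map fun a => if a.1 = X.mach then a.2.2 else 0).sum

theorem pt_speedNum : PT speedNum :=
  (pt_speeds.indexed.map (g := fun q : CtxC × ℤ × RatC => if q.2.1 = q.1.mach then q.2.2.1 else 0)
    (PT.ite (PTDec.eq PT.id.snd.fst (pt_mach.comp PT.id.fst)) PT.id.snd.snd.fst
      (PT.const 0))).listSum

theorem pt_speedDen : PT speedDen :=
  (pt_speeds.indexed.map (g := fun q : CtxC × ℤ × RatC => if q.2.1 = q.1.mach then q.2.2.2 else 0)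
    (PT.ite (PTDec.eq PT.id.snd.fst (pt_mach.comp PT.id.fst)) PT.id.snd.snd.snd
      (PT.const 0))).listSum

/-- The common denominator of all times. -/
def scale (X : CtxC) : ℤ :=
  -- The factor N³ gives 1/D ≤ 1/N³, which pays for a final shift of the schedule. The numerator of
  -- the speed makes p/s integral, and one factor 2 per job makes the scale exceed every job index.
  X.parN ^ 3 * X.speedNum * (X.jobs.map fun b => 2 * b.1.2 * b.2.2.1.2 * b.2.2.2.2.1.2).prod

theorem pt_scale : PT scale :=
  ((pt_parN.pow 3).mul pt_speedNum).mul
    (pt_jobs.map (g := fun q : CtxC × JobC => 2 * q.2.1.2 * q.2.2.2.1.2 * q.2.2.2.2.2.1.2)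
      ((((PT.const 2).mul PT.id.snd.fst.snd).mul PT.id.snd.snd.snd.fst.snd).mul
        PT.id.snd.snd.snd.snd.snd.fst.snd)).listProd

/-- The scaled release date of a job. -/
def release (q : CtxC × JobC) : ℤ := q.2.2.2.1.1 * (q.1.scale / q.2.2.2.1.2)

theorem pt_release : PT release :=
  PT.mul PT.id.snd.snd.snd.fst.fst
    (PT.div (pt_scale.comp PT.id.fst) PT.id.snd.snd.snd.fst.snd)

/-- The smallest scaled release date. -/
def releaseMin (X : CtxC) : ℤ :=
  -- For positive release dates the sum is at least each of them, so it is a starting value that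
  -- does not affect the minimum.
  (X.jobs.map fun b => release (X, b)).foldl min (X.jobs.map fun b => release (X, b)).sum

theorem pt_releaseMin : PT releaseMin :=
  PT.foldMin (pt_jobs.map pt_release) (pt_jobs.map pt_release).listSum

/-- The scaled data of a job. -/
def row (q : CtxC × ℤ × JobC) : RowC :=
  (q.2.1, q.2.2.1.1 * q.1.speedDen * (q.1.scale / (q.2.2.1.2 * q.1.speedNum)),
    q.2.2.2.2.2.2.1.1 * (q.1.scale / q.2.2.2.2.2.2.1.2),
    thr (q.1.1.1, q.1.releaseMin * q.1.1.2, release (q.1, q.2.2)))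

theorem pt_row : PT row :=
  PT.pair PT.id.snd.fst <| PT.pair
    ((PT.id.snd.snd.fst.fst.mul (pt_speedDen.comp PT.id.fst)).mul
      ((pt_scale.comp PT.id.fst).div
        (PT.id.snd.snd.fst.snd.mul (pt_speedNum.comp PT.id.fst)))) <| PT.pair
    (PT.id.snd.snd.snd.snd.snd.snd.fst.fst.mul
      ((pt_scale.comp PT.id.fst).div PT.id.snd.snd.snd.snd.snd.snd.fst.snd)) <|
    PT.thr.comp (PT.pair PT.id.fst.fst.fst (PT.pair
      ((pt_releaseMin.comp PT.id.fst).mul PT.id.fst.fst.snd)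
      (pt_release.comp (PT.pair PT.id.fst PT.id.snd.snd))))

/-- The jobs of the machine. -/
def rows (X : CtxC) : List RowC :=
  ((indexed X.jobs).filter fun a => decide (a.2.2.2.2.1 = X.mach)).map fun a => row (X, a)

theorem pt_rows : PT rows :=
  PT.map (PT.filter (q := fun q : CtxC × ℤ × JobC => q.2.2.2.2.2.1 = q.1.mach) pt_jobs.indexed
    (PTDec.eq PT.id.snd.snd.snd.snd.snd.fst (pt_mach.comp PT.id.fst))) pt_row

/-- The total processing time of the jobs with the same threshold that start late and complete
no later than the given job. -/
def volume (q : CtxC × RowC) : ℤ :=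
  (q.1.rows.map fun f => if (f.2.2.2 = q.2.2.2.2 ∧
    2 * q.1.parAlpha * f.2.2.2 ≤ 3 * (f.2.2.1 - f.2.1)) ∧ f.2.2.1 ≤ q.2.2.2.1
    then f.2.1 else 0).sum

theorem pt_volume : PT volume :=
  ((pt_rows.comp PT.id.fst).map (g := fun r : (CtxC × RowC) × RowC =>
    if (r.2.2.2.2 = r.1.2.2.2.2 ∧
      2 * r.1.1.parAlpha * r.2.2.2.2 ≤ 3 * (r.2.2.2.1 - r.2.2.1)) ∧ r.2.2.2.1 ≤ r.1.2.2.2.1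
    then r.2.2.1 else 0)
    (PT.ite (((PTDec.eq PT.id.snd.snd.snd.snd PT.id.fst.snd.snd.snd.snd).and
      (PTDec.le (((PT.const 2).mul (pt_parAlpha.comp PT.id.fst.fst)).mul PT.id.snd.snd.snd.snd)
        ((PT.const 3).mul (PT.id.snd.snd.snd.fst.sub PT.id.snd.snd.fst)))).and
      (PTDec.le PT.id.snd.snd.snd.fst PT.id.fst.snd.snd.snd.fst))
      PT.id.snd.snd.fst (PT.const 0))).listSum

/-- The sorting key of a job. -/
def key (q : CtxC × RowC) : ℤ :=
  max q.2.2.2.1 (q.1.parN ^ 4 * volume q ^ 2 / (q.1.parAlpha * q.2.2.2.2)) * q.1.scale + q.2.1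

theorem pt_key : PT key :=
  ((PT.max PT.id.snd.snd.snd.fst
    ((((pt_parN.comp PT.id.fst).pow 4).mul (pt_volume.pow 2)).div
      ((pt_parAlpha.comp PT.id.fst).mul PT.id.snd.snd.snd.snd))).mul
    (pt_scale.comp PT.id.fst)).add PT.id.snd.fst

/-- The completion time of the job `q.2` if the jobs with keys between those of `q.1.2` and
`q.2` are run one after the other, the first one being available from its relaxed starting
time. -/
def chain (q : (CtxC × RowC) × RowC) : ℤ :=
  if key q.1 ≤ key (q.1.1, q.2) then
    min (q.1.2.2.2.1 - q.1.2.2.1) (2 * q.1.2.2.2.2) +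
    (q.1.1.rows.map fun g =>
      if key q.1 ≤ key (q.1.1, g) ∧ key (q.1.1, g) ≤ key (q.1.1, q.2) then g.2.1 else 0).sum
  else 0

theorem pt_chain : PT chain :=
  PT.ite (PTDec.le (pt_key.comp PT.id.fst) (pt_key.comp (PT.pair PT.id.fst.fst PT.id.snd)))
    ((PT.min (PT.id.fst.snd.snd.snd.fst.sub PT.id.fst.snd.snd.fst)
      ((PT.const 2).mul PT.id.fst.snd.snd.snd.snd)).add
      ((pt_rows.comp PT.id.fst.fst).map (g := fun r : ((CtxC × RowC) × RowC) × RowC =>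
        if key r.1.1 ≤ key (r.1.1.1, r.2) ∧ key (r.1.1.1, r.2) ≤ key (r.1.1.1, r.1.2)
        then r.2.2.1 else 0)
        (PT.ite ((PTDec.le (pt_key.comp PT.id.fst.fst)
            (pt_key.comp (PT.pair PT.id.fst.fst.fst PT.id.snd))).and
          (PTDec.le (pt_key.comp (PT.pair PT.id.fst.fst.fst PT.id.snd))
            (pt_key.comp (PT.pair PT.id.fst.fst.fst PT.id.fst.snd))))
          PT.id.snd.snd.fst (PT.const 0))).listSum)
    (PT.const 0)

/-- The scaled completion time of a job. -/
def finish (q : CtxC × RowC) : ℤ :=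
  (q.1.rows.map fun f => chain ((q.1, f), q.2)).foldl max 0

theorem pt_finish : PT finish :=
  PT.foldMax ((pt_rows.comp PT.id.fst).map (g := fun r : (CtxC × RowC) × RowC =>
    chain ((r.1.1, r.2), r.1.2))
    (pt_chain.comp (PT.pair (PT.pair PT.id.fst.fst PT.id.snd) PT.id.fst.snd))) (PT.const 0)

/-- The result of the algorithm. -/
def output (X : CtxC) : List (ℤ × RatC) :=
  X.rows.map fun e => (e.1, finish (X, e) * X.scale + 1, X.scale * X.scale)

theorem pt_output : PT output :=
  pt_rows.map (g := fun q : CtxC × RowC =>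
    (q.2.1, finish q * q.1.scale + 1, q.1.scale * q.1.scale))
    (PT.pair PT.id.snd.fst (PT.pair ((pt_finish.mul (pt_scale.comp PT.id.fst)).add (PT.const 1))
      ((pt_scale.comp PT.id.fst).mul (pt_scale.comp PT.id.fst))))

end CtxC

/-! ### Running time of the algorithm. -/

/-- Exponentiation by repeated multiplication. -/
theorem exists_pow_runs : ∃ P : Prog, ∀ a e : ℕ, ∃ t,
    P.Runs (enc ((a : ℤ), (e : ℤ))) (enc ((a : ℤ) ^ e)) t := by
  obtain ⟨P₁, _, h₁⟩ : PT fun s : ℤ × ℤ => ((1 : ℤ), s) := PT.pair (PT.const 1) PT.id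
  obtain ⟨P₂, _, h₂⟩ : PTDec fun s : ℤ × ℤ × ℤ => 1 ≤ s.2.2 :=
    PTDec.le (PT.const 1) PT.id.snd.snd
  obtain ⟨P₃, _, h₃⟩ : PT fun s : ℤ × ℤ × ℤ => (s.1 * s.2.1, s.2.1, s.2.2 - 1) :=
    PT.pair (PT.mul PT.id.fst PT.id.snd.fst)
      (PT.pair PT.id.snd.fst (PT.sub PT.id.snd.snd (PT.const 1)))
  obtain ⟨P₄, _, h₄⟩ : PT fun s : ℤ × ℤ × ℤ => s.1 := PT.id.fst
  have hl : ∀ (e : ℕ) (b a : ℤ), ∃ t, (Prog.loop P₂ P₃).Runs (enc (b, a, (e : ℤ)))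
      (enc (b * a ^ e, a, (0 : ℤ))) t := by
    intro e
    induction e with
    | zero =>
      intro b a
      obtain ⟨v, t, c1, c2, -⟩ := h₂ (b, a, ((0 : ℕ) : ℤ))
      obtain rfl : v = .num 0 := by
        by_contra hv; simpa using c2.1 hv
      exact ⟨_, by simpa using Prog.Runs.loop_stop c1⟩
    | succ e ih =>
      intro b a
      obtain ⟨v, t, c1, c2, -⟩ := h₂ (b, a, ((e + 1 : ℕ) : ℤ))
      obtain ⟨t', d1, -⟩ := h₃ (b, a, ((e + 1 : ℕ) : ℤ))
      obtain ⟨u, k1⟩ := ih (b * a) a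
      have e1 : (((e + 1 : ℕ) : ℤ)) - 1 = (e : ℤ) := by push_cast; ring
      simp only [e1] at d1
      have e2 : b * a * a ^ e = b * a ^ (e + 1) := by ring
      rw [e2] at k1
      exact ⟨_, .loop_step c1 (c2.2 (by push_cast; omega)) d1 k1⟩
  refine ⟨.comp P₄ (.comp (.loop P₂ P₃) P₁), fun a e => ?_⟩
  obtain ⟨t₁, a1, -⟩ := h₁ ((a : ℤ), (e : ℤ))
  obtain ⟨t₂, a2⟩ := hl e 1 a
  obtain ⟨t₃, a3, -⟩ := h₄ ((1 : ℤ) * (a : ℤ) ^ e, (a : ℤ), (0 : ℤ))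
  rw [one_mul] at a2 a3
  exact ⟨_, .comp (.comp a1 a2) a3⟩

/-- The two powers of `α` that the algorithm needs. -/
def powers (N y k : ℕ) : ℤ × ℤ := ((alpha N y : ℤ) ^ shifts N y, (alpha N y : ℤ) ^ k)

theorem exists_powers_runs : ∃ P : Prog, ∀ N y k : ℕ, ∃ t,
    P.Runs (enc ((N : ℤ), (y : ℤ), (k : ℤ))) (enc (powers N y k)) t := by
  obtain ⟨P, hP⟩ := exists_pow_runs
  obtain ⟨P₁, _, h₁⟩ : PT fun s : ℤ × ℤ × ℤ => (s.2.1 * s.1 ^ 34, s.2.1 * s.1 ^ 34 * s.1) :=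
    PT.pair (PT.mul PT.id.snd.fst (PT.id.fst.pow 34))
      (PT.mul (PT.mul PT.id.snd.fst (PT.id.fst.pow 34)) PT.id.fst)
  obtain ⟨P₂, _, h₂⟩ : PT fun s : ℤ × ℤ × ℤ => (s.2.1 * s.1 ^ 34, s.2.2) :=
    PT.pair (PT.mul PT.id.snd.fst (PT.id.fst.pow 34)) PT.id.snd.snd
  refine ⟨.pair (.comp P P₁) (.comp P P₂), fun N y k => ?_⟩
  obtain ⟨t₁, a1, -⟩ := h₁ ((N : ℤ), (y : ℤ), (k : ℤ))
  obtain ⟨t₂, a2, -⟩ := h₂ ((N : ℤ), (y : ℤ), (k : ℤ))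
  obtain ⟨t₃, a3⟩ := hP (alpha N y) (shifts N y)
  obtain ⟨t₄, a4⟩ := hP (alpha N y) k
  have e1 : (y : ℤ) * (N : ℤ) ^ 34 = (alpha N y : ℤ) := by simp [alpha]
  have e2 : (y : ℤ) * (N : ℤ) ^ 34 * N = (shifts N y : ℤ) := by simp [alpha, shifts]
  simp only [e2] at a1
  simp only [e1] at a1 a2
  exact ⟨_, .pair (.comp a1 a3) (.comp a2 a4)⟩

/-- The algorithm, with its running time. -/
theorem exists_output_runs : ∃ (P : Prog) (c : ℕ) (f : ℕ → ℕ → ℕ),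
    ∀ N y k : ℕ, k < shifts N y → ∀ (l : ℤ) (sp : List RatC) (jobs : List JobC), ∃ t,
      P.Runs (enc ((N : ℤ), (y : ℤ), (k : ℤ), l, sp, jobs, ()))
        (enc (CtxC.output (powers N y k, (N : ℤ), (y : ℤ), (k : ℤ), l, sp, jobs, ()))) t ∧
      t ≤ f N y * sz ((N : ℤ), (y : ℤ), (k : ℤ), l, sp, jobs, ()) ^ c := by
  obtain ⟨P₀, h₀⟩ := exists_powers_runs
  obtain ⟨P₁, p, h₁⟩ : PT fun x : InpC => (x.1, x.2.1, x.2.2.1) :=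
    PT.pair PT.id.fst (PT.pair PT.id.snd.fst PT.id.snd.snd.fst)
  obtain ⟨P₂, q, h₂⟩ := CtxC.pt_output
  choose T hT using h₀
  obtain ⟨a, c, hp⟩ := exists_eval_le_mul_pow p
  obtain ⟨a', c', hq⟩ := exists_eval_le_mul_pow q
  -- Computing the two powers takes a number of steps that is not polynomial in the input length. As
  -- k ranges over finitely many values for given N and y, the sum over k bounds this work by a
  -- function of N and y.
  set H : ℕ → ℕ → ℕ := fun N y => ∑ k ∈ Finset.range (shifts N y), (T N y k + sz (powers N y k))
    with hH
  refine ⟨.comp P₂ (.pair (.comp P₀ P₁) (.prim .id)), c + c' + 2,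
    fun N y => a + H N y + a' * (H N y + 2) ^ c' + 4, fun N y k hk l sp jobs => ?_⟩
  set x : InpC := ((N : ℤ), (y : ℤ), (k : ℤ), l, sp, jobs, ()) with hx
  obtain ⟨t₁, b1, b2, -⟩ := h₁ x
  obtain ⟨t₂, d1, d2, -⟩ := h₂ (powers N y k, x)
  refine ⟨_, .comp (.pair (.comp b1 (hT N y k)) (.prim .id _)) d1, ?_⟩
  have hs := sz_pos x
  have hle : T N y k + sz (powers N y k) ≤ H N y :=
    Finset.single_le_sum (f := fun k => T N y k + sz (powers N y k)) (fun _ _ => Nat.zero_le _)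
      (Finset.mem_range.2 hk)
  have h3 := b2.trans (hp _ hs)
  have h4 : t₂ ≤ a' * ((H N y + 2) * sz x) ^ c' := by
    refine d2.trans ((hq _ (sz_pos _)).trans ?_)
    gcongr
    rw [sz_pair]
    nlinarith
  have e0 : (enc x).size = sz x := rfl
  rw [e0]
  have m : ∀ i, i ≤ c + c' + 2 → sz x ^ i ≤ sz x ^ (c + c' + 2) := fun i hi =>
    Nat.pow_le_pow_right hs hi
  have m1 := m c (by omega)
  have m2 := m c' (by omega)
  have m3 := m 2 (by omega)
  have m4 := m 1 (by omega)
  have m5 := m 0 (by omega)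
  rw [mul_pow, ← mul_assoc] at h4
  have m1' := Nat.mul_le_mul_left a m1
  have m2' := Nat.mul_le_mul_left (a' * (H N y + 2) ^ c') m2
  have m6 := Nat.mul_le_mul_left (H N y) m5
  have e3 : (a + H N y + a' * (H N y + 2) ^ c' + 4) * sz x ^ (c + c' + 2) =
    a * sz x ^ (c + c' + 2) + H N y * sz x ^ (c + c' + 2) +
      a' * (H N y + 2) ^ c' * sz x ^ (c + c' + 2) + 4 * sz x ^ (c + c' + 2) := by ring
  rw [e3]
  simp only [pow_zero, pow_one, mul_one] at m4 m5 m6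
  omega

/-! ### Combining the schedules of one machine -/

/-- Disjoint intervals inside `[a, b]` have total length at most `b - a`. -/
theorem sum_le_of_disjoint_intervals {ι : Type} (T C : ι → ℤ) (a : ℤ)
    (s : Finset ι) : ∀ b : ℤ, a ≤ b → (∀ x ∈ s, 0 < T x ∧ a ≤ C x - T x ∧ C x ≤ b) →
    (∀ x ∈ s, ∀ x' ∈ s, x ≠ x' → C x ≤ C x' - T x' ∨ C x' ≤ C x - T x) →
    ∑ x ∈ s, T x ≤ b - a := by
  classical
  induction s using Finset.induction_on_max_value C with
  | empty => intro b hab _ _; simpa using hab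
  | insert x s hx hmax ih =>
    intro b _ h hd
    rw [Finset.sum_insert hx]
    have h1 := h x (Finset.mem_insert_self _ _)
    have h2 := ih (C x - T x) h1.2.1 (fun z hz => ?_) (fun z hz z' hz' => hd z
      (Finset.mem_insert_of_mem hz) z' (Finset.mem_insert_of_mem hz'))
    · omega
    · have h3 := h z (Finset.mem_insert_of_mem hz)
      have h4 := hmax z hz
      refine ⟨h3.1, h3.2.1, ?_⟩
      rcases hd z (Finset.mem_insert_of_mem hz) x (Finset.mem_insert_self _ _)
        (fun e => hx (e ▸ hz)) with h5 | h5 <;> omega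

/-- The jobs of one machine in integral time: index, processing time, completion time in the
given schedules, threshold of the band, and density. -/
structure MachineData (ι : Type) where
  J : Finset ι
  idx : ι → ℤ
  T : ι → ℤ
  C : ι → ℤ
  B : ι → ℤ
  d : ι → ℚ
  N : ℤ
  y : ℤ
  D : ℤ
  hN : 36 ≤ N
  hy : 1 ≤ y
  hD : N ^ 3 ≤ D
  idx_nonneg : ∀ j ∈ J, 0 ≤ idx j
  idx_lt : ∀ j ∈ J, idx j < D
  idx_inj : ∀ i ∈ J, ∀ j ∈ J, idx i = idx j → i = j
  hT : ∀ j ∈ J, 0 < T j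
  hB : ∀ j ∈ J, 0 < B j
  hs : ∀ j ∈ J, 0 < C j - T j
  hd : ∀ j ∈ J, 0 ≤ d j
  -- Bands are identified by their thresholds: equal `B` means the same band, hence the same given
  -- schedule.
  disj : ∀ i ∈ J, ∀ j ∈ J, B i = B j → i ≠ j → C i ≤ C j - T j ∨ C j ≤ C i - T i
  -- The factor 2 here and in `decay` comes from Ψ ≤ 2B.
  size_le : ∀ j ∈ J, T j ≤ 2 * B j * y * N ^ 25
  -- A later band is released at Ψ_{i,k+1} or after, which carries one factor α more than the
  -- threshold of band i.
  le_start : ∀ i ∈ J, ∀ j ∈ J, B i < B j → y * N ^ 34 * B i ≤ C j - T j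
  le_thr : ∀ i ∈ J, ∀ j ∈ J, B i < B j → y * N ^ 34 * B i ≤ B j
  -- Of the decay factor (1+δ)^y only the lower bound 54 is needed.
  decay : ∀ i ∈ J, ∀ j ∈ J, B i = B j → 2 * (y * N ^ 34) * B i ≤ 3 * (C i - T i) →
    C i + 2 * B i * y * N ^ 28 ≤ C j → 54 * d j ≤ d i

namespace MachineData

variable {ι : Type} (M : MachineData ι)

def al : ℤ := M.y * M.N ^ 34

/-- A job is late if it starts near or after the earliest start in the next band. -/
abbrev Late (j : ι) : Prop := 2 * M.al * M.B j ≤ 3 * (M.C j - M.T j)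

def vol (j : ι) : ℤ :=
  ∑ x ∈ M.J, if (M.B x = M.B j ∧ 2 * M.al * M.B x ≤ 3 * (M.C x - M.T x)) ∧ M.C x ≤ M.C j
    then M.T x else 0

/-- The quadratic term balances two demands: `kap` ≤ t must keep the late volume of a band to a
small fraction of t, and postponing a job to `kap` must cost less than the density decay saves. -/
def kap (j : ι) : ℤ := max (M.C j) (M.N ^ 4 * M.vol j ^ 2 / (M.al * M.B j))

/-- Since 0 ≤ `idx` < `D`, this orders the jobs by `kap` and breaks ties by index. -/
def key (j : ι) : ℤ := M.kap j * M.D + M.idx j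

/-- Capping the start of i by 2B keeps the release date of A_k respected, and makes even a very late
i available before any later band begins. The value 0 in the other case is neutral in the maximum
over i. -/
def chain (i j : ι) : ℤ :=
  if M.key i ≤ M.key j then min (M.C i - M.T i) (2 * M.B i) +
    ∑ g ∈ M.J, if M.key i ≤ M.key g ∧ M.key g ≤ M.key j then M.T g else 0
  else 0

theorem y_pos : 0 < M.y := lt_of_lt_of_le one_pos M.hy
theorem N_pos : 0 < M.N := lt_of_lt_of_le (by norm_num) M.hN
theorem D_pos : 0 < M.D := lt_of_lt_of_le (pow_pos M.N_pos 3) M.hD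
theorem al_pos : 0 < M.al := mul_pos M.y_pos (pow_pos M.N_pos _)

theorem pow_mul_le {a b : ℕ} (c : ℤ) (hc : c ≤ 36 ^ b) : c * M.N ^ a ≤ M.N ^ (a + b) := by
  have h1 : (36 : ℤ) ^ b ≤ M.N ^ b := pow_le_pow_left₀ (by norm_num) M.hN b
  have h2 := pow_pos M.N_pos a
  rw [pow_add, mul_comm]
  nlinarith

theorem al_ge : 36 ≤ M.al := by
  have h1 := M.pow_mul_le (a := 0) (b := 34) 36 (by norm_num)
  have := M.hy
  simp only [pow_zero, zero_add, mul_one] at h1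
  unfold al
  nlinarith

theorem C_pos {j : ι} (hj : j ∈ M.J) : 0 < M.C j := by
  have := M.hs j hj; have := M.hT j hj; omega

theorem C_le_kap (j : ι) : M.C j ≤ M.kap j := le_max_left _ _

theorem vol_eq_sum (j : ι) :
    M.vol j = ∑ x ∈ M.J with (M.B x = M.B j ∧ M.Late x) ∧ M.C x ≤ M.C j, M.T x := by
  rw [vol, Finset.sum_filter]

theorem sum_T_mono {s t : Finset ι} (hst : s ⊆ t) (ht : t ⊆ M.J) :
    ∑ x ∈ s, M.T x ≤ ∑ x ∈ t, M.T x :=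
  Finset.sum_le_sum_of_subset_of_nonneg hst fun x hx _ => (M.hT x (ht hx)).le

theorem vol_nonneg (j : ι) : 0 ≤ M.vol j := by
  rw [vol_eq_sum]
  exact Finset.sum_nonneg fun x hx => (M.hT x (Finset.mem_filter.1 hx).1).le

theorem vol_mono {i j : ι} (hB : M.B i = M.B j) (hC : M.C i ≤ M.C j) : M.vol i ≤ M.vol j := by
  rw [vol_eq_sum, vol_eq_sum]
  refine M.sum_T_mono (fun x hx => ?_) (Finset.filter_subset _ _)
  simp only [Finset.mem_filter] at hx ⊢
  exact ⟨hx.1, ⟨hx.2.1.1.trans hB, hx.2.1.2⟩, hx.2.2.trans hC⟩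

/-- A late job of the band that completes no later than j would precede j, and then j would be late
as well. -/
theorem vol_eq_zero {j : ι} (hj : j ∈ M.J) (h : ¬ M.Late j) : M.vol j = 0 := by
  rw [vol_eq_sum]
  refine Finset.sum_eq_zero fun x hx => ?_
  obtain ⟨hx, ⟨hB, hl⟩, hC⟩ := Finset.mem_filter.1 hx
  exfalso
  have hne : x ≠ j := by rintro rfl; exact h hl
  have h1 := M.hT x hx
  have h2 := M.hT j hj
  rcases M.disj x hx j hj hB hne with h3 | h3
  · apply h; unfold Late at *; rw [← hB]; linarith
  · omega

theorem kap_eq {j : ι} (hj : j ∈ M.J) (h : ¬ M.Late j) : M.kap j = M.C j := by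
  have := M.C_pos hj
  rw [kap, M.vol_eq_zero hj h]
  simp [this.le]

/-- The start is below 2αB/3, and the size bound 2ByN²⁵ is at most αB/3 because 6N²⁵ ≤ N³⁴. -/
theorem C_le_of_not_late {j : ι} (hj : j ∈ M.J) (h : ¬ M.Late j) : M.C j ≤ M.al * M.B j := by
  unfold Late at h
  have h1 := M.size_le j hj
  have h2 := M.pow_mul_le (a := 25) (b := 9) 6 (by norm_num)
  have h3 := mul_le_mul_of_nonneg_left h2 (mul_pos M.y_pos (M.hB j hj)).le
  have h4 : M.al * M.B j = M.y * M.B j * M.N ^ 34 := by unfold al; ring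
  norm_num at h3
  nlinarith

theorem start_of_lt {i j : ι} (hi : i ∈ M.J) (hj : j ∈ M.J) (h : M.B i < M.B j) :
    M.al * M.B i ≤ M.C j - M.T j := M.le_start i hi j hj h

/-- In different bands, the job of the lower band is completed by αB, when the higher band has not
yet begun. -/
theorem disj_of_not_late {i j : ι} (hi : i ∈ M.J) (hj : j ∈ M.J) (h : ¬ M.Late i)
    (h' : ¬ M.Late j) (hne : i ≠ j) : M.C i ≤ M.C j - M.T j ∨ M.C j ≤ M.C i - M.T i := by
  rcases lt_trichotomy (M.B i) (M.B j) with hB | hB | hB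
  · exact Or.inl ((M.C_le_of_not_late hi h).trans (M.start_of_lt hi hj hB))
  · exact M.disj i hi j hj hB hne
  · exact Or.inr ((M.C_le_of_not_late hj h').trans (M.start_of_lt hj hi hB))

theorem kap_le_of_key_le {i j : ι} (hi : i ∈ M.J) (hj : j ∈ M.J) (h : M.key i ≤ M.key j) :
    M.kap i ≤ M.kap j := by
  by_contra hlt
  have h1 := M.idx_nonneg i hi
  have h2 := M.idx_lt j hj
  have h3 := M.D_pos
  unfold key at h
  nlinarith

theorem key_inj {i j : ι} (hi : i ∈ M.J) (hj : j ∈ M.J) (h : M.key i = M.key j) : i = j := by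
  have h1 := M.kap_le_of_key_le hi hj h.le
  have h2 := M.kap_le_of_key_le hj hi h.ge
  have h3 : M.kap i = M.kap j := le_antisymm h1 h2
  unfold key at h
  rw [h3] at h
  exact M.idx_inj i hi j hj (by linarith)

theorem sum_T_eq_filter (p : ι → Prop) [DecidablePred p] :
    (∑ g ∈ M.J, if p g then M.T g else 0) = ∑ g ∈ M.J with p g, M.T g := by
  rw [Finset.sum_filter]

/-! #### The volume of the late jobs -/

/-- The volume V in the highest band satisfies N⁴V² ≤ 2tαB by the definition of `kap`. The lower
bands have αB' ≤ B, so by induction their volume Y satisfies N⁴Y² ≤ 8tB, which is smaller by a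
factor of order α. The inequality (V+Y)² ≤ 2V² + 2Y² then leaves room within 8tc. -/
theorem late_sum_sq_le {t : ℤ} (ht : 1 ≤ t) (s : Finset ι) : ∀ c : ℤ, 0 ≤ c →
    (∀ x ∈ s, x ∈ M.J ∧ M.Late x ∧ M.kap x ≤ t ∧ M.al * M.B x ≤ c) →
    M.N ^ 4 * (∑ x ∈ s, M.T x) ^ 2 ≤ 8 * t * c := by
  induction s using Finset.strongInduction with
  | H s ih =>
    intro c hc h
    rcases s.eq_empty_or_nonempty with rfl | hne
    · simp; positivity
    obtain ⟨x₀, hx₀, hmax⟩ := s.exists_max_image M.B hne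
    have hs₁ : (s.filter fun x => M.B x = M.B x₀).Nonempty := ⟨x₀, by simp [hx₀]⟩
    -- The job of the highest band in `s` that completes last: its `vol` counts all jobs of `s` in
    -- that band.
    obtain ⟨x₁, hx₁, hmax₁⟩ := Finset.exists_max_image _ M.C hs₁
    rw [Finset.mem_filter] at hx₁
    have hV : ∑ x ∈ s with M.B x = M.B x₀, M.T x ≤ M.vol x₁ := by
      rw [vol_eq_sum]
      refine M.sum_T_mono (fun x hx => ?_) (Finset.filter_subset _ _)
      have hx' := Finset.mem_filter.1 hx
      have := h x hx'.1
      simp only [Finset.mem_filter]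
      exact ⟨this.1, ⟨hx'.2.trans hx₁.2.symm, this.2.1⟩, hmax₁ x hx⟩
    have hV0 : 0 ≤ ∑ x ∈ s with M.B x = M.B x₀, M.T x :=
      Finset.sum_nonneg fun x hx => (M.hT x (h x (Finset.mem_filter.1 hx).1).1).le
    have h1 := h x₁ hx₁.1
    have hpos : 0 < M.al * M.B x₁ := mul_pos M.al_pos (M.hB x₁ h1.1)
    have hv : M.N ^ 4 * M.vol x₁ ^ 2 < (t + 1) * (M.al * M.B x₁) := by
      have h2 : M.N ^ 4 * M.vol x₁ ^ 2 / (M.al * M.B x₁) < t + 1 :=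
        lt_of_le_of_lt ((le_max_right _ _).trans h1.2.2.1) (by omega)
      rwa [Int.ediv_lt_iff_lt_mul hpos] at h2
    have hN4 : 0 < M.N ^ 4 := pow_pos M.N_pos 4
    -- For the lower bands the bound `c` drops to the threshold of the highest band, without its
    -- factor α.
    have hY := ih (s.filter fun x => ¬ M.B x = M.B x₀)
      (Finset.filter_ssubset.2 ⟨x₀, hx₀, by simp⟩) (M.B x₀) (M.hB x₀ (h x₀ hx₀).1).le
      (fun x hx => by
        have hx' := Finset.mem_filter.1 hx
        have h2 := h x hx'.1
        exact ⟨h2.1, h2.2.1, h2.2.2.1, M.le_thr x h2.1 x₀ (h x₀ hx₀).1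
          (lt_of_le_of_ne (hmax x hx'.1) hx'.2)⟩)
    rw [← Finset.sum_filter_add_sum_filter_not s (fun x => M.B x = M.B x₀)]
    set V := ∑ x ∈ s with M.B x = M.B x₀, M.T x
    set Y := ∑ x ∈ s with ¬ M.B x = M.B x₀, M.T x
    have h3 : M.N ^ 4 * V ^ 2 ≤ 2 * t * (M.al * M.B x₁) := by
      have : V ^ 2 ≤ M.vol x₁ ^ 2 := pow_le_pow_left₀ hV0 hV 2
      nlinarith
    rw [hx₁.2] at h3 hpos
    have h4 : M.N ^ 4 * (V + Y) ^ 2 ≤ 2 * (M.N ^ 4 * V ^ 2) + 2 * (M.N ^ 4 * Y ^ 2) := by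
      nlinarith [mul_nonneg hN4.le (sq_nonneg (V - Y))]
    have h5 := (h x₀ hx₀).2.2.2
    have h6 : 36 * M.B x₀ ≤ M.al * M.B x₀ :=
      mul_le_mul_of_nonneg_right M.al_ge (M.hB x₀ (h x₀ hx₀).1).le
    have h7 : t * (36 * M.B x₀) ≤ t * (M.al * M.B x₀) := mul_le_mul_of_nonneg_left h6 (by omega)
    have h8 : t * (M.al * M.B x₀) ≤ t * c := mul_le_mul_of_nonneg_left h5 (by omega)
    nlinarith

theorem late_sum_le {t : ℤ} (ht : 1 ≤ t) :
    M.N ^ 2 * ∑ x ∈ M.J with M.Late x ∧ M.kap x ≤ t, M.T x ≤ 4 * t := by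
  -- A late job has αB at most 3/2 of its start, hence at most 3t/2. The square is then at most 12t²
  -- ≤ (4t)².
  have h := M.late_sum_sq_le ht (M.J.filter fun x => M.Late x ∧ M.kap x ≤ t) (3 * t / 2)
    (by omega) (fun x hx => by
      obtain ⟨h1, h2, h3⟩ := Finset.mem_filter.1 hx
      refine ⟨h1, h2, h3, ?_⟩
      have h4 := M.C_le_kap x
      have h5 := M.hT x h1
      have h6 : 2 * (M.al * M.B x) ≤ 3 * (M.C x - M.T x) := by
        have := h2; unfold Late at this; linarith
      omega)
  have h1 : 2 * (3 * t / 2) ≤ 3 * t := by omega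
  set X := ∑ x ∈ M.J with M.Late x ∧ M.kap x ≤ t, M.T x
  refine abs_le_of_sq_le_sq' (a := M.N ^ 2 * X) (b := 4 * t) ?_ (by omega) |>.2
  nlinarith

/-- No job is delayed much beyond its key. -/
theorem chain_le {i j : ι} (hi : i ∈ M.J) (hj : j ∈ M.J) :
    M.N ^ 2 * M.chain i j ≤ (M.N ^ 2 + 4) * M.kap j := by
  have hk : 0 < M.kap j := lt_of_lt_of_le (M.C_pos hj) (M.C_le_kap j)
  have hN2 : 0 < M.N ^ 2 := pow_pos M.N_pos 2
  rw [chain]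
  split_ifs with hij
  swap
  · nlinarith
  have hlate := M.late_sum_le (t := M.kap j) (by omega)
  rw [sum_T_eq_filter, ← Finset.sum_filter_add_sum_filter_not _ (fun x => M.Late x)]
  have h1 : ∑ x ∈ (M.J.filter fun g => M.key i ≤ M.key g ∧ M.key g ≤ M.key j) with M.Late x,
      M.T x ≤ ∑ x ∈ M.J with M.Late x ∧ M.kap x ≤ M.kap j, M.T x := by
    refine M.sum_T_mono (fun x hx => ?_) (Finset.filter_subset _ _)
    simp only [Finset.mem_filter] at hx ⊢
    exact ⟨hx.1.1, hx.2, M.kap_le_of_key_le hx.1.1 hj hx.1.2.2⟩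
  -- The jobs of the chain that are not late keep their old intervals. These are disjoint and lie
  -- between the relaxed start of i and `kap j`, so only the late jobs cause delay.
  have h2 := sum_le_of_disjoint_intervals M.T M.C (min (M.C i - M.T i) (2 * M.B i))
    ((M.J.filter fun g => M.key i ≤ M.key g ∧ M.key g ≤ M.key j).filter fun x => ¬ M.Late x)
    (M.kap j) ?_ ?_ ?_
  · nlinarith
  · have h3 := M.kap_le_of_key_le hi hj hij
    have h4 := M.C_le_kap i
    have h5 := M.hT i hi
    have := min_le_left (M.C i - M.T i) (2 * M.B i)
    omega
  · intro x hx
    simp only [Finset.mem_filter] at hx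
    obtain ⟨⟨hx, hix, hxj⟩, hxl⟩ := hx
    have h3 := M.kap_le_of_key_le hi hx hix
    have h4 := M.kap_le_of_key_le hx hj hxj
    have h5 := M.C_le_kap i
    have h6 := M.hT i hi
    have h7 := M.hT x hx
    have h8 := M.kap_eq hx hxl
    refine ⟨h7, ?_, by omega⟩
    have m1 := min_le_left (M.C i - M.T i) (2 * M.B i)
    have m2 := min_le_right (M.C i - M.T i) (2 * M.B i)
    -- If i is late, x cannot be in a lower band, since it would complete before i starts, against
    -- the order of keys. In the same band it follows i, and in a higher band it starts after αB ≥
    -- 2B; the latter is where the cap 2B is needed.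
    by_cases hil : M.Late i
    · rcases lt_trichotomy (M.B x) (M.B i) with hB | hB | hB
      · have h9 := M.C_le_of_not_late hx hxl
        have h10 := M.start_of_lt hx hi hB
        omega
      · have hne : x ≠ i := by rintro rfl; exact hxl hil
        rcases M.disj x hx i hi hB hne with h9 | h9 <;> omega
      · have h9 := M.start_of_lt hi hx hB
        have h10 := M.al_ge
        have h11 := M.hB i hi
        nlinarith
    · by_cases hne : x = i
      · subst hne; exact m1
      · rcases M.disj_of_not_late hx hi hxl hil hne with h9 | h9 <;> omega
  · intro x hx x' hx' hne
    simp only [Finset.mem_filter] at hx hx'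
    exact M.disj_of_not_late hx.1.1 hx'.1.1 hx.2 hx'.2 hne

/-! #### The cost of the late jobs that are postponed -/

/-- The additional jobs overlap neither i nor each other, so they fit between the two completion
times. -/
theorem vol_sub_le {i j : ι} (hi : i ∈ M.J) (hB : M.B i = M.B j)
    (hC : M.C i ≤ M.C j) : M.vol j - M.vol i ≤ M.C j - M.C i := by
  have h1 : M.vol j = M.vol i +
      ∑ x ∈ M.J with (M.B x = M.B j ∧ M.Late x) ∧ M.C i < M.C x ∧ M.C x ≤ M.C j, M.T x := by
    rw [vol_eq_sum, vol_eq_sum, ← Finset.sum_filter_add_sum_filter_not _ (fun x => M.C x ≤ M.C i),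
      Finset.filter_filter, Finset.filter_filter]
    congr 1
    · refine Finset.sum_congr (Finset.filter_congr fun x _ => ?_) fun _ _ => rfl
      rw [hB]
      exact ⟨fun h => ⟨h.1.1, h.2⟩, fun h => ⟨⟨h.1, h.2.trans hC⟩, h.2⟩⟩
    · refine Finset.sum_congr (Finset.filter_congr fun x _ => ?_) fun _ _ => rfl
      rw [not_le, and_assoc, and_comm (a := M.C x ≤ M.C j)]
  have h2 := sum_le_of_disjoint_intervals M.T M.C (M.C i)
    (M.J.filter fun x => (M.B x = M.B j ∧ M.Late x) ∧ M.C i < M.C x ∧ M.C x ≤ M.C j) (M.C j) hC ?_ ?_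
  · omega
  · intro x hx
    obtain ⟨hx, ⟨hxB, -⟩, h3, h4⟩ := Finset.mem_filter.1 hx
    have h5 := M.hT x hx
    refine ⟨h5, ?_, h4⟩
    have h6 := M.hT i hi
    rcases M.disj i hi x hx (hB.trans hxB.symm) (by rintro rfl; omega) with h7 | h7 <;> omega
  · intro x hx x' hx' hne
    simp only [Finset.mem_filter] at hx hx'
    exact M.disj x hx.1 x' hx'.1 (hx.2.1.1.trans hx'.2.1.1.symm) hne

/-- Decay is given in terms of time, but the keys are in terms of volume; a gap in volume forces at
least the same gap in time. -/
theorem decay_of_vol {i j : ι} (hi : i ∈ M.J) (hj : j ∈ M.J) (hl : M.Late i)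
    (hB : M.B i = M.B j) (h : M.vol i + 2 * M.B i * M.y * M.N ^ 28 ≤ M.vol j) :
    54 * M.d j ≤ M.d i := by
  refine M.decay i hi j hj hB hl ?_
  have h0 : 0 < 2 * M.B i * M.y * M.N ^ 28 := by
    have := M.hB i hi; have := M.y_pos; have := M.N_pos; positivity
  have h1 : M.C i ≤ M.C j := by
    by_contra hlt
    have := M.vol_mono hB.symm (not_le.1 hlt).le
    omega
  have := M.vol_sub_le hi hB h1
  omega

/-- The late jobs of the band with threshold `b`. -/
def band (b : ℤ) : Finset ι := M.J.filter fun x => M.B x = b ∧ M.Late x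

theorem mem_band {b : ℤ} {x : ι} : x ∈ M.band b ↔ x ∈ M.J ∧ M.B x = b ∧ M.Late x := by
  simp [band]

theorem vol_sub_T {b : ℤ} {g : ι} (hg : g ∈ M.band b) :
    M.vol g - M.T g = ∑ x ∈ M.band b with M.C x < M.C g, M.T x := by
  classical
  obtain ⟨h1, h2, h3⟩ := M.mem_band.1 hg
  have e : (M.J.filter fun x => (M.B x = M.B g ∧ M.Late x) ∧ M.C x ≤ M.C g) =
      insert g ((M.band b).filter fun x => M.C x < M.C g) := by
    ext x
    simp only [Finset.mem_filter, Finset.mem_insert, M.mem_band]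
    constructor
    · rintro ⟨hx, ⟨hB, hl⟩, hC⟩
      by_cases hxg : x = g
      · exact Or.inl hxg
      · have h4 := M.hT x hx
        have h5 := M.hT g h1
        refine Or.inr ⟨⟨hx, hB.trans h2, hl⟩, ?_⟩
        rcases M.disj x hx g h1 hB hxg with h6 | h6 <;> omega
    · rintro (rfl | ⟨⟨hx, hB, hl⟩, hC⟩)
      · exact ⟨h1, ⟨rfl, h3⟩, le_rfl⟩
      · exact ⟨hx, ⟨hB.trans h2.symm, hl⟩, hC.le⟩
  rw [vol_eq_sum, e, Finset.sum_insert (by simp)]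
  ring

/-- The first late job of a band at which the volume reaches `a`. -/
theorem exists_first {b a : ℤ} (ha : 0 < a) {j : ι} (hj : j ∈ M.band b) (h : a ≤ M.vol j) :
    ∃ g ∈ M.band b, a ≤ M.vol g ∧ M.vol g - M.T g < a := by
  obtain ⟨g, hg, hmin⟩ := ((M.band b).filter fun x => a ≤ M.vol x).exists_min_image M.C
    ⟨j, Finset.mem_filter.2 ⟨hj, h⟩⟩
  obtain ⟨hg, hga⟩ := Finset.mem_filter.1 hg
  refine ⟨g, hg, hga, ?_⟩
  rw [M.vol_sub_T hg]
  rcases ((M.band b).filter fun x => M.C x < M.C g).eq_empty_or_nonempty with he | hne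
  · rw [he]; simpa using ha
  · obtain ⟨f, hf, hmax⟩ := Finset.exists_max_image _ M.C hne
    obtain ⟨hfb, hfC⟩ := Finset.mem_filter.1 hf
    have hf' := M.mem_band.1 hfb
    by_contra hcon
    have h1 : ∑ x ∈ M.band b with M.C x < M.C g, M.T x ≤ M.vol f := by
      rw [vol_eq_sum]
      refine M.sum_T_mono (fun x hx => ?_) (Finset.filter_subset _ _)
      have h2 := hmax x hx
      have h3 := M.mem_band.1 (Finset.mem_filter.1 hx).1
      exact Finset.mem_filter.2 ⟨h3.1, ⟨h3.2.1.trans hf'.2.1.symm, h3.2.2⟩, h2⟩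
    have := hmin f (Finset.mem_filter.2 ⟨hfb, (not_lt.1 hcon).trans h1⟩)
    omega

/-- The length of the blocks of time in which a band is divided. -/
def blk (b : ℤ) : ℤ := 4 * b * M.y * M.N ^ 28

theorem blk_pos {b : ℤ} (hb : 0 < b) : 0 < M.blk b := by
  have := M.y_pos; have := M.N_pos
  unfold blk; positivity

/-- A single job fills less than half a block, so passing a volume mark overshoots it by less than
half a block. -/
theorem two_mul_T_le_blk {j : ι} (hj : j ∈ M.J) : 2 * M.T j + 2 ≤ M.blk (M.B j) := by
  have h1 := M.size_le j hj
  have hB := M.hB j hj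
  have h2 := M.pow_mul_le (a := 25) (b := 3) 36 (by norm_num)
  have h3 := mul_le_mul_of_nonneg_left h2 (mul_pos M.y_pos hB).le
  have h4 : 0 < M.y * M.B j * M.N ^ 25 := mul_pos (mul_pos M.y_pos hB) (pow_pos M.N_pos _)
  have h5 : M.blk (M.B j) = 4 * (M.y * M.B j * M.N ^ (25 + 3)) := by unfold blk; ring
  nlinarith

/-- A block is twice the separation required for decay. Thus the first job g that reaches a block
boundary is still half a block, one full separation, before the next boundary, and each block
contributes a factor 54. -/
theorem density_le {b : ℤ} (hb : 0 < b) {x : ι} (hx : x ∈ M.band b) (hxv : M.vol x ≤ M.blk b)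
    (k : ℕ) : ∀ j ∈ M.band b, (k + 2) * M.blk b ≤ M.vol j → 54 ^ (k + 1) * M.d j ≤ M.d x := by
  have hu := M.blk_pos hb
  obtain ⟨x1, x2, x3⟩ := M.mem_band.1 hx
  induction k with
  | zero =>
    intro j hj hv
    obtain ⟨j1, j2, j3⟩ := M.mem_band.1 hj
    have h := M.decay_of_vol x1 j1 x3 (x2.trans j2.symm) (by
      have : 2 * (2 * b * M.y * M.N ^ 28) = M.blk b := by unfold blk; ring
      rw [x2]; push_cast at hv; linarith)
    simpa using h
  | succ k ih =>
    intro j hj hv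
    obtain ⟨j1, j2, j3⟩ := M.mem_band.1 hj
    push_cast at hv
    obtain ⟨g, hg, g1, g2⟩ := M.exists_first (a := (k + 2) * M.blk b) (by positivity) hj
      (by nlinarith)
    obtain ⟨g3, g4, g5⟩ := M.mem_band.1 hg
    have h1 := ih g hg g1
    have h2 := M.decay_of_vol g3 j1 g5 (g4.trans j2.symm) (by
      have e : 2 * (2 * b * M.y * M.N ^ 28) = M.blk b := by unfold blk; ring
      have h3 := M.two_mul_T_le_blk g3
      rw [g4] at h3 ⊢
      nlinarith)
    have : (54 : ℚ) ^ (k + 1) * (54 * M.d j) ≤ 54 ^ (k + 1) * M.d g :=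
      mul_le_mul_of_nonneg_left h2 (by positivity)
    calc (54 : ℚ) ^ (k + 1 + 1) * M.d j = 54 ^ (k + 1) * (54 * M.d j) := by ring
      _ ≤ _ := this.trans h1

/-- The postponed jobs of a band. -/
def postponed (b : ℤ) : Finset ι := M.J.filter fun x => M.B x = b ∧ M.C x < M.kap x

/-- A late job has `kap` at least 2αb/3, so postponement by the quadratic term forces N⁴ vol² to be
of order (αb)². A volume below two blocks is too small for that, since 96N⁶⁰ ≤ N⁶⁸. -/
theorem postponed_spec {b : ℤ} {j : ι} (hj : j ∈ M.postponed b) :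
    j ∈ M.band b ∧ 2 * M.blk b ≤ M.vol j ∧
      M.al * b * M.kap j ≤ M.N ^ 4 * M.vol j ^ 2 := by
  obtain ⟨h1, h2, h3⟩ := Finset.mem_filter.1 hj
  have hl : M.Late j := by
    by_contra hl
    rw [M.kap_eq h1 hl] at h3
    exact lt_irrefl _ h3
  have hb : 0 < b := h2 ▸ M.hB j h1
  have hab : 0 < M.al * b := mul_pos M.al_pos hb
  have h4 : M.al * b * M.kap j ≤ M.N ^ 4 * M.vol j ^ 2 := by
    have h5 : M.kap j = M.N ^ 4 * M.vol j ^ 2 / (M.al * M.B j) := by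
      rcases max_choice (M.C j) (M.N ^ 4 * M.vol j ^ 2 / (M.al * M.B j)) with h | h
      · rw [kap, h] at h3; exact absurd h3 (lt_irrefl _)
      · exact h
    rw [h5, h2]
    exact Int.mul_ediv_self_le hab.ne'
  refine ⟨M.mem_band.2 ⟨h1, h2, hl⟩, ?_, h4⟩
  by_contra hlt
  rw [not_le] at hlt
  have h6 : 2 * (M.al * b) ≤ 3 * M.kap j := by
    have := M.hT j h1
    unfold Late at hl
    rw [h2] at hl
    linarith
  have h7 : 2 * (M.al * b) ^ 2 ≤ 3 * (M.N ^ 4 * M.vol j ^ 2) := by nlinarith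
  have h8 : M.vol j ^ 2 < (2 * M.blk b) ^ 2 := pow_lt_pow_left₀ hlt (M.vol_nonneg j) two_ne_zero
  have h9 : 0 < M.N ^ 4 := pow_pos M.N_pos 4
  have h10 := M.pow_mul_le (a := 60) (b := 8) 96 (by norm_num)
  have h11 : M.N ^ 4 * (2 * M.blk b) ^ 2 = 64 * (b * M.y) ^ 2 * M.N ^ 60 := by unfold blk; ring
  have h12 : (M.al * b) ^ 2 = (b * M.y) ^ 2 * M.N ^ (60 + 8) := by unfold al; ring
  have h13 := mul_le_mul_of_nonneg_left h10 (sq_nonneg (b * M.y))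
  have h14 := mul_lt_mul_of_pos_left h8 h9
  linarith

/-- The volume passes the first block somewhere, and the job at which this happens is shorter than
half a block; the jobs before it make up the rest. -/
theorem half_blk_le {b : ℤ} {j : ι} (hj : j ∈ M.postponed b) :
    M.blk b ≤ 2 * ∑ x ∈ M.band b with M.vol x ≤ M.blk b, M.T x := by
  obtain ⟨h1, h2, -⟩ := M.postponed_spec hj
  obtain ⟨h3, h4, -⟩ := M.mem_band.1 h1
  have hu := M.blk_pos (h4 ▸ M.hB j h3)
  obtain ⟨g, hg, g1, g2⟩ := M.exists_first (a := M.blk b + 1) (by omega) h1 (by omega)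
  obtain ⟨g3, g4, g5⟩ := M.mem_band.1 hg
  have h5 : M.vol g - M.T g ≤ ∑ x ∈ M.band b with M.vol x ≤ M.blk b, M.T x := by
    rw [M.vol_sub_T hg]
    refine M.sum_T_mono (fun f hf => ?_)
      ((Finset.filter_subset _ _).trans (Finset.filter_subset _ _))
    obtain ⟨hf, hfC⟩ := Finset.mem_filter.1 hf
    obtain ⟨f1, f2, f3⟩ := M.mem_band.1 hf
    refine Finset.mem_filter.2 ⟨hf, ?_⟩
    have h6 : M.vol f ≤ M.vol g - M.T g := by
      rw [M.vol_sub_T hg, vol_eq_sum]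
      refine M.sum_T_mono (fun z hz => ?_)
        ((Finset.filter_subset _ _).trans (Finset.filter_subset _ _))
      obtain ⟨z1, ⟨z2, z3⟩, z4⟩ := Finset.mem_filter.1 hz
      exact Finset.mem_filter.2 ⟨M.mem_band.2 ⟨z1, z2.trans f2, z3⟩, z4.trans_lt hfC⟩
    omega
  have h6 := M.two_mul_T_le_blk g3
  rw [g4] at h6
  omega

theorem sum_T_le_vol {b v : ℤ} (hv : 0 ≤ v) {s : Finset ι} (hs : ∀ x ∈ s, x ∈ M.band b ∧ M.vol x ≤ v) :
    ∑ x ∈ s, M.T x ≤ v := by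
  rcases s.eq_empty_or_nonempty with rfl | hne
  · simpa using hv
  · obtain ⟨f, hf, hmax⟩ := s.exists_max_image M.C hne
    refine le_trans ?_ (hs f hf).2
    have hf' := M.mem_band.1 (hs f hf).1
    rw [vol_eq_sum]
    refine M.sum_T_mono (fun x hx => ?_) (Finset.filter_subset _ _)
    have h3 := M.mem_band.1 (hs x hx).1
    exact Finset.mem_filter.2 ⟨h3.1, ⟨h3.2.1.trans hf'.2.1.symm, h3.2.2⟩, hmax x hx⟩

/-- The postponed jobs are grouped by the block k+2 in which their volume lies. Such a group has
total length and volumes at most (k+3) blocks and density at most d_x/54^(k+1), so the sum is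
dominated by a geometric series. -/
theorem sum_postponed_le_of_mem {b : ℤ} (hb : 0 < b) {x : ι} (hx : x ∈ M.band b)
    (hxv : M.vol x ≤ M.blk b) :
    ∑ j ∈ M.postponed b, M.d j * M.T j * (M.vol j : ℚ) ^ 2 ≤ M.d x * (M.blk b : ℚ) ^ 3 := by
  have hu := M.blk_pos hb
  have hdx := M.hd x (M.mem_band.1 hx).1
  set κ : ι → ℕ := fun j => (M.vol j / M.blk b - 2).toNat with hκ
  obtain ⟨n, hn⟩ : ∃ n, ∀ j ∈ M.postponed b, κ j ∈ Finset.range n :=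
    ⟨(M.postponed b).sup κ + 1, fun j hj =>
      Finset.mem_range.2 (Nat.lt_succ_of_le (Finset.le_sup (f := κ) hj))⟩
  rw [← Finset.sum_fiberwise_of_maps_to hn]
  have hk : ∀ k ∈ Finset.range n, ∑ j ∈ M.postponed b with κ j = k,
      M.d j * M.T j * (M.vol j : ℚ) ^ 2 ≤ M.d x * (M.blk b : ℚ) ^ 3 * (1 / 2) ^ (k + 1) := by
    intro k _
    have hj : ∀ j ∈ (M.postponed b).filter fun j => κ j = k,
        j ∈ M.band b ∧ (k + 2) * M.blk b ≤ M.vol j ∧ M.vol j ≤ (k + 3) * M.blk b := by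
      intro j hj
      obtain ⟨hj, hjk⟩ := Finset.mem_filter.1 hj
      obtain ⟨h1, h2, -⟩ := M.postponed_spec hj
      have h3 : 2 ≤ M.vol j / M.blk b := (Int.le_ediv_iff_mul_le hu).2 h2
      have h4 : M.vol j / M.blk b = k + 2 := by simp only [hκ] at hjk; omega
      refine ⟨h1, ?_, ?_⟩
      · rw [← h4]; exact Int.ediv_mul_le _ hu.ne'
      · have := Int.lt_ediv_add_one_mul_self (M.vol j) hu
        rw [h4] at this
        linarith
    have hT := M.sum_T_le_vol (v := (k + 3) * M.blk b) (by positivity)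
      (fun j hj' => ⟨(hj j hj').1, (hj j hj').2.2⟩)
    have hTq : (∑ j ∈ M.postponed b with κ j = k, (M.T j : ℚ)) ≤ (k + 3) * M.blk b := by
      exact_mod_cast hT
    have huq : (0 : ℚ) < M.blk b := by exact_mod_cast hu
    have h54 : (0 : ℚ) < 54 ^ (k + 1) := by positivity
    calc ∑ j ∈ M.postponed b with κ j = k, M.d j * M.T j * (M.vol j : ℚ) ^ 2
        ≤ ∑ j ∈ M.postponed b with κ j = k,
          (M.d x / 54 ^ (k + 1) * ((k + 3) * M.blk b) ^ 2) * M.T j := by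
          refine Finset.sum_le_sum fun j hj' => ?_
          obtain ⟨h1, h2, h3⟩ := hj j hj'
          have h4 : M.d j ≤ M.d x / 54 ^ (k + 1) := by
            rw [le_div_iff₀ h54, mul_comm]
            exact M.density_le hb hx hxv k j h1 h2
          have h5 : (0 : ℚ) ≤ M.T j := by exact_mod_cast (M.hT j (M.mem_band.1 h1).1).le
          have h6 : (0 : ℚ) ≤ M.vol j := by exact_mod_cast M.vol_nonneg j
          have h7 : (M.vol j : ℚ) ≤ (k + 3) * M.blk b := by exact_mod_cast h3
          calc M.d j * M.T j * (M.vol j : ℚ) ^ 2 = M.d j * (M.vol j : ℚ) ^ 2 * M.T j := by ring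
            _ ≤ _ := by gcongr
      _ = (M.d x / 54 ^ (k + 1) * ((k + 3) * M.blk b) ^ 2) *
          ∑ j ∈ M.postponed b with κ j = k, (M.T j : ℚ) := by rw [Finset.mul_sum]
      _ ≤ (M.d x / 54 ^ (k + 1) * ((k + 3) * M.blk b) ^ 2) * ((k + 3) * M.blk b) := by gcongr
      _ = M.d x * (M.blk b : ℚ) ^ 3 * ((k + 3) ^ 3 / 54 ^ (k + 1)) := by field_simp
      _ ≤ _ := by
        refine mul_le_mul_of_nonneg_left ?_ (by positivity)
        -- With (k+3)³ ≤ 27^(k+1), the constant 54 = 2·27 leaves the ratio 1/2.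
        have h1 : ((k : ℚ) + 3) ≤ 3 ^ (k + 1) := by
          have : ∀ k : ℕ, k + 3 ≤ 3 ^ (k + 1) := by
            intro k
            induction k with
            | zero => norm_num
            | succ k ih => rw [pow_succ]; omega
          exact_mod_cast this k
        rw [div_le_iff₀ h54, ← mul_pow]
        calc ((k : ℚ) + 3) ^ 3 ≤ (3 ^ (k + 1)) ^ 3 := by gcongr
          _ = (1 / 2 * 54) ^ (k + 1) := by rw [← pow_mul, mul_comm, pow_mul]; norm_num
  refine (Finset.sum_le_sum hk).trans ?_
  rw [← Finset.mul_sum]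
  have hgeo : ∑ k ∈ Finset.range n, (1 / 2 : ℚ) ^ (k + 1) ≤ 1 := by
    have : ∀ n : ℕ, ∑ k ∈ Finset.range n, (1 / 2 : ℚ) ^ (k + 1) = 1 - (1 / 2) ^ n := by
      intro n
      induction n with
      | zero => simp
      | succ n ih => rw [Finset.sum_range_succ, ih]; ring
    rw [this]
    have : (0 : ℚ) < (1 / 2) ^ n := by positivity
    linarith
  have huq : (0 : ℚ) < M.blk b := by exact_mod_cast hu
  exact mul_le_of_le_one_right (by positivity) hgeo

/-- The postponed jobs of a band are cheap in comparison with all jobs of the band. -/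
theorem sum_postponed_le {b : ℤ} :
    (M.N : ℚ) ^ 2 * ∑ j ∈ M.postponed b, M.d j * M.T j * M.kap j ≤
      ∑ j ∈ M.J with M.B j = b, M.d j * M.T j * M.C j := by
  have hnn : ∀ j ∈ M.J, 0 ≤ M.d j * M.T j * M.C j := fun j hj => by
    have h1 := M.hd j hj
    have h2 : (0 : ℚ) ≤ M.T j := by exact_mod_cast (M.hT j hj).le
    have h3 : (0 : ℚ) ≤ M.C j := by exact_mod_cast (M.C_pos hj).le
    positivity
  rcases (M.postponed b).eq_empty_or_nonempty with he | ⟨j₀, hj₀⟩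
  · rw [he, Finset.sum_empty, mul_zero]
    exact Finset.sum_nonneg fun j hj => hnn j (Finset.mem_filter.1 hj).1
  have hb : 0 < b := by
    obtain ⟨h1, h2, -⟩ := Finset.mem_filter.1 hj₀
    exact h2 ▸ M.hB j₀ h1
  have hN : (0 : ℚ) < M.N := by exact_mod_cast M.N_pos
  have hu : (0 : ℚ) < M.blk b := by exact_mod_cast M.blk_pos hb
  have hab : (0 : ℚ) < M.al * b := by exact_mod_cast mul_pos M.al_pos hb
  set G := (M.band b).filter fun x => M.vol x ≤ M.blk b with hG
  set S := ∑ j ∈ M.postponed b, M.d j * M.T j * (M.vol j : ℚ) ^ 2 with hS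
  have hmem : ∀ x ∈ G, x ∈ M.J ∧ M.B x = b ∧ M.Late x := fun x hx =>
    M.mem_band.1 (Finset.mem_filter.1 hx).1
  have hS0 : 0 ≤ S := Finset.sum_nonneg fun j hj => by
    have hj' := (Finset.mem_filter.1 hj).1
    have h1 := M.hd j hj'
    have h2 : (0 : ℚ) ≤ M.T j := by exact_mod_cast (M.hT j hj').le
    positivity
  -- The estimate holds for every x in the first block; averaging it with weights T_x compares S
  -- with the total weight of that block, whose length is at least half a block.
  have h1 : S * ∑ x ∈ G, (M.T x : ℚ) ≤ (M.blk b : ℚ) ^ 3 * ∑ x ∈ G, M.d x * M.T x := by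
    rw [Finset.mul_sum, Finset.mul_sum]
    refine Finset.sum_le_sum fun x hx => ?_
    have h2 : (0 : ℚ) ≤ M.T x := by exact_mod_cast (M.hT x (hmem x hx).1).le
    have h3 := M.sum_postponed_le_of_mem hb (Finset.mem_filter.1 hx).1 (Finset.mem_filter.1 hx).2
    calc S * (M.T x : ℚ) ≤ M.d x * (M.blk b : ℚ) ^ 3 * M.T x := by gcongr
      _ = _ := by ring
  have h2 : (M.blk b : ℚ) ≤ 2 * ∑ x ∈ G, (M.T x : ℚ) := by exact_mod_cast M.half_blk_le hj₀
  have h3 : S ≤ 2 * (M.blk b : ℚ) ^ 2 * ∑ x ∈ G, M.d x * M.T x := by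
    have h4 : S * M.blk b ≤ (2 * (M.blk b : ℚ) ^ 2 * ∑ x ∈ G, M.d x * M.T x) * M.blk b := by
      calc S * M.blk b ≤ S * (2 * ∑ x ∈ G, (M.T x : ℚ)) := by gcongr
        _ = 2 * (S * ∑ x ∈ G, (M.T x : ℚ)) := by ring
        _ ≤ 2 * ((M.blk b : ℚ) ^ 3 * ∑ x ∈ G, M.d x * M.T x) := by gcongr
        _ = _ := by ring
    exact le_of_mul_le_mul_right h4 hu
  have h4 : 2 * (M.al * b) * ∑ x ∈ G, M.d x * M.T x ≤
      3 * ∑ j ∈ M.J with M.B j = b, M.d j * M.T j * M.C j := by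
    calc 2 * (M.al * b) * ∑ x ∈ G, M.d x * M.T x
        ≤ 3 * ∑ x ∈ G, M.d x * M.T x * M.C x := by
          rw [Finset.mul_sum, Finset.mul_sum]
          refine Finset.sum_le_sum fun x hx => ?_
          obtain ⟨x1, x2, x3⟩ := hmem x hx
          have h5 := M.hd x x1
          have h6 := M.hT x x1
          have h7 : 2 * (M.al * b) ≤ 3 * M.C x := by
            unfold Late at x3; rw [x2] at x3; linarith
          have h8 : 2 * ((M.al : ℚ) * b) ≤ 3 * M.C x := by exact_mod_cast h7
          have h9 : (0 : ℚ) ≤ M.T x := by exact_mod_cast h6.le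
          calc 2 * (M.al * b) * (M.d x * M.T x) ≤ 3 * M.C x * (M.d x * M.T x) := by gcongr
            _ = _ := by ring
      _ ≤ _ := by
          refine mul_le_mul_of_nonneg_left (Finset.sum_le_sum_of_subset_of_nonneg
            (fun x hx => Finset.mem_filter.2 ⟨(hmem x hx).1, (hmem x hx).2.1⟩)
            fun j hj _ => hnn j (Finset.mem_filter.1 hj).1) (by norm_num)
  have h5 : M.al * b * ∑ j ∈ M.postponed b, M.d j * M.T j * M.kap j ≤ (M.N : ℚ) ^ 4 * S := by
    rw [Finset.mul_sum, hS, Finset.mul_sum]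
    refine Finset.sum_le_sum fun j hj => ?_
    have hj' := (Finset.mem_filter.1 hj).1
    have h6 := M.hd j hj'
    have h7 : (0 : ℚ) ≤ M.T j := by exact_mod_cast (M.hT j hj').le
    have h8 : (M.al : ℚ) * b * M.kap j ≤ M.N ^ 4 * M.vol j ^ 2 := by
      exact_mod_cast (M.postponed_spec hj).2.2
    calc M.al * b * (M.d j * M.T j * M.kap j) = M.d j * M.T j * (M.al * b * M.kap j) := by ring
      _ ≤ M.d j * M.T j * (M.N ^ 4 * M.vol j ^ 2) := by gcongr
      _ = _ := by ring
  set W := ∑ j ∈ M.J with M.B j = b, M.d j * M.T j * M.C j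
  set E := ∑ j ∈ M.postponed b, M.d j * M.T j * M.kap j
  set F := ∑ x ∈ G, M.d x * M.T x
  have hW : 0 ≤ W := Finset.sum_nonneg fun j hj => hnn j (Finset.mem_filter.1 hj).1
  -- Here 48 = 3·4², from 3W and the square of the constant 4 in `blk`. The exponents are 62 = 6 +
  -- 2·28 and 68 = 2·34.
  have h48 : (48 : ℚ) * M.N ^ 62 ≤ M.N ^ 68 := by
    exact_mod_cast M.pow_mul_le (a := 62) (b := 6) 48 (by norm_num)
  have h6 : (M.al * b : ℚ) ^ 2 * (M.N ^ 2 * E) ≤ (M.al * b : ℚ) ^ 2 * W := by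
    calc (M.al * b : ℚ) ^ 2 * (M.N ^ 2 * E) = M.N ^ 2 * (M.al * b) * (M.al * b * E) := by ring
      _ ≤ M.N ^ 2 * (M.al * b) * (M.N ^ 4 * S) :=
        mul_le_mul_of_nonneg_left h5 (mul_nonneg (by positivity) hab.le)
      _ ≤ M.N ^ 2 * (M.al * b) * (M.N ^ 4 * (2 * (M.blk b : ℚ) ^ 2 * F)) :=
        mul_le_mul_of_nonneg_left (mul_le_mul_of_nonneg_left h3 (by positivity))
          (mul_nonneg (by positivity) hab.le)
      _ = M.N ^ 6 * (M.blk b : ℚ) ^ 2 * (2 * (M.al * b) * F) := by ring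
      _ ≤ M.N ^ 6 * (M.blk b : ℚ) ^ 2 * (3 * W) := by gcongr
      _ = ((b * M.y) ^ 2 * W) * (48 * M.N ^ 62) := by unfold blk; push_cast; ring
      _ ≤ ((b * M.y) ^ 2 * W) * M.N ^ 68 := by gcongr
      _ = _ := by unfold al; push_cast; ring
  exact le_of_mul_le_mul_left h6 (by positivity)

theorem sum_all_postponed_le :
    (M.N : ℚ) ^ 2 * ∑ j ∈ M.J with M.C j < M.kap j, M.d j * M.T j * M.kap j ≤
      ∑ j ∈ M.J, M.d j * M.T j * M.C j := by
  classical
  have hmap : ∀ j ∈ M.J, M.B j ∈ M.J.image M.B := fun j hj => Finset.mem_image_of_mem _ hj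
  rw [← Finset.sum_fiberwise_of_maps_to (s := M.J) hmap,
    ← Finset.sum_fiberwise_of_maps_to (s := M.J.filter fun j => M.C j < M.kap j)
      (fun j hj => hmap j (Finset.mem_filter.1 hj).1), Finset.mul_sum]
  refine Finset.sum_le_sum fun b _ => ?_
  refine le_trans (le_of_eq ?_) (M.sum_postponed_le (b := b))
  rw [postponed, Finset.filter_filter]
  simp only [and_comm]

end MachineData

/-! ### Rounded times -/

theorem one_lt_base {N : ℕ} (hN : 0 < N) : 1 < base N := by
  have : (0 : ℚ) < N := by exact_mod_cast hN
  unfold base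
  have : (0 : ℚ) < 1 / N := by positivity
  linarith

theorem base_pos {N : ℕ} (hN : 0 < N) : 0 < base N := one_pos.trans (one_lt_base hN)

theorem one_lt_base_real {N : ℕ} (hN : 0 < N) : (1 : ℝ) < ((base N : ℚ) : ℝ) := by
  exact_mod_cast one_lt_base hN

theorem zpow_le_iff_le_logb {N : ℕ} (hN : 0 < N) {t : ℚ} (ht : 0 < t) (e : ℤ) :
    base N ^ e ≤ t ↔ (e : ℝ) ≤ Real.logb ((base N : ℚ) : ℝ) (t : ℝ) := by
  have ht' : (0 : ℝ) < (t : ℝ) := by exact_mod_cast ht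
  rw [Real.le_logb_iff_rpow_le (one_lt_base_real hN) ht', Real.rpow_intCast]
  exact_mod_cast Iff.rfl

theorem le_zpow_iff_logb_le {N : ℕ} (hN : 0 < N) {t : ℚ} (ht : 0 < t) (e : ℤ) :
    t ≤ base N ^ e ↔ Real.logb ((base N : ℚ) : ℝ) (t : ℝ) ≤ (e : ℝ) := by
  have ht' : (0 : ℝ) < (t : ℝ) := by exact_mod_cast ht
  rw [Real.logb_le_iff_le_rpow (one_lt_base_real hN) ht', Real.rpow_intCast]
  exact_mod_cast Iff.rfl

theorem lt_roundUp {N : ℕ} (hN : 0 < N) {t : ℚ} (ht : 0 < t) : t < roundUp N t := by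
  by_contra h
  rw [not_lt, roundUp, zpow_le_iff_le_logb hN ht] at h
  have := Int.lt_floor_add_one (Real.logb ((base N : ℚ) : ℝ) (t : ℝ))
  push_cast at h
  linarith

theorem roundUp_le {N : ℕ} (hN : 0 < N) {t : ℚ} (ht : 0 < t) : roundUp N t ≤ base N * t := by
  have hb := base_pos hN
  have h := (zpow_le_iff_le_logb hN ht _).2 (Int.floor_le (Real.logb ((base N : ℚ) : ℝ) (t : ℝ)))
  rw [roundUp, zpow_add_one₀ hb.ne', mul_comm]
  gcongr

/-- A factor 1+δ in time moves the logarithm by 1, hence its floor by at most 1. Comparing rounded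
times in this way avoids a second factor 1+δ for the rounding. -/
theorem roundUp_le_base_mul {N : ℕ} (hN : 0 < N) {s t : ℚ} (hs : 0 < s) (ht : 0 < t)
    (h : s ≤ base N * t) : roundUp N s ≤ base N * roundUp N t := by
  have hb := base_pos hN
  have hb' := one_lt_base_real hN
  rw [roundUp, roundUp, mul_comm (base N), ← zpow_add_one₀ hb.ne']
  refine zpow_le_zpow_right₀ (one_lt_base hN).le ?_
  have hs' : (0 : ℝ) < (s : ℝ) := by exact_mod_cast hs
  have ht' : (0 : ℝ) < (t : ℝ) := by exact_mod_cast ht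
  have h1 : Real.logb ((base N : ℚ) : ℝ) (s : ℝ) ≤
      Real.logb ((base N : ℚ) : ℝ) (((base N : ℚ) : ℝ) * (t : ℝ)) :=
    Real.logb_le_logb_of_le hb' hs' (by exact_mod_cast h)
  rw [Real.logb_mul (by positivity) ht'.ne', Real.logb_self_eq_one hb'] at h1
  have h2 := Int.floor_le_floor h1
  rw [add_comm (1 : ℝ), Int.floor_add_one] at h2
  omega

/-! ### Feasibility and cost of the combined schedule. -/

namespace MachineData

variable {ι : Type} (M : MachineData ι)

/-- `F j` is the maximum of `0` and the values `chain i j`. -/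
structure IsFinish (F : ι → ℤ) : Prop where
  le : ∀ i ∈ M.J, ∀ j ∈ M.J, M.chain i j ≤ F j
  attained : ∀ j ∈ M.J, F j = 0 ∨ ∃ i ∈ M.J, F j = M.chain i j

variable {M} {F : ι → ℤ}

theorem IsFinish.start_le (hF : M.IsFinish F) {j : ι} (hj : j ∈ M.J) :
    min (M.C j - M.T j) (2 * M.B j) ≤ F j - M.T j := by
  have h := hF.le j hj j hj
  rw [chain, if_pos le_rfl, sum_T_eq_filter] at h
  have h1 := Finset.single_le_sum (f := M.T) (s := M.J.filter fun g => M.key j ≤ M.key g ∧ M.key g ≤ M.key j)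
    (fun g hg => (M.hT g (Finset.mem_filter.1 hg).1).le) (Finset.mem_filter.2 ⟨hj, le_rfl, le_rfl⟩)
  linarith

theorem rel_pos {j : ι} (hj : j ∈ M.J) : 0 < min (M.C j - M.T j) (2 * M.B j) :=
  lt_min (M.hs j hj) (by have := M.hB j hj; omega)

theorem IsFinish.pos (hF : M.IsFinish F) {j : ι} (hj : j ∈ M.J) : 0 < F j := by
  have := hF.start_le hj; have := M.hT j hj; have := M.rel_pos hj; omega

/-- A chain that attains the completion time of i can be prolonged by j, and the completion time of
j is at least the length of the prolonged chain. -/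
theorem IsFinish.disjoint_of_lt (hF : M.IsFinish F) {i j : ι} (hi : i ∈ M.J) (hj : j ∈ M.J)
    (h : M.key i < M.key j) : F i ≤ F j - M.T j := by
  classical
  have h0 : 0 ≤ F j - M.T j := (M.rel_pos hj).le.trans (hF.start_le hj)
  rcases hF.attained i hi with h1 | ⟨g, hg, h1⟩
  · omega
  by_cases hgi : M.key g ≤ M.key i
  · have h2 := hF.le g hg j hj
    rw [chain, if_pos (hgi.trans h.le), sum_T_eq_filter] at h2
    rw [chain, if_pos hgi, sum_T_eq_filter] at h1
    have h3 : M.T j + ∑ x ∈ M.J with M.key g ≤ M.key x ∧ M.key x ≤ M.key i, M.T x ≤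
        ∑ x ∈ M.J with M.key g ≤ M.key x ∧ M.key x ≤ M.key j, M.T x := by
      rw [← Finset.sum_insert (f := M.T) (a := j) (by simp [h])]
      refine M.sum_T_mono (fun x hx => ?_) (Finset.filter_subset _ _)
      rcases Finset.mem_insert.1 hx with rfl | hx
      · exact Finset.mem_filter.2 ⟨hj, hgi.trans h.le, le_rfl⟩
      · obtain ⟨x1, x2, x3⟩ := Finset.mem_filter.1 hx
        exact Finset.mem_filter.2 ⟨x1, x2, x3.trans h.le⟩
    omega
  · rw [chain, if_neg hgi] at h1
    omega

theorem IsFinish.disjoint (hF : M.IsFinish F) {i j : ι} (hi : i ∈ M.J) (hj : j ∈ M.J)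
    (h : i ≠ j) : F i ≤ F j - M.T j ∨ F j ≤ F i - M.T i := by
  rcases lt_trichotomy (M.key i) (M.key j) with h1 | h1 | h1
  · exact Or.inl (hF.disjoint_of_lt hi hj h1)
  · exact absurd (M.key_inj hi hj h1) h
  · exact Or.inr (hF.disjoint_of_lt hj hi h1)

/-- The completion time of a job in the combined schedule. -/
def completion (M : MachineData ι) (F : ι → ℤ) (j : ι) : ℚ :=
  (F j * M.D + 1) / (M.D * M.D)

theorem completion_eq (j : ι) : M.completion F j = F j / M.D + 1 / (M.D * M.D) := by
  have : (M.D : ℚ) ≠ 0 := by exact_mod_cast M.D_pos.ne'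
  unfold completion
  field_simp

theorem IsFinish.completion_le (hF : M.IsFinish F) {N : ℕ} (hN : M.N = N) {j : ι} (hj : j ∈ M.J) :
    M.completion F j ≤ base N * (M.kap j / M.D) := by
  have hD : (0 : ℚ) < M.D := by exact_mod_cast M.D_pos
  have hN36 : (36 : ℚ) ≤ M.N := by exact_mod_cast M.hN
  have hD3 : (M.N : ℚ) ^ 3 ≤ M.D := by exact_mod_cast M.hD
  have hNp : (0 : ℚ) < M.N := by linarith
  have hF0 : (1 : ℚ) ≤ F j := by exact_mod_cast hF.pos hj
  have h1 : M.N ^ 2 * F j ≤ (M.N ^ 2 + 4) * M.kap j := by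
    rcases hF.attained j hj with h | ⟨i, hi, h⟩
    · exact absurd h (hF.pos hj).ne'
    · rw [h]; exact M.chain_le hi hj
  have h2 : (M.N : ℚ) ^ 2 * F j ≤ (M.N ^ 2 + 4) * M.kap j := by exact_mod_cast h1
  have hk : (0 : ℚ) < M.kap j := by exact_mod_cast (M.C_pos hj).trans_le (M.C_le_kap j)
  -- The shift 1/D² is at most F/D · 1/N³, since F ≥ 1 and D ≥ N³.
  have h3 : M.completion F j ≤ F j / M.D * (1 + 1 / M.N ^ 3) := by
    have e : M.completion F j = F j / M.D + 1 / M.D * (1 / M.D) := by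
      rw [completion_eq, one_div_mul_one_div]
    rw [e, mul_add, mul_one]
    gcongr
  have h4 : (F j : ℚ) ≤ (1 + 4 / M.N ^ 2) * M.kap j := by
    have : (M.N : ℚ) ^ 2 * F j ≤ M.N ^ 2 * ((1 + 4 / M.N ^ 2) * M.kap j) := by
      refine h2.trans (le_of_eq ?_)
      field_simp
    exact le_of_mul_le_mul_left this (by positivity)
  have h5 : (1 + 4 / (M.N : ℚ) ^ 2) * (1 + 1 / M.N ^ 3) ≤ base N := by
    have e : base N = 1 + 1 / (M.N : ℚ) := by rw [base, hN]; simp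
    rw [e]
    have h6 : 4 / (M.N : ℚ) ^ 2 ≤ 1 / M.N * (1 / 9) := by
      rw [div_mul_div_comm, div_le_div_iff₀ (by positivity) (by positivity)]
      nlinarith
    have h7 : 1 / (M.N : ℚ) ^ 3 ≤ 1 / M.N * (1 / 9) := by
      rw [div_mul_div_comm, div_le_div_iff₀ (by positivity) (by positivity)]
      nlinarith [sq_nonneg ((M.N : ℚ)), mul_pos hNp hNp]
    have h8 : 1 / (M.N : ℚ) ≤ 1 := by rw [div_le_one hNp]; linarith
    have h9 : (0 : ℚ) < 1 / M.N := by positivity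
    have h10 : 0 ≤ 1 / (M.N : ℚ) ^ 3 := by positivity
    nlinarith
  calc M.completion F j ≤ F j / M.D * (1 + 1 / M.N ^ 3) := h3
    _ ≤ (1 + 4 / M.N ^ 2) * M.kap j / M.D * (1 + 1 / M.N ^ 3) := by gcongr
    _ = (1 + 4 / (M.N : ℚ) ^ 2) * (1 + 1 / M.N ^ 3) * (M.kap j / M.D) := by ring
    _ ≤ _ := by gcongr

theorem IsFinish.completion_pos (hF : M.IsFinish F) {j : ι} (hj : j ∈ M.J) :
    0 < M.completion F j := by
  have hD : (0 : ℚ) < M.D := by exact_mod_cast M.D_pos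
  have hF0 : (1 : ℚ) ≤ F j := by exact_mod_cast hF.pos hj
  unfold completion
  positivity

theorem IsFinish.cost_le (hF : M.IsFinish F) {N : ℕ} (hN : M.N = N) :
    ∑ j ∈ M.J, M.d j * M.T j * roundUp N (M.completion F j) ≤
      (1 + 1 / (N : ℚ)) ^ 2 * ∑ j ∈ M.J, M.d j * M.T j * roundUp N (M.C j / M.D) := by
  have hD : (0 : ℚ) < M.D := by exact_mod_cast M.D_pos
  have hN0 : 0 < N := by have := M.N_pos; omega
  have hNq : (M.N : ℚ) = N := by exact_mod_cast hN
  have hN36 : (36 : ℚ) ≤ N := by rw [← hNq]; exact_mod_cast M.hN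
  have hb := base_pos hN0
  have hw : ∀ j ∈ M.J, 0 ≤ M.d j * M.T j := fun j hj => by
    have h1 := M.hd j hj
    have h2 : (0 : ℚ) ≤ M.T j := by exact_mod_cast (M.hT j hj).le
    positivity
  have hC : ∀ j ∈ M.J, (0 : ℚ) < M.C j / M.D := fun j hj => by
    have : (0 : ℚ) < M.C j := by exact_mod_cast M.C_pos hj
    positivity
  set W := ∑ j ∈ M.J, M.d j * M.T j * roundUp N (M.C j / M.D) with hW
  have hterm : ∀ j ∈ M.J, 0 ≤ M.d j * M.T j * roundUp N (M.C j / M.D) := fun j hj =>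
    mul_nonneg (hw j hj) ((hC j hj).trans (lt_roundUp hN0 (hC j hj))).le
  have h1 : ∑ j ∈ M.J with ¬ M.C j < M.kap j, M.d j * M.T j * roundUp N (M.completion F j) ≤
      base N * W := by
    rw [hW, Finset.mul_sum]
    refine (Finset.sum_le_sum fun j hj => ?_).trans
      (Finset.sum_le_sum_of_subset_of_nonneg (Finset.filter_subset _ _)
        fun j hj _ => mul_nonneg hb.le (hterm j hj))
    obtain ⟨hj, hk⟩ := Finset.mem_filter.1 hj
    have h2 : M.kap j = M.C j := le_antisymm (not_lt.1 hk) (M.C_le_kap j)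
    have h3 := hF.completion_le hN hj
    rw [h2] at h3
    have h4 := roundUp_le_base_mul hN0 (hF.completion_pos hj) (hC j hj) h3
    calc _ ≤ M.d j * M.T j * (base N * roundUp N (M.C j / M.D)) :=
          mul_le_mul_of_nonneg_left h4 (hw j hj)
      _ = _ := by ring
  have h2 : ∑ j ∈ M.J with M.C j < M.kap j, M.d j * M.T j * roundUp N (M.completion F j) ≤
      base N ^ 2 * (W / (N : ℚ) ^ 2) := by
    have h3 : ∑ j ∈ M.J with M.C j < M.kap j, M.d j * M.T j * roundUp N (M.completion F j) ≤
        base N ^ 2 / M.D * ∑ j ∈ M.J with M.C j < M.kap j, M.d j * M.T j * M.kap j := by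
      rw [Finset.mul_sum]
      refine Finset.sum_le_sum fun j hj => ?_
      obtain ⟨hj, -⟩ := Finset.mem_filter.1 hj
      have h4 := (roundUp_le hN0 (hF.completion_pos hj)).trans
        (mul_le_mul_of_nonneg_left (hF.completion_le hN hj) hb.le)
      calc _ ≤ M.d j * M.T j * (base N * (base N * (M.kap j / M.D))) :=
            mul_le_mul_of_nonneg_left h4 (hw j hj)
        _ = _ := by ring
    have h4 := M.sum_all_postponed_le
    rw [hNq] at h4
    have h5 : ∑ j ∈ M.J, M.d j * M.T j * M.C j ≤ M.D * W := by
      rw [hW, Finset.mul_sum]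
      refine Finset.sum_le_sum fun j hj => ?_
      have h6 := (lt_roundUp hN0 (hC j hj)).le
      calc M.d j * M.T j * M.C j = M.D * (M.d j * M.T j * (M.C j / M.D)) := by field_simp
        _ ≤ _ := by
          have := hw j hj
          gcongr
    have h6 : ∑ j ∈ M.J with M.C j < M.kap j, M.d j * M.T j * (M.kap j : ℚ) ≤
        M.D * W / (N : ℚ) ^ 2 := by
      rw [le_div_iff₀ (by positivity), mul_comm]
      exact h4.trans h5
    calc _ ≤ base N ^ 2 / M.D * ∑ j ∈ M.J with M.C j < M.kap j, M.d j * M.T j * (M.kap j : ℚ) := h3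
      _ ≤ base N ^ 2 / M.D * (M.D * W / (N : ℚ) ^ 2) := by gcongr
      _ = _ := by field_simp
  rw [← Finset.sum_filter_add_sum_filter_not M.J (fun j => M.C j < M.kap j)]
  have hW0 : 0 ≤ W := Finset.sum_nonneg hterm
  -- The term (1+δ)δW in the budget (1+δ)²W = (1+δ)W + (1+δ)δW pays for the postponed jobs.
  have h3 : base N + base N ^ 2 / (N : ℚ) ^ 2 ≤ base N ^ 2 := by
    have h4 : base N / (N : ℚ) ^ 2 ≤ 1 / N := by
      rw [div_le_div_iff₀ (by positivity) (by positivity)]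
      have : base N ≤ N := by
        unfold base
        have : 1 / (N : ℚ) ≤ 1 := by rw [div_le_one (by linarith)]; linarith
        linarith
      nlinarith
    calc base N + base N ^ 2 / (N : ℚ) ^ 2 = base N * (1 + base N / N ^ 2) := by ring
      _ ≤ base N * (1 + 1 / N) := by gcongr
      _ = _ := by rw [sq]; rfl
  calc _ ≤ base N ^ 2 * (W / (N : ℚ) ^ 2) + base N * W := add_le_add h2 h1
    _ = (base N + base N ^ 2 / (N : ℚ) ^ 2) * W := by ring
    _ ≤ base N ^ 2 * W := by gcongr
    _ = _ := rfl

end MachineData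

/-! ### The bands -/

theorem alpha_ge {N y : ℕ} (hN : 36 ≤ N) (hy : 1 ≤ y) : 36 ≤ alpha N y := by
  have h : N ^ 1 ≤ N ^ 34 := Nat.pow_le_pow_right (by omega) (by norm_num)
  unfold alpha
  nlinarith

theorem shifts_ge {N y : ℕ} (hN : 36 ≤ N) (hy : 1 ≤ y) : 36 ≤ shifts N y := by
  have := alpha_ge hN hy
  unfold shifts
  nlinarith

theorem base_le {N : ℕ} (hN : 36 ≤ N) : base N ≤ 37 / 36 := by
  have h : (36 : ℚ) ≤ N := by exact_mod_cast hN
  have : 1 / (N : ℚ) ≤ 1 / 36 := one_div_le_one_div_of_le (by norm_num) h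
  unfold base
  linarith

/-- The exponent `⌈log_{1+δ} α ^ e⌉`. -/
noncomputable def ceilLog (N y e : ℕ) : ℤ := ⌈Real.logb ((base N : ℚ) : ℝ) ((alpha N y : ℝ) ^ e)⌉

theorem ceilLog_zero (N y : ℕ) : ceilLog N y 0 = 0 := by simp [ceilLog]

section CeilLog

variable {N y : ℕ} (hN : 36 ≤ N) (hy : 1 ≤ y)
include hN hy

theorem ceilLog_le_iff (e : ℕ) (z : ℤ) : ceilLog N y e ≤ z ↔ (alpha N y : ℚ) ^ e ≤ base N ^ z := by
  have h : (0 : ℚ) < (alpha N y : ℚ) ^ e := by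
    have := alpha_ge hN hy
    have : (0 : ℚ) < alpha N y := by exact_mod_cast (by omega : 0 < alpha N y)
    positivity
  rw [le_zpow_iff_logb_le (by omega) h, ceilLog, Int.ceil_le]
  push_cast
  rfl

theorem pow_le_zpow_ceilLog (e : ℕ) : (alpha N y : ℚ) ^ e ≤ base N ^ ceilLog N y e :=
  (ceilLog_le_iff hN hy e _).1 le_rfl

theorem zpow_ceilLog_le (e : ℕ) : base N ^ ceilLog N y e ≤ base N * (alpha N y : ℚ) ^ e := by
  have hb := base_pos (N := N) (by omega)
  have h : ¬ ceilLog N y e ≤ ceilLog N y e - 1 := by omega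
  rw [ceilLog_le_iff hN hy, not_le, zpow_sub_one₀ hb.ne', ← div_eq_mul_inv, div_lt_iff₀ hb] at h
  linarith

theorem ceilLog_strictMono : StrictMono (ceilLog N y) := by
  refine strictMono_nat_of_lt_succ fun e => ?_
  have hb := base_pos (N := N) (by omega)
  by_contra h
  rw [not_lt, ceilLog_le_iff hN hy, pow_succ] at h
  have h1 := zpow_ceilLog_le hN hy e
  have h2 : (36 : ℚ) ≤ alpha N y := by exact_mod_cast alpha_ge hN hy
  have h3 : (0 : ℚ) < (alpha N y : ℚ) ^ e := by positivity
  have h4 := base_le hN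
  nlinarith

theorem natCast_le_ceilLog (e : ℕ) : (e : ℤ) ≤ ceilLog N y e := by
  induction e with
  | zero => rw [ceilLog_zero]; simp
  | succ e ih =>
    have := ceilLog_strictMono hN hy (Nat.lt_succ_self e)
    push_cast
    simp only [Nat.succ_eq_add_one] at this
    omega

end CeilLog

section Bands

variable {n m : ℕ} (I : Instance n m) {N y k : ℕ}

theorem Psi_natCast (i k : ℕ) :
    Psi I N y (i : ℤ) k = base N ^ (I.theta + ceilLog N y (k + i * shifts N y)) := by
  rw [Psi, Q, if_neg (by omega), Int.toNat_natCast, ceilLog]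

theorem Psi_zero_sub_one (k : ℕ) : Psi I N y (((0 : ℕ) : ℤ) - 1) k = base N ^ I.theta := by
  rw [Psi, Q, if_pos (by norm_num)]

theorem Psi_succ_sub_one (i k : ℕ) : Psi I N y (((i + 1 : ℕ) : ℤ) - 1) k = Psi I N y (i : ℤ) k := by
  push_cast; rw [add_sub_cancel_right]

theorem theta_le (j : Fin n) : I.theta ≤ I.releaseExp j :=
  ciInf_le (Set.finite_range _).bddBelow j

variable (hN : 36 ≤ N) (hy : 1 ≤ y)
include hN hy

theorem Psi_le_Psi {i i' a a' : ℕ} (h : a + i * shifts N y ≤ a' + i' * shifts N y) :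
    Psi I N y (i : ℤ) a ≤ Psi I N y (i' : ℤ) a' := by
  rw [Psi_natCast, Psi_natCast]
  exact zpow_le_zpow_right₀ (one_lt_base (by omega)).le
    (by have := (ceilLog_strictMono hN hy).monotone h; omega)

theorem Psi_lt_Psi {i i' a a' : ℕ} (h : a + i * shifts N y < a' + i' * shifts N y) :
    Psi I N y (i : ℤ) a < Psi I N y (i' : ℤ) a' := by
  rw [Psi_natCast, Psi_natCast]
  exact zpow_lt_zpow_right₀ (one_lt_base (by omega))
    (by have := ceilLog_strictMono hN hy h; omega)

/-- A point lies in at most one band. -/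
theorem band_unique {x : ℚ} {i i' : ℕ} (h : Psi I N y ((i : ℤ) - 1) (k + 1) ≤ x)
    (hi : x < Psi I N y (i : ℤ) k) (h' : Psi I N y ((i' : ℤ) - 1) (k + 1) ≤ x)
    (hi' : x < Psi I N y (i' : ℤ) k) : i = i' := by
  have key : ∀ a b : ℕ, a < b → x < Psi I N y (a : ℤ) k →
      Psi I N y ((b : ℤ) - 1) (k + 1) ≤ x → False := by
    intro a b hab h1 h2
    obtain ⟨c, rfl⟩ : ∃ c, b = c + 1 := ⟨b - 1, by omega⟩
    rw [Psi_succ_sub_one] at h2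
    have h3 : a * shifts N y ≤ c * shifts N y := Nat.mul_le_mul_right _ (by omega)
    have := Psi_le_Psi I hN hy (i := a) (i' := c) (a := k) (a' := k + 1) (by omega)
    linarith
  rcases lt_trichotomy i i' with h1 | h1 | h1
  · exact (key i i' h1 hi h').elim
  · exact h1
  · exact (key i' i h1 hi' h).elim

theorem exists_release_lt (j : Fin n) :
    ∃ i : ℕ, I.releaseExp j - I.theta < ceilLog N y (k + i * shifts N y) := by
  have h0 := theta_le I j
  refine ⟨(I.releaseExp j - I.theta).toNat + 1, ?_⟩
  have h1 := natCast_le_ceilLog hN hy (k + ((I.releaseExp j - I.theta).toNat + 1) * shifts N y)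
  have h2 := shifts_ge hN hy
  have h3 : ((I.releaseExp j - I.theta).toNat + 1) * 1 ≤
    ((I.releaseExp j - I.theta).toNat + 1) * shifts N y := Nat.mul_le_mul_left _ (by omega)
  omega

/-- The raised release date of a job lies in the band of the first threshold that exceeds the
release date. -/
theorem releaseK_mem (j : Fin n) {i : ℕ} (h : I.release N j < Psi I N y (i : ℤ) k)
    (hmin : ∀ i' < i, Psi I N y (i' : ℤ) k ≤ I.release N j) :
    Psi I N y ((i : ℤ) - 1) (k + 1) ≤ releaseK I N y k j ∧
      releaseK I N y k j < Psi I N y (i : ℤ) k := by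
  have hs := shifts_ge hN hy
  have hlt : ∀ i' : ℕ, Psi I N y (i' : ℤ) k ≤ I.release N j → i' < i := by
    intro i' h'
    by_contra hle
    have h3 : i * shifts N y ≤ i' * shifts N y := Nat.mul_le_mul_right _ (by omega)
    have := Psi_le_Psi I hN hy (i := i) (i' := i') (a := k) (a' := k) (by omega)
    linarith
  -- A date that is raised lies in [Ψ_{i',k}, Ψ_{i',k+1}), which is below Ψ_{i'+1,k}; so i'+1 is the
  -- first threshold that exceeds it.
  have hraise : ∀ i' : ℕ, Psi I N y (i' : ℤ) k ≤ I.release N j →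
      I.release N j < Psi I N y (i' : ℤ) (k + 1) → i' + 1 = i := by
    intro i' h1 h2
    by_contra hne
    have h3 := hlt i' h1
    have h4 := hmin (i' + 1) (by omega)
    have h5 := Psi_le_Psi I hN hy (i := i') (i' := i' + 1) (a := k + 1) (a' := k)
      (by rw [add_mul]; omega)
    linarith
  rcases i with _ | i
  · have hno : ¬ ∃ i : ℕ, Psi I N y i k ≤ I.release N j ∧ I.release N j < Psi I N y i (k + 1) := by
      rintro ⟨i', h', -⟩
      exact absurd (hlt i' h') (by omega)
    rw [releaseK, dif_neg hno, Psi_zero_sub_one]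
    exact ⟨zpow_le_zpow_right₀ (one_lt_base (by omega)).le (theta_le I j), h⟩
  · rw [Psi_succ_sub_one]
    have h5 := Psi_lt_Psi I hN hy (i := i) (i' := i + 1) (a := k + 1) (a' := k)
      (by rw [add_mul]; omega)
    by_cases hex : ∃ i : ℕ, Psi I N y i k ≤ I.release N j ∧ I.release N j < Psi I N y i (k + 1)
    · have he : hex.choose = i := by
        have := hraise _ hex.choose_spec.1 hex.choose_spec.2
        omega
      rw [releaseK, dif_pos hex, he]
      exact ⟨le_rfl, h5⟩
    · rw [releaseK, dif_neg hex]
      refine ⟨?_, h⟩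
      by_contra hlt'
      exact hex ⟨i, hmin i (by omega), not_le.1 hlt'⟩

/-- The index of the band of a job. -/
theorem exists_bandIdx (k : ℕ) : ∃ b : Fin n → ℕ, ∀ j,
    (I.release N j < base N ^ I.theta * (alpha N y : ℚ) ^ (k + b j * shifts N y) ∧
      ∀ i' < b j, base N ^ I.theta * (alpha N y : ℚ) ^ (k + i' * shifts N y) ≤ I.release N j) ∧
    ∀ i, j ∈ band I N y k i ↔ i = b j := by
  classical
  have hb := base_pos (N := N) (by omega)
  -- The ceiling in the exponent of Ψ has no influence on comparisons with integer powers of 1+δ, so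
  -- the unrounded threshold selects the same band.
  have hiff : ∀ (j : Fin n) (i : ℕ), base N ^ I.theta * (alpha N y : ℚ) ^ (k + i * shifts N y) ≤
      I.release N j ↔ ceilLog N y (k + i * shifts N y) ≤ I.releaseExp j - I.theta := by
    intro j i
    have e : I.release N j = base N ^ I.theta * base N ^ (I.releaseExp j - I.theta) := by
      rw [← zpow_add₀ hb.ne', Instance.release]; congr 1; ring
    rw [ceilLog_le_iff hN hy, e]
    exact mul_le_mul_iff_right₀ (zpow_pos hb _)
  have hPsi : ∀ (j : Fin n) (i : ℕ), Psi I N y (i : ℤ) k ≤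
      I.release N j ↔ ceilLog N y (k + i * shifts N y) ≤ I.releaseExp j - I.theta := by
    intro j i
    rw [Psi_natCast, Instance.release, zpow_le_zpow_iff_right₀ (one_lt_base (by omega))]
    omega
  refine ⟨fun j => Nat.find (exists_release_lt I hN hy (k := k) j), fun j => ?_⟩
  have h1 := Nat.find_spec (exists_release_lt I hN hy (k := k) j)
  have h2 := fun i' (h : i' < Nat.find (exists_release_lt I hN hy (k := k) j)) =>
    not_lt.1 (Nat.find_min (exists_release_lt I hN hy (k := k) j) h)
  refine ⟨⟨?_, fun i' h => (hiff j i').2 (h2 i' h)⟩, fun i => ?_⟩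
  · rw [← not_le, hiff, not_le]; exact h1
  · have h3 := releaseK_mem I hN hy j (i := Nat.find (exists_release_lt I hN hy (k := k) j))
      (by rw [← not_le, hPsi, not_le]; exact h1) (fun i' h => (hPsi j i').2 (h2 i' h))
    simp only [band, Finset.mem_filter, Finset.mem_univ, true_and]
    constructor
    · rintro ⟨h4, h5⟩
      exact band_unique I hN hy h4 h5 h3.1 h3.2
    · rintro rfl
      exact h3

end Bands

/-! ### Lists of integers -/

theorem indexed_map_finRange {α : Type} {n : ℕ} (g : Fin n → α) :
    indexed ((List.finRange n).map g) = (List.finRange n).map fun j : Fin n => (((j : ℕ) : ℤ), g j) := by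
  apply List.ext_getElem
  · simp [indexed]
  · intro i h1 h2
    simp [indexed]

theorem sum_map_finRange_filter {n : ℕ} (p : Fin n → Prop) [DecidablePred p] (f : Fin n → ℤ) :
    (((List.finRange n).filter fun j => decide (p j)).map f).sum = ∑ j with p j, f j := by
  rw [Finset.sum_filter, Fin.sum_univ_def]
  induction List.finRange n with
  | nil => rfl
  | cons a l ih => by_cases h : p a <;> simp [h, ih]

theorem two_pow_length_le_prod (l : List ℤ) (h : ∀ a ∈ l, 2 ≤ a) : 2 ^ l.length ≤ l.prod := by
  induction l with
  | nil => simp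
  | cons a l ih =>
    have h1 := ih fun b hb => h b (List.mem_cons_of_mem _ hb)
    have h2 := h a (List.mem_cons_self ..)
    have h3 : (0 : ℤ) < 2 ^ l.length := by positivity
    rw [List.prod_cons, List.length_cons, pow_succ]
    nlinarith

theorem foldl_min_le_start (l : List ℤ) (z : ℤ) : l.foldl min z ≤ z := by
  induction l generalizing z with
  | nil => exact le_rfl
  | cons a l ih => exact (ih (min z a)).trans (min_le_left _ _)

theorem foldl_min_le_of_mem {l : List ℤ} {a : ℤ} (h : a ∈ l) (z : ℤ) : l.foldl min z ≤ a := by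
  induction l generalizing z with
  | nil => simp at h
  | cons b l ih =>
    rcases List.mem_cons.1 h with rfl | h
    · exact (foldl_min_le_start l _).trans (min_le_right _ _)
    · exact ih h _

theorem le_foldl_min {l : List ℤ} {c z : ℤ} (hz : c ≤ z) (h : ∀ a ∈ l, c ≤ a) :
    c ≤ l.foldl min z := by
  induction l generalizing z with
  | nil => exact hz
  | cons a l ih =>
    exact ih (le_min hz (h a (List.mem_cons_self ..))) fun b hb => h b (List.mem_cons_of_mem _ hb)

theorem le_foldl_max_start (l : List ℤ) (z : ℤ) : z ≤ l.foldl max z := by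
  induction l generalizing z with
  | nil => exact le_rfl
  | cons a l ih => exact (le_max_left _ _).trans (ih (max z a))

theorem le_foldl_max_of_mem {l : List ℤ} {a : ℤ} (h : a ∈ l) (z : ℤ) : a ≤ l.foldl max z := by
  induction l generalizing z with
  | nil => simp at h
  | cons b l ih =>
    rcases List.mem_cons.1 h with rfl | h
    · exact (le_max_right _ _).trans (le_foldl_max_start l _)
    · exact ih h _

theorem foldl_max_mem (l : List ℤ) (z : ℤ) : l.foldl max z = z ∨ l.foldl max z ∈ l := by
  induction l generalizing z with
  | nil => exact Or.inl rfl
  | cons a l ih =>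
    rw [List.foldl_cons]
    rcases ih (max z a) with h | h
    · rcases max_choice z a with h' | h' <;> rw [h'] at h
      · left; rw [h', h]
      · right; rw [h', h]; exact List.mem_cons_self ..
    · exact Or.inr (List.mem_cons_of_mem _ h)

theorem le_list_sum_of_mem {l : List ℤ} (h : ∀ a ∈ l, 0 ≤ a) {a : ℤ} (ha : a ∈ l) : a ≤ l.sum :=
  List.single_le_sum h a ha

/-! ### The data of an instance -/

section Bridge

variable {n m : ℕ} (I : Instance n m) (N y k : ℕ) (S : Schedule n m) (l : Fin m)

def ratC (q : ℚ) : RatC := (q.num, (q.den : ℤ))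

def jobC (j : Fin n) : JobC :=
  (ratC (I.size N j), ratC (I.weight N j), ratC (I.release N j), ((S.machine j : ℕ) : ℤ),
    ratC (S.completion j), ())

def inpC : InpC :=
  ((N : ℤ), (y : ℤ), (k : ℤ), ((l : ℕ) : ℤ), (List.finRange m).map (fun a => ratC (I.speed N a)),
    (List.finRange n).map (jobC I N S), ())

theorem enc_inpC : enc (inpC I N y k S l) = encInput I N y k S l := by
  simp only [inpC, enc, encInput, List.map_map]
  rfl

def ctxC : CtxC := (powers N y k, inpC I N y k S l)

def rowC (j : Fin n) : RowC := CtxC.row (ctxC I N y k S l, ((j : ℕ) : ℤ), jobC I N S j)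

theorem rows_ctxC : (ctxC I N y k S l).rows =
    ((List.finRange n).filter fun j => decide (S.machine j = l)).map (rowC I N y k S l) := by
  have h : ∀ L : List (Fin n), (L.map fun j : Fin n => (((j : ℕ) : ℤ), jobC I N S j)).filter
      (fun a => decide (a.2.2.2.2.1 = (ctxC I N y k S l).mach)) =
      (L.filter fun j => decide (S.machine j = l)).map fun j : Fin n => (((j : ℕ) : ℤ), jobC I N S j) := by
    intro L
    rw [List.filter_map]
    congr 1
    refine List.filter_congr fun j _ => ?_
    simp only [Function.comp, decide_eq_decide]
    change ((S.machine j : ℕ) : ℤ) = ((l : ℕ) : ℤ) ↔ _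
    rw [Nat.cast_inj, Fin.val_inj]
  have e : (ctxC I N y k S l).jobs = (List.finRange n).map (jobC I N S) := rfl
  rw [CtxC.rows, e, indexed_map_finRange, h, List.map_map]
  rfl

/-- The program looks up an entry of the list by a sum in which only the term with the right index
is nonzero. -/
theorem sum_indexed_speeds (g : RatC → ℤ) :
    ((indexed (ctxC I N y k S l).speeds).map fun a =>
      if a.1 = (ctxC I N y k S l).mach then g a.2 else 0).sum = g (ratC (I.speed N l)) := by
  have e : (ctxC I N y k S l).speeds = (List.finRange m).map fun a => ratC (I.speed N a) := rfl
  have e' : (ctxC I N y k S l).mach = ((l : ℕ) : ℤ) := rfl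
  rw [e, e', indexed_map_finRange, List.map_map, ← Fin.sum_univ_def]
  simp only [Function.comp, Nat.cast_inj, Fin.val_inj, Finset.sum_ite_eq', Finset.mem_univ, if_true]

theorem speedNum_ctxC : (ctxC I N y k S l).speedNum = (I.speed N l).num :=
  sum_indexed_speeds I N y k S l Prod.fst

theorem speedDen_ctxC : (ctxC I N y k S l).speedDen = ((I.speed N l).den : ℤ) :=
  sum_indexed_speeds I N y k S l Prod.snd

variable {N}

theorem size_pos (hN : 36 ≤ N) (j : Fin n) : 0 < I.size N j := zpow_pos (base_pos (by omega)) _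
theorem weight_pos (hN : 36 ≤ N) (j : Fin n) : 0 < I.weight N j := zpow_pos (base_pos (by omega)) _
theorem release_pos (hN : 36 ≤ N) (j : Fin n) : 0 < I.release N j := zpow_pos (base_pos (by omega)) _
theorem speed_pos (hN : 36 ≤ N) (a : Fin m) : 0 < I.speed N a := zpow_pos (base_pos (by omega)) _

def denomFactor (N : ℕ) (j : Fin n) : ℤ :=
  2 * (I.size N j).den * (I.release N j).den * (S.completion j).den

theorem scale_ctxC : (ctxC I N y k S l).scale =
    (N : ℤ) ^ 3 * (I.speed N l).num * ((List.finRange n).map (denomFactor I S N)).prod := by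
  have e : (ctxC I N y k S l).jobs = (List.finRange n).map (jobC I N S) := rfl
  have e' : (ctxC I N y k S l).parN = (N : ℤ) := rfl
  rw [CtxC.scale, e, e', speedNum_ctxC, List.map_map]
  rfl

theorem two_pow_le_prod_denom : (2 : ℤ) ^ n ≤ ((List.finRange n).map (denomFactor I S N)).prod := by
  have h := two_pow_length_le_prod ((List.finRange n).map (denomFactor I S N)) (fun a ha => by
    obtain ⟨j, -, rfl⟩ := List.mem_map.1 ha
    have h1 := (I.size N j).den_pos
    have h2 := (I.release N j).den_pos
    have h3 := (S.completion j).den_pos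
    have h4 : 0 < (I.size N j).den * (I.release N j).den * (S.completion j).den := by positivity
    unfold denomFactor
    have h5 : (1 : ℤ) ≤ (I.size N j).den * (I.release N j).den * (S.completion j).den := by
      exact_mod_cast h4
    linarith)
  simpa using h

theorem speed_num_pos (hN : 36 ≤ N) : 0 < (I.speed N l).num := Rat.num_pos.2 (speed_pos I hN l)

theorem pow_le_scale (hN : 36 ≤ N) : (N : ℤ) ^ 3 ≤ (ctxC I N y k S l).scale := by
  have h1 := speed_num_pos I l hN
  have h2 := two_pow_le_prod_denom I S (N := N)
  have h3 : (0 : ℤ) < 2 ^ n := by positivity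
  have h4 : (0 : ℤ) < (N : ℤ) ^ 3 := by positivity
  rw [scale_ctxC, mul_assoc]
  refine le_mul_of_one_le_right h4.le ?_
  nlinarith

theorem natCast_lt_scale (hN : 36 ≤ N) (j : Fin n) : ((j : ℕ) : ℤ) < (ctxC I N y k S l).scale := by
  have h1 := speed_num_pos I l hN
  have h2 := two_pow_le_prod_denom I S (N := N)
  have h3 : ((j : ℕ) : ℤ) < 2 ^ n := by
    exact_mod_cast j.2.trans n.lt_two_pow_self
  have h4 : (0 : ℤ) < (N : ℤ) ^ 3 * (I.speed N l).num := by positivity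
  rw [scale_ctxC]
  have h5 : (0 : ℤ) < ((List.finRange n).map (denomFactor I S N)).prod :=
    lt_of_lt_of_le (by positivity) h2
  exact h3.trans_le (h2.trans (le_mul_of_one_le_left h5.le (by omega)))

theorem scale_pos (hN : 36 ≤ N) : 0 < (ctxC I N y k S l).scale :=
  lt_of_lt_of_le (by positivity) (pow_le_scale I y k S l hN)

theorem denomFactor_dvd (j : Fin n) : (I.speed N l).num * denomFactor I S N j ∣
    (ctxC I N y k S l).scale := by
  rw [scale_ctxC, mul_assoc]
  refine (mul_dvd_mul_left _ (List.dvd_prod ?_)).mul_left _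
  exact List.mem_map.2 ⟨j, List.mem_finRange j, rfl⟩

theorem cast_num_mul_div (q : ℚ) {D : ℤ} (h : (q.den : ℤ) ∣ D) :
    ((q.num * (D / q.den) : ℤ) : ℚ) = q * D := by
  have hq : (q.den : ℚ) ≠ 0 := by exact_mod_cast q.den_nz
  obtain ⟨c, rfl⟩ := h
  have hq' : (q.den : ℤ) ≠ 0 := by exact_mod_cast q.den_nz
  rw [Int.mul_ediv_cancel_left _ hq']
  push_cast
  rw [← mul_assoc, Rat.mul_den_eq_num]

theorem row_time (hN : 36 ≤ N) (j : Fin n) : ((rowC I N y k S l j).2.1 : ℚ) =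
    I.size N j / I.speed N l * (ctxC I N y k S l).scale := by
  have e : (rowC I N y k S l j).2.1 = (I.size N j).num * (ctxC I N y k S l).speedDen *
    ((ctxC I N y k S l).scale / ((I.size N j).den * (ctxC I N y k S l).speedNum)) := rfl
  rw [e, speedNum_ctxC, speedDen_ctxC]
  obtain ⟨c, hc⟩ : ((I.size N j).den : ℤ) * (I.speed N l).num ∣ (ctxC I N y k S l).scale := by
    refine Dvd.dvd.trans ?_ (denomFactor_dvd I y k S l j)
    exact ⟨2 * (I.release N j).den * (S.completion j).den, by unfold denomFactor; ring⟩
  have h1 := speed_num_pos I l hN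
  have h2 : (0 : ℤ) < (I.size N j).den := by exact_mod_cast (I.size N j).den_pos
  have h3 : ((I.size N j).den : ℤ) * (I.speed N l).num ≠ 0 := by positivity
  rw [hc, Int.mul_ediv_cancel_left _ h3]
  have h4 : ((I.speed N l).num : ℚ) ≠ 0 := by exact_mod_cast h1.ne'
  have h5 : ((I.size N j).den : ℚ) ≠ 0 := by exact_mod_cast h2.ne'
  have h6 : ((I.speed N l).den : ℚ) ≠ 0 := by exact_mod_cast (I.speed N l).den_nz
  have h7 : I.size N j = (I.size N j).num / (I.size N j).den := (Rat.num_div_den _).symm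
  have h8 : I.speed N l = (I.speed N l).num / (I.speed N l).den := (Rat.num_div_den _).symm
  generalize (I.size N j).num = pn at *
  generalize (I.size N j).den = pd at *
  generalize (I.speed N l).num = sn at *
  generalize (I.speed N l).den = sd at *
  rw [h7, h8]
  push_cast
  field_simp

theorem row_completion (j : Fin n) : ((rowC I N y k S l j).2.2.1 : ℚ) =
    S.completion j * (ctxC I N y k S l).scale := by
  refine cast_num_mul_div _ (Dvd.dvd.trans ?_ (denomFactor_dvd I y k S l j))
  exact ⟨(I.speed N l).num * (2 * (I.size N j).den * (I.release N j).den), by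
    unfold denomFactor; ring⟩

theorem release_ctxC (j : Fin n) : (CtxC.release (ctxC I N y k S l, jobC I N S j) : ℚ) =
    I.release N j * (ctxC I N y k S l).scale := by
  refine cast_num_mul_div _ (Dvd.dvd.trans ?_ (denomFactor_dvd I y k S l j))
  exact ⟨(I.speed N l).num * (2 * (I.size N j).den * (S.completion j).den), by
    unfold denomFactor; ring⟩

theorem releaseMin_ctxC (hN : 36 ≤ N) (j : Fin n) : ((ctxC I N y k S l).releaseMin : ℚ) =
    base N ^ I.theta * (ctxC I N y k S l).scale := by
  have : Nonempty (Fin n) := ⟨j⟩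
  obtain ⟨j₀, hj₀⟩ := exists_eq_ciInf_of_finite (f := I.releaseExp)
  have e : base N ^ I.theta = I.release N j₀ := by
    rw [Instance.release, hj₀, Instance.theta]
  have hs : (0 : ℚ) < (ctxC I N y k S l).scale := by exact_mod_cast scale_pos I y k S l hN
  have hmem : ∀ j, CtxC.release (ctxC I N y k S l, jobC I N S j) ∈
      (ctxC I N y k S l).jobs.map fun b => CtxC.release (ctxC I N y k S l, b) := fun j =>
    List.mem_map.2 ⟨_, List.mem_map.2 ⟨j, List.mem_finRange j, rfl⟩, rfl⟩
  have hle : ∀ a ∈ (ctxC I N y k S l).jobs.map fun b => CtxC.release (ctxC I N y k S l, b),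
      0 ≤ a ∧ CtxC.release (ctxC I N y k S l, jobC I N S j₀) ≤ a := by
    intro a ha
    obtain ⟨b, hb, rfl⟩ := List.mem_map.1 ha
    obtain ⟨i, -, rfl⟩ := List.mem_map.1 hb
    constructor
    · have : (0 : ℚ) ≤ CtxC.release (ctxC I N y k S l, jobC I N S i) := by
        rw [release_ctxC]
        exact mul_nonneg (release_pos I hN i).le hs.le
      exact_mod_cast this
    · have : (CtxC.release (ctxC I N y k S l, jobC I N S j₀) : ℚ) ≤
          CtxC.release (ctxC I N y k S l, jobC I N S i) := by
        rw [release_ctxC, release_ctxC, ← e]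
        refine mul_le_mul_of_nonneg_right ?_ hs.le
        exact zpow_le_zpow_right₀ (one_lt_base (by omega)).le (theta_le I i)
      exact_mod_cast this
  have h : (ctxC I N y k S l).releaseMin = CtxC.release (ctxC I N y k S l, jobC I N S j₀) := by
    refine le_antisymm (foldl_min_le_of_mem (hmem j₀) _) (le_foldl_min ?_ fun a ha => (hle a ha).2)
    exact le_list_sum_of_mem (fun a ha => (hle a ha).1) (hmem j₀)
  rw [h, release_ctxC, e]

/-- Both sides come from the least i whose unrounded threshold exceeds the release date, and scaling
by a positive number preserves the comparison. -/
theorem row_threshold (hN : 36 ≤ N) (hy : 1 ≤ y) {b : Fin n → ℕ} (j : Fin n)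
    (h1 : I.release N j < base N ^ I.theta * (alpha N y : ℚ) ^ (k + b j * shifts N y))
    (h2 : ∀ i' < b j,
      base N ^ I.theta * (alpha N y : ℚ) ^ (k + i' * shifts N y) ≤ I.release N j) :
    ((rowC I N y k S l j).2.2.2 : ℚ) =
      base N ^ I.theta * (alpha N y : ℚ) ^ (k + b j * shifts N y) * (ctxC I N y k S l).scale := by
  have hs : (0 : ℚ) < (ctxC I N y k S l).scale := by exact_mod_cast scale_pos I y k S l hN
  have hα : (36 : ℤ) ≤ alpha N y := by exact_mod_cast alpha_ge hN hy
  have hα0 : (0 : ℤ) < alpha N y := by omega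
  have hmin := releaseMin_ctxC I y k S l hN j
  have hmin0 : 0 < (ctxC I N y k S l).releaseMin := by
    have : (0 : ℚ) < (ctxC I N y k S l).releaseMin := by
      rw [hmin]; exact mul_pos (zpow_pos (base_pos (by omega)) _) hs
    exact_mod_cast this
  have hA : (2 : ℤ) ≤ (alpha N y : ℤ) ^ shifts N y := by
    calc (2 : ℤ) ≤ (alpha N y : ℤ) ^ 1 := by rw [pow_one]; omega
      _ ≤ _ := pow_le_pow_right₀ (by omega) (by have := shifts_ge hN hy; omega)
  obtain ⟨i, h3, h4, h5⟩ := thr_spec (r := CtxC.release (ctxC I N y k S l, jobC I N S j)) hA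
    (show 1 ≤ (ctxC I N y k S l).releaseMin * (alpha N y : ℤ) ^ k from
      Int.add_one_le_iff.2 (mul_pos hmin0 (pow_pos hα0 k)))
  have hval : ∀ i : ℕ, (((ctxC I N y k S l).releaseMin * (alpha N y : ℤ) ^ k *
      ((alpha N y : ℤ) ^ shifts N y) ^ i : ℤ) : ℚ) =
      base N ^ I.theta * (alpha N y : ℚ) ^ (k + i * shifts N y) * (ctxC I N y k S l).scale := by
    intro i
    push_cast
    rw [hmin, pow_add, mul_comm i, pow_mul]
    ring
  have hcmp : ∀ i : ℕ, (ctxC I N y k S l).releaseMin * (alpha N y : ℤ) ^ k *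
      ((alpha N y : ℤ) ^ shifts N y) ^ i ≤ CtxC.release (ctxC I N y k S l, jobC I N S j) ↔
      base N ^ I.theta * (alpha N y : ℚ) ^ (k + i * shifts N y) ≤ I.release N j := by
    intro i
    rw [← Int.cast_le (R := ℚ), hval, release_ctxC]
    exact mul_le_mul_iff_left₀ hs
  have hi : i = b j := by
    rcases lt_trichotomy i (b j) with h | h | h
    · exact absurd ((hcmp i).2 (h2 i h)) (not_le.2 h4)
    · exact h
    · exact absurd ((hcmp _).1 (h5 _ h)) (not_le.2 h1)
  rw [← hi, ← hval, ← h3]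
  rfl

end Bridge

/-! ### From the hypotheses on the given schedules to `MachineData`. -/

section Combine

variable {n m : ℕ} (I : Instance n m) {N y : ℕ} (k : ℕ) (S : Schedule n m) (l : Fin m)

/-- The real threshold of the band with index `i`. -/
noncomputable def bandThr (N y i : ℕ) : ℚ := base N ^ I.theta * (alpha N y : ℚ) ^ (k + i * shifts N y)

section

variable (hN : 36 ≤ N) (hy : 1 ≤ y)
include hN hy

theorem bandThr_pos (i : ℕ) : 0 < bandThr I k N y i := by
  have h1 : (36 : ℚ) ≤ alpha N y := by exact_mod_cast alpha_ge hN hy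
  exact mul_pos (zpow_pos (base_pos (by omega)) _) (by positivity)

theorem bandThr_le_Psi (i : ℕ) : bandThr I k N y i ≤ Psi I N y (i : ℤ) k := by
  have hb := base_pos (N := N) (by omega)
  rw [Psi_natCast, zpow_add₀ hb.ne', bandThr]
  exact mul_le_mul_of_nonneg_left (pow_le_zpow_ceilLog hN hy _) (zpow_pos hb _).le

theorem Psi_le_base_mul_bandThr (i : ℕ) : Psi I N y (i : ℤ) k ≤ base N * bandThr I k N y i := by
  have hb := base_pos (N := N) (by omega)
  rw [Psi_natCast, zpow_add₀ hb.ne', bandThr, mul_left_comm]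
  exact mul_le_mul_of_nonneg_left (zpow_ceilLog_le hN hy _) (zpow_pos hb _).le

theorem Psi_le_two_mul_bandThr (i : ℕ) : Psi I N y (i : ℤ) k ≤ 2 * bandThr I k N y i := by
  have h1 := Psi_le_base_mul_bandThr I k hN hy i
  have h2 := base_le hN
  have h3 := bandThr_pos I k hN hy i
  nlinarith

/-- Raising k to k+1 supplies the factor α, and the ceiling in Ψ only increases the right side. -/
theorem alpha_mul_bandThr_le_Psi {i i' : ℕ} (h : i < i') :
    alpha N y * bandThr I k N y i ≤ Psi I N y ((i' : ℤ) - 1) (k + 1) := by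
  obtain ⟨c, rfl⟩ : ∃ c, i' = c + 1 := ⟨i' - 1, by omega⟩
  have h1 : i * shifts N y ≤ c * shifts N y := Nat.mul_le_mul_right _ (by omega)
  rw [Psi_succ_sub_one]
  refine le_trans ?_ (Psi_le_Psi I hN hy (i := i) (i' := c) (a := k + 1) (a' := k + 1) (by omega))
  refine le_trans (le_of_eq ?_) (bandThr_le_Psi I (k + 1) hN hy i)
  rw [bandThr, bandThr, add_right_comm, pow_succ]
  ring

theorem alpha_mul_bandThr_le {i i' : ℕ} (h : i < i') :
    alpha N y * bandThr I k N y i ≤ bandThr I k N y i' := by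
  have h1 : (36 : ℚ) ≤ alpha N y := by exact_mod_cast alpha_ge hN hy
  have h2 := shifts_ge hN hy
  have h3 : (i + 1) * shifts N y ≤ i' * shifts N y := Nat.mul_le_mul_right _ h
  rw [add_mul] at h3
  have h4 : (alpha N y : ℚ) ^ (k + i * shifts N y + 1) ≤ (alpha N y : ℚ) ^ (k + i' * shifts N y) :=
    pow_le_pow_right₀ (by linarith) (by omega)
  calc alpha N y * bandThr I k N y i = base N ^ I.theta * (alpha N y : ℚ) ^ (k + i * shifts N y + 1) := by
        rw [bandThr, pow_succ]; ring
    _ ≤ _ := mul_le_mul_of_nonneg_left h4 (zpow_pos (base_pos (by omega)) _).le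

end

/-- Bernoulli's inequality gives (1+1/N)^y ≥ 1 + y/N, and y/N ≥ N¹¹. -/
theorem le_base_pow (hN : 36 ≤ N) (hy : N ^ 12 < y) : 54 ≤ base N ^ y := by
  have hNq : (36 : ℚ) ≤ N := by exact_mod_cast hN
  have h1 := one_add_mul_le_pow (a := 1 / (N : ℚ)) (by
    have : (0 : ℚ) ≤ 1 / N := by positivity
    linarith) y
  have h2 : (N : ℚ) ^ 12 ≤ y := by exact_mod_cast hy.le
  have h3 : (36 : ℚ) ^ 11 ≤ (N : ℚ) ^ 11 := pow_le_pow_left₀ (by norm_num) hNq 11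
  have h4 : (N : ℚ) ^ 11 ≤ y * (1 / N) := by
    rw [mul_one_div, le_div_iff₀ (by linarith)]
    calc (N : ℚ) ^ 11 * (N : ℚ) = (N : ℚ) ^ 12 := by ring
      _ ≤ (y : ℚ) := h2
  have h5 : (54 : ℚ) ≤ 36 ^ 11 := by norm_num
  unfold base
  linarith

/-- The jobs of the machine `l` in integral time. -/
theorem exists_machineData (hN : 36 ≤ N) (hy : N ^ 12 < y) (hG : GoodFamily I N y k S) :
    ∃ M : MachineData (Fin n), M.J = Finset.univ.filter (fun j => S.machine j = l) ∧
      M.idx = (fun j : Fin n => ((j : ℕ) : ℤ)) ∧ M.T = (fun j => (rowC I N y k S l j).2.1) ∧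
      M.C = (fun j => (rowC I N y k S l j).2.2.1) ∧
      M.B = (fun j => (rowC I N y k S l j).2.2.2) ∧
      M.d = (fun j => I.weight N j / (rowC I N y k S l j).2.1) ∧ M.N = N ∧ M.y = y ∧
      M.D = (ctxC I N y k S l).scale ∧
      ∀ j ∈ M.J, releaseK I N y k j * (ctxC I N y k S l).scale ≤
        (min (M.C j - M.T j) (2 * M.B j) : ℤ) := by
  have hy1 : 1 ≤ y := by omega
  obtain ⟨b, hb⟩ := exists_bandIdx I hN hy1 k
  set D : ℤ := (ctxC I N y k S l).scale with hDdef
  have hD : (0 : ℚ) < D := by exact_mod_cast scale_pos I y k S l hN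
  have hNq : (36 : ℚ) ≤ N := by exact_mod_cast hN
  have hyq : (0 : ℚ) < y := by exact_mod_cast hy1
  set T : Fin n → ℤ := fun j => (rowC I N y k S l j).2.1 with hTdef
  set C : Fin n → ℤ := fun j => (rowC I N y k S l j).2.2.1 with hCdef
  set B : Fin n → ℤ := fun j => (rowC I N y k S l j).2.2.2 with hBdef
  set J : Finset (Fin n) := Finset.univ.filter (fun j => S.machine j = l) with hJdef
  have hJ : ∀ j ∈ J, S.machine j = l := fun j hj => (Finset.mem_filter.1 hj).2
  have hT : ∀ j, (T j : ℚ) = I.size N j / I.speed N l * D := fun j => row_time I y k S l hN j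
  have hC : ∀ j, (C j : ℚ) = S.completion j * D := fun j => row_completion I y k S l j
  have hB : ∀ j, (B j : ℚ) = bandThr I k N y (b j) * D := fun j =>
    row_threshold I y k S l hN hy1 j (hb j).1.1 (hb j).1.2
  have hstart : ∀ j, ((C j - T j : ℤ) : ℚ) = startOn I N l S.completion j * D := fun j => by
    push_cast; rw [hT, hC, startOn]; ring
  have hT0 : ∀ j, 0 < T j := fun j => by
    have : (0 : ℚ) < T j := by
      rw [hT]; exact mul_pos (div_pos (size_pos I hN j) (speed_pos I hN l)) hD
    exact_mod_cast this
  have hmem : ∀ j, j ∈ band I N y k (b j) := fun j => ((hb j).2 _).2 rfl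
  have hK : ∀ j, Psi I N y ((b j : ℤ) - 1) (k + 1) ≤ releaseK I N y k j ∧
      releaseK I N y k j < Psi I N y (b j : ℤ) k := fun j => (Finset.mem_filter.1 (hmem j)).2
  have hjobs : ∀ j ∈ J, j ∈ S.jobsOn (band I N y k (b j)) l := fun j hj =>
    Finset.mem_filter.2 ⟨hmem j, hJ j hj⟩
  have hrel : ∀ j ∈ J, releaseK I N y k j ≤ startOn I N l S.completion j := fun j hj =>
    ((hG (b j)).1.1 l).1 j (hjobs j hj)
  have hBlt : ∀ i j, B i < B j → b i < b j := by
    intro i j h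
    by_contra hle
    have h1 : (B i : ℚ) < B j := by exact_mod_cast h
    rw [hB, hB] at h1
    have h2 := lt_of_mul_lt_mul_right h1 hD.le
    rcases (not_lt.1 hle).eq_or_lt with h3 | h3
    · rw [h3] at h2; exact lt_irrefl _ h2
    · have h4 := alpha_mul_bandThr_le I k hN hy1 h3
      have h5 : (36 : ℚ) ≤ alpha N y := by exact_mod_cast alpha_ge hN hy1
      have h6 := bandThr_pos I k hN hy1 (b j)
      nlinarith
  have hBeq : ∀ i j, B i = B j → b i = b j := by
    have key : ∀ i j, B i = B j → ¬ b i < b j := by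
      intro i j h h3
      have h1 : (B i : ℚ) = B j := by exact_mod_cast h
      rw [hB, hB] at h1
      have h2 := mul_right_cancel₀ hD.ne' h1
      have h4 := alpha_mul_bandThr_le I k hN hy1 h3
      have h5 : (36 : ℚ) ≤ alpha N y := by exact_mod_cast alpha_ge hN hy1
      have h6 := bandThr_pos I k hN hy1 (b i)
      nlinarith
    intro i j h
    have h1 := key i j h
    have h2 := key j i h.symm
    omega
  have hBpos : ∀ j, 0 < B j := fun j => by
    have : (0 : ℚ) < B j := by rw [hB]; exact mul_pos (bandThr_pos I k hN hy1 _) hD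
    exact_mod_cast this
  have hαq : ((y : ℤ) * (N : ℤ) ^ 34 : ℤ) = (alpha N y : ℤ) := by simp [alpha]
  refine ⟨{ J := J
            idx := fun j : Fin n => ((j : ℕ) : ℤ)
            T := T
            C := C
            B := B
            d := fun j => I.weight N j / T j
            N := N
            y := y
            D := D
            hN := by exact_mod_cast hN
            hy := by exact_mod_cast hy1
            hD := pow_le_scale I y k S l hN
            idx_nonneg := fun j _ => by positivity
            idx_lt := fun j _ => natCast_lt_scale I y k S l hN j
            idx_inj := fun i _ j _ h => Fin.ext (by exact_mod_cast h)
            hT := fun j _ => hT0 j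
            hB := fun j _ => hBpos j
            hs := ?_
            hd := ?_
            disj := ?_
            size_le := ?_
            le_start := ?_
            le_thr := ?_
            decay := ?_ }, rfl, rfl, rfl, rfl, rfl, rfl, rfl, rfl, rfl, ?_⟩
  · intro j hj
    have h1 : (0 : ℚ) < ((C j - T j : ℤ) : ℚ) := by
      rw [hstart]
      refine mul_pos (lt_of_lt_of_le ?_ ((hK j).1.trans (hrel j hj))) hD
      exact zpow_pos (base_pos (by omega)) _
    exact_mod_cast h1
  · intro j _
    have h1 : (0 : ℚ) < T j := by exact_mod_cast hT0 j
    exact (div_pos (weight_pos I hN j) h1).le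
  · intro i hi j hj hBij hne
    have h1 := hjobs i hi
    rw [hBeq i j hBij] at h1
    have h2 := ((hG (b j)).1.1 l).2 i h1 j (hjobs j hj) hne
    have hcast : ∀ i j, S.completion i ≤ startOn I N l S.completion j → C i ≤ C j - T j := by
      intro i j h
      have h3 : (C i : ℚ) ≤ ((C j - T j : ℤ) : ℚ) := by
        rw [hstart, hC]; exact mul_le_mul_of_nonneg_right h hD.le
      exact_mod_cast h3
    exact h2.imp (hcast i j) (hcast j i)
  · intro j hj
    have h1 := (hG (b j)).2.2 j (hmem j)
    rw [hJ j hj] at h1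
    have hσ := speed_pos I hN l
    have h2 : I.size N j / I.speed N l ≤ 2 * bandThr I k N y (b j) * (y * (N : ℚ) ^ 25) := by
      rw [div_le_iff₀ hσ]
      refine h1.trans ?_
      have := Psi_le_two_mul_bandThr I k hN hy1 (b j)
      gcongr
    have h3 : (T j : ℚ) ≤ ((2 * B j * y * (N : ℤ) ^ 25 : ℤ) : ℚ) := by
      push_cast
      rw [hT, hB]
      calc I.size N j / I.speed N l * (D : ℚ)
          ≤ 2 * bandThr I k N y (b j) * (y * (N : ℚ) ^ 25) * D := by gcongr
        _ = _ := by ring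
    exact_mod_cast h3
  · intro i hi j hj hlt
    have h1 := (alpha_mul_bandThr_le_Psi I k hN hy1 (hBlt i j hlt)).trans ((hK j).1.trans (hrel j hj))
    rw [hαq]
    have h2 : (((alpha N y : ℤ) * B i : ℤ) : ℚ) ≤ ((C j - T j : ℤ) : ℚ) := by
      rw [hstart]
      push_cast
      rw [hB, ← mul_assoc]
      exact mul_le_mul_of_nonneg_right h1 hD.le
    exact_mod_cast h2
  · intro i hi j hj hlt
    have h1 := alpha_mul_bandThr_le I k hN hy1 (hBlt i j hlt)
    rw [hαq]
    have h2 : (((alpha N y : ℤ) * B i : ℤ) : ℚ) ≤ B j := by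
      push_cast
      rw [hB, hB, ← mul_assoc]
      exact mul_le_mul_of_nonneg_right h1 hD.le
    exact_mod_cast h2
  · intro i hi j hj hBij hlate hsep
    rw [hαq] at hlate
    obtain ⟨Ψ', ⟨-, -, hΨ'⟩, -, hdec⟩ := (hG (b i)).2.1
    have hbp := bandThr_pos I k hN hy1 (b i)
    have h1 := hmem j
    rw [← hBeq i j hBij] at h1
    have hα : (36 : ℚ) ≤ alpha N y := by exact_mod_cast alpha_ge hN hy1
    have hbase := base_le hN
    have hb0 := base_pos (N := N) (by omega)
    have h2 : Ψ' / 2 ≤ S.start I N i := by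
      rw [Schedule.start, hJ i hi]
      have h3 : ((2 * (alpha N y : ℤ) * B i : ℤ) : ℚ) ≤ ((3 * (C i - T i) : ℤ) : ℚ) := by
        exact_mod_cast hlate
      rw [Int.cast_mul, Int.cast_mul, Int.cast_mul, hstart, hB] at h3
      push_cast at h3
      have h4 : 2 * (alpha N y : ℚ) * bandThr I k N y (b i) ≤ 3 * startOn I N l S.completion i := by
        refine le_of_mul_le_mul_right (a := (D : ℚ)) ?_ hD
        linarith
      have h5 := Psi_le_base_mul_bandThr I k hN hy1 (b i)
      -- This is the origin of the constant 2/3 in `Late`: Ψ' < (1+δ)Ψα ≤ (1+δ)²αB ≤ 4αB/3, so a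
      -- late job starts at Ψ'/2 or later.
      have h6 : Ψ' ≤ bandThr I k N y (b i) * alpha N y * (4 / 3) := by
        calc Ψ' ≤ Psi I N y (b i) k * (alpha N y * base N) := hΨ'.le
          _ ≤ base N * bandThr I k N y (b i) * (alpha N y * base N) := by gcongr
          _ = bandThr I k N y (b i) * alpha N y * (base N * base N) := by ring
          _ ≤ bandThr I k N y (b i) * alpha N y * (37 / 36 * (37 / 36)) := by gcongr
          _ ≤ _ := by
            have : (0 : ℚ) ≤ bandThr I k N y (b i) * alpha N y := by positivity
            nlinarith
      linarith
    have h3 : S.completion i + Psi I N y (b i) k * (y * (N : ℚ) ^ 28) ≤ S.completion j := by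
      have h4 : ((C i + 2 * B i * y * (N : ℤ) ^ 28 : ℤ) : ℚ) ≤ (C j : ℚ) := by exact_mod_cast hsep
      push_cast at h4
      rw [hC, hC, hB] at h4
      have h5 : S.completion i + 2 * bandThr I k N y (b i) * (y * (N : ℚ) ^ 28) ≤ S.completion j := by
        refine le_of_mul_le_mul_right (a := (D : ℚ)) ?_ hD
        linarith
      have h6 := Psi_le_two_mul_bandThr I k hN hy1 (b i)
      have h7 : Psi I N y (b i) k * (y * (N : ℚ) ^ 28) ≤
        2 * bandThr I k N y (b i) * (y * (N : ℚ) ^ 28) := by gcongr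
      linarith
    have h4 := hdec i (hmem i) j h1 ((hJ i hi).trans (hJ j hj).symm) h2 h3
    have hQ := le_base_pow hN hy
    have hdens : ∀ j, I.weight N j / (T j : ℚ) = I.density N j * (I.speed N l / D) := by
      intro j
      have := (size_pos I hN j).ne'
      have := (speed_pos I hN l).ne'
      rw [hT, Instance.density]
      field_simp
    have hdj : 0 < I.density N i := div_pos (weight_pos I hN i) (size_pos I hN i)
    change 54 * (I.weight N j / (T j : ℚ)) ≤ I.weight N i / (T i : ℚ)
    rw [hdens, hdens, ← mul_assoc]
    refine mul_le_mul_of_nonneg_right ?_ (div_pos (speed_pos I hN l) hD).le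
    rw [mul_one_div, le_div_iff₀ (by positivity)] at h4
    have hdj0 : 0 < I.density N j := div_pos (weight_pos I hN j) (size_pos I hN j)
    nlinarith
  · intro j hj
    change releaseK I N y k j * (D : ℚ) ≤ ((min (C j - T j) (2 * B j) : ℤ) : ℚ)
    rw [Int.cast_min, le_min_iff]
    constructor
    · rw [hstart]
      exact mul_le_mul_of_nonneg_right (hrel j hj) hD.le
    · have h1 := (hK j).2.le.trans (Psi_le_two_mul_bandThr I k hN hy1 (b j))
      push_cast
      rw [hB, ← mul_assoc]
      exact mul_le_mul_of_nonneg_right h1 hD.le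

end Combine

/-! ### The result of the algorithm -/

section Output

variable {n m : ℕ} (I : Instance n m) {N y : ℕ} (k : ℕ) (S : Schedule n m) (l : Fin m)

/-- The scaled completion times that the algorithm computes. -/
def finishC (N y : ℕ) (j : Fin n) : ℤ := CtxC.finish (ctxC I N y k S l, rowC I N y k S l j)

theorem isFinish_finishC {M : MachineData (Fin n)}
    (hJ : M.J = Finset.univ.filter (fun j => S.machine j = l))
    (hidx : M.idx = fun j : Fin n => ((j : ℕ) : ℤ)) (hT : M.T = fun j => (rowC I N y k S l j).2.1)
    (hC : M.C = fun j => (rowC I N y k S l j).2.2.1)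
    (hB : M.B = fun j => (rowC I N y k S l j).2.2.2)
    (hN : M.N = N) (hy : M.y = y) (hD : M.D = (ctxC I N y k S l).scale) :
    M.IsFinish (finishC I k S l N y) := by
  have hsum : ∀ f : RowC → ℤ, ((ctxC I N y k S l).rows.map f).sum =
      ∑ j ∈ M.J, f (rowC I N y k S l j) := by
    intro f
    rw [rows_ctxC, List.map_map, sum_map_finRange_filter, hJ]
    rfl
  have hal : (ctxC I N y k S l).parAlpha = M.al := by
    rw [MachineData.al, hN, hy]; rfl
  have hparN : (ctxC I N y k S l).parN = M.N := hN.symm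
  have hvol : ∀ j, CtxC.volume (ctxC I N y k S l, rowC I N y k S l j) = M.vol j := by
    intro j
    rw [CtxC.volume, hsum, MachineData.vol, hT, hC, hB]
    simp only [hal]
  have hkey : ∀ j, CtxC.key (ctxC I N y k S l, rowC I N y k S l j) = M.key j := by
    intro j
    rw [CtxC.key, hvol, MachineData.key, MachineData.kap, hC, hB, hidx, ← hD, hal, hparN]
    rfl
  have hchain : ∀ i j, CtxC.chain ((ctxC I N y k S l, rowC I N y k S l i), rowC I N y k S l j) =
      M.chain i j := by
    intro i j
    rw [CtxC.chain, hsum, MachineData.chain, hT, hC, hB]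
    simp only [hkey]
  have hfin : ∀ j, finishC I k S l N y j =
      (((ctxC I N y k S l).rows.map fun f =>
        CtxC.chain ((ctxC I N y k S l, f), rowC I N y k S l j))).foldl max 0 := fun j => rfl
  have hmem : ∀ i ∈ M.J, rowC I N y k S l i ∈ (ctxC I N y k S l).rows := by
    intro i hi
    rw [hJ] at hi
    rw [rows_ctxC]
    exact List.mem_map.2 ⟨i, List.mem_filter.2 ⟨List.mem_finRange i,
      decide_eq_true (Finset.mem_filter.1 hi).2⟩, rfl⟩
  refine ⟨fun i hi j _ => ?_, fun j _ => ?_⟩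
  · rw [hfin, ← hchain]
    exact le_foldl_max_of_mem (List.mem_map.2 ⟨_, hmem i hi, rfl⟩) _
  · rw [hfin]
    refine (foldl_max_mem _ 0).imp_right fun h => ?_
    obtain ⟨f, hf, he⟩ := List.mem_map.1 h
    rw [rows_ctxC] at hf
    obtain ⟨i, hi, rfl⟩ := List.mem_map.1 hf
    refine ⟨i, ?_, he.symm.trans (hchain i j)⟩
    rw [hJ]
    exact Finset.mem_filter.2 ⟨Finset.mem_univ _, of_decide_eq_true (List.mem_filter.1 hi).2⟩

/-- aD+1 is coprime to D, so the fraction is in lowest terms and its canonical encoding is obtained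
without computing a greatest common divisor. This is why the completion times are shifted by 1/D².
-/
theorem encRat_div_sq {a D : ℤ} (hD : 0 < D) :
    encRat ((a * D + 1 : ℚ) / (D * D)) = enc ((a * D + 1, D * D) : RatC) := by
  have hcop : Nat.Coprime (a * D + 1).natAbs (D * D).natAbs := by
    rw [← Int.isCoprime_iff_nat_coprime]
    have h : IsCoprime (a * D + 1) D := ⟨1, -a, by ring⟩
    exact h.mul_right h
  have h1 := Rat.num_div_eq_of_coprime (mul_pos hD hD) hcop
  have h2 := Rat.den_div_eq_of_coprime (mul_pos hD hD) hcop
  push_cast at h1 h2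
  rw [encRat, h1, h2]
  rfl

/-- Every job lies in some band, because the thresholds are unbounded and raised dates never fall
into a gap between bands. -/
theorem allJobsOn_eq (hN : 36 ≤ N) (hy : 1 ≤ y) :
    allJobsOn I N y k S l = Finset.univ.filter (fun j => S.machine j = l) := by
  classical
  obtain ⟨b, hb⟩ := exists_bandIdx I hN hy k
  ext j
  rw [allJobsOn, Finset.mem_filter, Finset.mem_filter]
  refine and_congr_right fun _ => ⟨?_, fun h => ⟨b j, ?_⟩⟩
  · rintro ⟨i, hi⟩
    exact (Finset.mem_filter.1 hi).2
  · exact Finset.mem_filter.2 ⟨((hb j).2 _).2 rfl, h⟩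

theorem finsum_cost_eq (hN : 36 ≤ N) (hy : 1 ≤ y) :
    ∑ᶠ i : ℕ, cost I N (S.jobsOn (band I N y k i) l) S.completion =
      cost I N (Finset.univ.filter (fun j => S.machine j = l)) S.completion := by
  obtain ⟨b, hb⟩ := exists_bandIdx I hN hy k
  have he : ∀ i, S.jobsOn (band I N y k i) l =
      (Finset.univ.filter (fun j => S.machine j = l)).filter fun j => b j = i := by
    intro i
    ext j
    simp only [Schedule.jobsOn, Finset.mem_filter, Finset.mem_univ, true_and, (hb j).2 i]
    rw [and_comm, eq_comm (a := i)]
  have hmaps : ∀ j ∈ Finset.univ.filter (fun j => S.machine j = l),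
      b j ∈ Finset.range (Finset.univ.sup b + 1) := fun j _ =>
    Finset.mem_range.2 (Nat.lt_succ_of_le (Finset.le_sup (Finset.mem_univ j)))
  rw [finsum_eq_sum_of_support_subset (s := Finset.range (Finset.univ.sup b + 1))]
  · simp only [he, cost]
    exact Finset.sum_fiberwise_of_maps_to hmaps _
  · intro i hi
    by_contra hcon
    refine hi ?_
    simp only [he, cost]
    refine Finset.sum_eq_zero fun j hj => ?_
    obtain ⟨h1, rfl⟩ := Finset.mem_filter.1 hj
    exact absurd (hmaps j h1) (by simpa using hcon)

theorem enc_output_ctxC (hN : 36 ≤ N) (hy : 1 ≤ y) :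
    enc (ctxC I N y k S l).output = encOutput (allJobsOn I N y k S l) (fun j =>
      ((finishC I k S l N y j * (ctxC I N y k S l).scale + 1 : ℚ) /
        ((ctxC I N y k S l).scale * (ctxC I N y k S l).scale))) := by
  have hD := scale_pos I y k S l hN
  rw [CtxC.output, rows_ctxC, List.map_map]
  change encList (List.map enc _) = _
  rw [encOutput, List.map_map]
  congr 1
  have hf : (List.finRange n).filter (fun j => decide (S.machine j = l)) =
      (List.finRange n).filter (fun j => decide (j ∈ allJobsOn I N y k S l)) := by
    refine List.filter_congr fun j _ => ?_
    rw [decide_eq_decide, allJobsOn_eq I k S l hN hy]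
    simp
  rw [hf]
  refine List.map_congr_left fun j _ => ?_
  rw [encRat_div_sq hD]
  rfl

end Output

end Sched

/-! ### Assembly of program, feasibility and cost bound. -/

theorem mainTheorem6 :
    ∃ (P : Sched.Prog) (c : ℕ) (f : ℕ → ℕ → ℕ),
      ∀ N y : ℕ, 36 ≤ N → N ^ 12 < y →
      ∀ k : ℕ, k < Sched.shifts N y →
      ∀ (n m : ℕ) (I : Sched.Instance n m) (S : Sched.Schedule n m),
        Sched.GoodFamily I N y k S →
        ∀ l : Fin m, ∃ (C : Fin n → ℚ) (t : ℕ),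
          P.Runs (Sched.encInput I N y k S l)
            (Sched.encOutput (Sched.allJobsOn I N y k S l) C) t ∧
          t ≤ f N y * (Sched.encInput I N y k S l).size ^ c ∧
          Sched.FeasibleOn I N (Sched.releaseK I N y k) l (Sched.allJobsOn I N y k S l) C ∧
          Sched.cost I N (Sched.allJobsOn I N y k S l) C ≤
            (1 + 1 / (N : ℚ)) ^ 2 *
              ∑ᶠ i : ℕ, Sched.cost I N (S.jobsOn (Sched.band I N y k i) l) S.completion := by
  obtain ⟨P, c, f, hP⟩ := Sched.exists_output_runs
  refine ⟨P, c, f, fun N y hN hy k hk n m I S hG l => ?_⟩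
  have hy1 : 1 ≤ y := by omega
  obtain ⟨t, h1, h2⟩ := hP N y k hk ((l : ℕ) : ℤ) ((List.finRange m).map
    (fun a => Sched.ratC (I.speed N a))) ((List.finRange n).map (Sched.jobC I N S))
  obtain ⟨M, hJ, hidx, hT, hC, hB, hd, hMN, hMy, hMD, hrel⟩ :=
    Sched.exists_machineData I k S l hN hy hG
  have hF := Sched.isFinish_finishC I k S l hJ hidx hT hC hB hMN hMy hMD
  set F := Sched.finishC I k S l N y with hFdef
  have hD : (0 : ℚ) < M.D := by exact_mod_cast M.D_pos
  have hTq : ∀ j, (M.T j : ℚ) = I.size N j / I.speed N l * M.D := fun j => by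
    rw [hT, hMD]; exact Sched.row_time I y k S l hN j
  have hCq : ∀ j, (M.C j : ℚ) / M.D = S.completion j := fun j => by
    rw [div_eq_iff hD.ne', hC, hMD]; exact Sched.row_completion I y k S l j
  have hw : ∀ j ∈ M.J, M.d j * M.T j = I.weight N j := fun j hj => by
    have h3 : (M.T j : ℚ) ≠ 0 := by exact_mod_cast (M.hT j hj).ne'
    rw [hT] at h3 ⊢
    rw [hd]
    exact div_mul_cancel₀ _ h3
  -- All starts and completions move by the same 1/D² from the integral schedule, so disjointness is
  -- preserved and release dates remain respected.
  have hstart : ∀ j, Sched.startOn I N l (M.completion F) j =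
      (F j - M.T j : ℤ) / M.D + 1 / (M.D * M.D) := fun j => by
    rw [Sched.startOn, Sched.MachineData.completion_eq]
    push_cast
    rw [sub_div, hTq, mul_div_cancel_right₀ _ hD.ne']
    ring
  have hall := Sched.allJobsOn_eq I k S l hN hy1
  have hout := Sched.enc_output_ctxC I k S l hN hy1
  rw [← hMD] at hout
  refine ⟨M.completion F, t, ?_, ?_, ?_, ?_⟩
  · rw [← Sched.enc_inpC]
    exact hout ▸ h1
  · rw [← Sched.enc_inpC]
    exact h2
  · rw [hall, ← hJ]
    constructor
    · intro j hj
      have h3 := hrel j hj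
      have h4 : ((min (M.C j - M.T j) (2 * M.B j) : ℤ) : ℚ) ≤ ((F j - M.T j : ℤ) : ℚ) := by
        exact_mod_cast hF.start_le hj
      rw [← hMD, ← le_div_iff₀ hD] at h3
      rw [hstart]
      have h5 : (0 : ℚ) < 1 / (M.D * M.D) := by positivity
      have h6 := div_le_div_of_nonneg_right h4 hD.le
      linarith
    · intro i hi j hj hne
      have hcast : ∀ i j, F i ≤ F j - M.T j →
          M.completion F i ≤ Sched.startOn I N l (M.completion F) j := by
        intro i j h
        have h3 : (F i : ℚ) ≤ ((F j - M.T j : ℤ) : ℚ) := by exact_mod_cast h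
        rw [hstart, Sched.MachineData.completion_eq]
        have := div_le_div_of_nonneg_right h3 hD.le
        linarith
      exact (hF.disjoint hi hj hne).imp (hcast i j) (hcast j i)
  · rw [hall, Sched.finsum_cost_eq I k S l hN hy1, ← hJ]
    have h3 := hF.cost_le hMN
    simp only [hCq] at h3
    have h4 : ∀ C : Fin n → ℚ, ∑ j ∈ M.J, M.d j * M.T j * Sched.roundUp N (C j) =
        Sched.cost I N M.J C := fun C => Finset.sum_congr rfl fun j hj => by rw [hw j hj]
    rwa [h4, h4] at h3
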